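/- Let $n\ge 1$ and let $S^{2n+1}$ be the unit sphere of $\mathbb C^{n+1}$ with its surface measure $dS$. Let $\Delta_S$ be the restriction to $S^{2n+1}$ of $\Delta=2\sum_{j=1}^{n+1}\frac{\partial^2}{\partial z_j\partial\bar z_j}$ (applied to extensions constant on rays), let $Tf(z)=\frac{d}{ds}\big|_{s=0}f(e^{is}z)$, and let $\Delta_C=\Delta_S-\frac12T^2$ be the Cauchy–Riemann sub-Laplacian of $S^{2n+1}$. Fix $w\in S^{2n+1}$. There is a heat kernel of $\Delta_C$ with pole $w$, that is, a real $C^2$ function $P_C(t,z)$ on $(0,\infty)\times S^{2n+1}$ with $\partial P_C/\partial t=\Delta_CP_C$ and $\lim_{t\to0+}\int_{S^{2n+1}}P_C(t,z)f(z)\,dS(z)=f(w)$ for all smooth $f$. Let $P_C$ be such a heat kernel, and write $z\cdot\overline w=\cos\vartheta_1\,e^{i\varphi_1}$ with $0\le\vartheta_1\le\pi/2$, $|\varphi_1|\le\pi$. For $u\in\mathbb R$ let $\kappa=\kappa(\vartheta_1,\varphi_1,u)=i\arccos\big(\cos\vartheta_1\cosh(u+i\varphi_1)\big)$ with the principal branch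 of $\arccos$ (so $\cosh\kappa=\cos\vartheta_1\cosh(u+i\varphi_1)$ and $0\le\operatorname{Im}\kappa\le\pi$), let $$V_n(\kappa,t)=e^{-\frac{\kappa^2}{2t}}\Big(\frac{t}{\sinh\kappa}\frac{\partial}{\partial\kappa}\Big)^{n-1}\Big(e^{\frac{\kappa^2}{2t}}\frac{\kappa}{\sinh\kappa}\Big),\qquad I_k=e^{-\frac{u^2-(\kappa+i2k\pi)^2}{2t}}\,V_n(\kappa+i2k\pi,t)\quad(k\in\mathbb Z).$$ Then for every $t>0$: 1) for every $\delta'>0$, $$P_C=\frac{e^{\frac{n^2}{2}t}}{(2\pi t)^{n+1}}\Big\{\int_{-\infty}^{\infty}I_0\,du+\sum_{k=1}^\infty\int_{-\infty}^\infty\big(I_k+I_{-k}\big)\,du\Big\}$$ at all points with $0\le\vartheta_1\le\pi/2$, $|\varphi_1|\le\pi-\delta'$; 2) for every $\delta>0$, $$P_C=\frac{e^{\frac{n^2}{2}t}}{(2\pi t)^{n+1}}\sum_{k=0}^\infty\int_{-\infty}^\infty\big(I_k+I_{-k-1}\big)\,du$$ at all points with $0\le\vartheta_1\le\pi/2$,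 $\delta<|\varphi_1|\le\pi$. On the indicated sets the integrals converge absolutely, and both series converge absolutely and uniformly, even after the integrands $I_0$, $I_k+I_{-k}$ (in 1) and $I_k+I_{-k-1}$ (in 2) are replaced by their absolute values. In particular these formulas represent $P_C$ across the sets $\varphi_1=0$ (by 1) and $\varphi_1=\pm\pi$ (by 2), including $\vartheta_1=0$. -/

import Mathlib

open Set Filter Topology MeasureTheory
open scoped ContDiff

noncomputable section

namespace CRSphere

/-- The space `ℂ^{n+1}` with its Hermitian norm; the sphere `S^{2n+1}` is its unit sphere. -/
abbrev Cn (n : ℕ) : Type := EuclideanSpace ℂ (Fin (n + 1))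

/-- The extension of a function on the unit sphere that is constant on rays.
Only the values of `f` on the unit sphere matter. -/
def radialExt (n : ℕ) (f : Cn n → ℝ) : Cn n → ℝ :=
  fun x => f ((‖x‖⁻¹ : ℝ) • x)

/-- The operator `Δ_S` on the unit sphere: the restriction to the sphere of
`Δ = 2 ∑ ∂²/∂z_j ∂z̄_j`, which is half of the Euclidean Laplacian of `ℂ^{n+1} = ℝ^{2n+2}`,
applied to the extension that is constant on rays. -/
def sphereLaplacian (n : ℕ) (f : Cn n → ℝ) (z : Cn n) : ℝ :=
  (1 / 2) * Laplacian.laplacian (radialExt n f) z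

/-- The second derivative `T² f`, where `T = ∑ ∂/∂φ_j` generates the rotations `z ↦ e^{is} z`. -/
def rotationSq (n : ℕ) (f : Cn n → ℝ) (z : Cn n) : ℝ :=
  iteratedDeriv 2 (fun s : ℝ => f (Complex.exp (s * Complex.I) • z)) 0

/-- The Cauchy-Riemann sub-Laplacian `Δ_C = Δ_S - T²/2` of `S^{2n+1}`, evaluated at a point `z`
of the unit sphere. It equals `-∑ (W_j^* W_j + W̄_j^* W̄_j)`, for `√2 W_1, …, √2 W_n` a local
orthonormal basis of the holomorphic vector fields tangent to the spheres. -/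
def subLaplacian (n : ℕ) (f : Cn n → ℝ) (z : Cn n) : ℝ :=
  sphereLaplacian n f z - (1 / 2) * rotationSq n f z

/-- `P t z` is the heat kernel of `Δ_C` on `S^{2n+1}` with pole `w`: a classical solution of
`∂P/∂t = Δ_C P` on `(0,∞) × S^{2n+1}` with `P → δ_w` as `t → 0+`, in the sense of distributions
with respect to the surface measure `dS` of the unit sphere. -/
structure IsHeatKernel (n : ℕ) (w : Cn n) (P : ℝ → Cn n → ℝ) : Prop where
  regular : ContDiffOn ℝ 2 (fun p : ℝ × Cn n => radialExt n (P p.1) p.2)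
    (Ioi (0 : ℝ) ×ˢ ({0}ᶜ : Set (Cn n)))
  heat : ∀ t : ℝ, 0 < t → ∀ z : Cn n, ‖z‖ = 1 →
    HasDerivAt (fun s => P s z) (subLaplacian n (P t) z) t
  initial : ∀ f : Cn n → ℝ, ContDiff ℝ ∞ f →
    Tendsto (fun t => ∫ z : Metric.sphere (0 : Cn n) 1, P t z * f z
      ∂(volume : Measure (Cn n)).toSphere) (𝓝[>] 0) (𝓝 (f w))

/-- The principal branch of the complex inverse cosine; its real part lies in `[0, π]`. -/
def arccos (x : ℂ) : ℂ :=
  -Complex.I * Complex.log (x + Complex.I * (1 - x ^ 2) ^ (1 / 2 : ℂ))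

/-- `κ = cosh⁻¹ (cos ϑ₁ cosh (u + i φ₁))`, that is `κ = i γ̃` with
`cos γ̃ = cos ϑ₁ cos (φ₁ - i u)` and `0 ≤ Re γ̃ ≤ π`. -/
def kappa (θ φ u : ℝ) : ℂ :=
  Complex.I * arccos (Real.cos θ * Complex.cosh (u + Complex.I * φ))

/-- The operator `t ∂/∂(cosh κ) = (t / sinh κ) ∂/∂κ`. -/
def dcosh (t : ℝ) (g : ℂ → ℂ) : ℂ → ℂ :=
  fun κ => (t / Complex.sinh κ) * deriv g κ

/-- The meromorphic function
`V_n(κ,t) = e^{-κ²/2t} (t ∂/∂(cosh κ))^{n-1} (e^{κ²/2t} κ / sinh κ)`.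
The values at the zeros of `sinh κ` are irrelevant: below `V_n` only occurs inside integrals, and
there these zeros are met for at most two values of the integration variable. -/
def Vn (n : ℕ) (κ : ℂ) (t : ℝ) : ℂ :=
  Complex.exp (-(κ ^ 2 / (2 * t))) *
    (dcosh t)^[n - 1] (fun z => Complex.exp (z ^ 2 / (2 * t)) * (z / Complex.sinh z)) κ

/-- The integrand `e^{-(u² - (κ + i2kπ)²)/2t} V_n(κ + i2kπ, t)`. -/
def integrand (n : ℕ) (t : ℝ) (k : ℤ) (θ φ u : ℝ) : ℂ :=
  Complex.exp (-(((u : ℂ) ^ 2 - (kappa θ φ u + Complex.I * (2 * k * Real.pi)) ^ 2) / (2 * t))) *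
    Vn n (kappa θ φ u + Complex.I * (2 * k * Real.pi)) t

/-- The integrands paired by `k` and `-k`; for `k = 0` there is only one. -/
def pairNeg (n : ℕ) (t : ℝ) (k : ℕ) (θ φ u : ℝ) : ℂ :=
  if k = 0 then integrand n t 0 θ φ u
  else integrand n t k θ φ u + integrand n t (-k) θ φ u

/-- The integrands paired by `k` and `-k-1`. -/
def pairNegSucc (n : ℕ) (t : ℝ) (k : ℕ) (θ φ u : ℝ) : ℂ :=
  integrand n t k θ φ u + integrand n t (-k - 1) θ φ u

/-- The constant `e^{n²t/2} / (2πt)^{n+1}`. -/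
def prefactor (n : ℕ) (t : ℝ) : ℝ :=
  Real.exp ((n : ℝ) ^ 2 / 2 * t) / (2 * Real.pi * t) ^ (n + 1)

/-- The triples `(ϑ₁, φ₁, z)` with `0 ≤ ϑ₁ ≤ π/2`, with `φ₁` in `A`, and with `z` a point of
`S^{2n+1}` such that `z · w̄ = cos ϑ₁ e^{iφ₁}`. -/
def region (n : ℕ) (w : Cn n) (A : Set ℝ) : Set (ℝ × ℝ × Cn n) :=
  {p | 0 ≤ p.1 ∧ p.1 ≤ Real.pi / 2 ∧ p.2.1 ∈ A ∧ ‖p.2.2‖ = 1 ∧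
    inner ℂ w p.2.2 = Real.cos p.1 * Complex.exp (Complex.I * p.2.1)}

/-- `P t z = c ∑_k ∫ F k ϑ₁ φ₁ u du` at the points `(ϑ₁, φ₁, z)` of `R`, with all integrals
convergent and with the series convergent uniformly and absolutely, even after the
integrands are replaced by their absolute values. -/
def RepresentsOn (n : ℕ) (t : ℝ) (P : ℝ → Cn n → ℝ) (F : ℕ → ℝ → ℝ → ℝ → ℂ)
    (R : Set (ℝ × ℝ × Cn n)) : Prop :=
  (∀ k : ℕ, ∀ p ∈ R, Integrable (F k p.1 p.2.1)) ∧
  SummableUniformlyOn (fun (k : ℕ) (p : ℝ × ℝ × Cn n) => ∫ u : ℝ, ‖F k p.1 p.2.1 u‖) R ∧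
  HasSumUniformlyOn
    (fun (k : ℕ) (p : ℝ × ℝ × Cn n) => (prefactor n t : ℂ) * ∫ u : ℝ, F k p.1 p.2.1 u)
    (fun p => (P t p.2.2 : ℂ)) R

end CRSphere

end

/-! Write `ζ = z · w̄`. A polynomial `T_m^{(n)}(Re ζ)`, where `T_m` is the Chebyshev polynomial and
`m ≥ n`, is up to a factor the zonal spherical harmonic of degree `m - n`. On it `Δ_S` is `(n² -
m²)/2`, and on a monomial `ζ^a ζ̄^b` the operator `T²` is `-(a - b)²`. Giving each monomial the
factor `e^{-λt}`, `λ = (m² - n² - (a - b)²)/2`, yields solutions `B_m(t, ζ)` of the heat equation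
(`zonalBlock`). At the level of coefficients the equation is the Gegenbauer differential equation
(`zonalCoeff_recurrence`). The candidate kernel is `c ∑ B_m` with `c = 2/(2π)^{n+1}`. It converges
on a disc of radius greater than 1 for every `t > 0` (`summable_zonal`), hence is smooth up to `|ζ|
= 1`.

The series `c ∑ r^m B_m(0, ζ)` is `r^n` times the Poisson kernel, so Abel summation recovers a
continuous function from a summable expansion in blocks (`tsum_integral_poleBlock`). For existence,
the symmetry of `Δ_S` makes the pairings of the blocks with a smooth function decay rapidly,
uniformly in `t ≥ 0`, and the initial condition follows. For uniqueness, the symmetry of `Δ_C` makes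
`∫ P(s) B_m(τ - s)` independent of `s`. Comparing `s = τ` with `s → 0` determines all block
coefficients of `P(τ)`, hence `P(τ)` itself (`IsHeatKernel.eq_zonalHeatKernel`).

For the integral formula, the factor `e^{(a-b)²t/2}` is a Gaussian average of `e^{(a-b)u}`, that is,
of rotations by an imaginary angle. Such a rotation turns `Re ζ` into `cos ϑ₁ cosh(u + iφ₁) = cosh
κ`. Thus the kernel is a constant times `∫ e^{-u²/2t} ∑_m 2e^{-m²t/2} T_m^{(n)}(cosh κ) du`
(`prefactor_mul_integral`). The inner sum is an `n`-fold `cosh`-derivative of a theta function.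
Poisson summation converts it into the sum over `k` of the same derivative of `e^{(κ+2πik)²/2t}`
(`hasSum_gaussDeriv`), and these terms are the integrands `I_k` (`integrand_eq`).

It remains to exchange the sum over `k` with the integral over `u`. A single `I_k` can be singular
at the zeros `κ = 0` and `κ = iπ` of `sinh`. The pair `k, -k` comes from an even function of `κ`,
and the pair `k, -k-1` from an even function of `κ - iπ`; so each pairing removes one of the two
singularities, and the condition on `φ₁` keeps `κ` away from the other. The maximum principle makes
this quantitative (`exists_bound_pairDeriv`). Decay in `u` comes from `|Re κ| ≤ |u|` and the factor
`e^{-n|Re κ|}`, decay in `k` from `0 ≤ Im κ ≤ π`. -/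

noncomputable section

namespace CRSphere

/-! ### Derivatives of Chebyshev polynomials: growth, coefficients, generating function. -/

section

open Polynomial

/-- The `n`-th derivative of the Chebyshev polynomial `T_m`, a multiple of a Gegenbauer
polynomial. -/
def chebDeriv (R : Type*) [CommRing R] (n m : ℕ) : R[X] :=
  derivative^[n] (Chebyshev.T R (m : ℤ))

lemma chebDeriv_natDegree_le (n m : ℕ) : (chebDeriv ℝ n m).natDegree ≤ m - n := by
  have h := natDegree_iterate_derivative (Chebyshev.T ℝ (m : ℤ)) n
  simpa [chebDeriv, Chebyshev.natDegree_T] using h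

lemma chebDeriv_eq_zero {R : Type*} [CommRing R] [IsDomain R] [NeZero (2 : R)] {n m : ℕ}
    (h : m < n) : chebDeriv R n m = 0 :=
  iterate_derivative_eq_zero (by simpa [Chebyshev.natDegree_T] using h)

lemma chebDeriv_map (n m : ℕ) :
    (chebDeriv ℝ n m).map (algebraMap ℝ ℂ) = chebDeriv ℂ n m := by
  rw [chebDeriv, ← iterate_derivative_map, Chebyshev.map_T, chebDeriv]

lemma chebDeriv_eval_ofReal (n m : ℕ) (x : ℝ) :
    (chebDeriv ℂ n m).eval (x : ℂ) = ((chebDeriv ℝ n m).eval x : ℝ) := by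
  rw [← chebDeriv_map, eval_map_algebraMap]
  exact aeval_algebraMap_apply ℂ x _

/-- The value at `1` is the quotient of `∏ (m² - l²)` by `∏ (2l + 1)`, and the denominator is at
least `1`. -/
lemma chebDeriv_eval_one_le (n m : ℕ) : (chebDeriv ℝ n m).eval 1 ≤ (m : ℝ) ^ (2 * n) := by
  rcases lt_or_ge m n with hmn | hmn
  · rw [chebDeriv_eq_zero hmn, eval_zero]; positivity
  have h := Chebyshev.iterate_derivative_T_eval_one (R := ℝ) (m : ℤ) n
  rw [chebDeriv]
  have h1 : (1 : ℝ) ≤ ∏ l ∈ Finset.range n, (2 * (l : ℝ) + 1) := by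
    refine Finset.prod_induction _ (fun a : ℝ => 1 ≤ a) (fun a b ha hb => ?_) le_rfl fun l _ => ?_
    · nlinarith
    have : (0 : ℝ) ≤ l := Nat.cast_nonneg l
    linarith
  have h2 : ∏ l ∈ Finset.range n, ((m : ℝ) ^ 2 - (l : ℝ) ^ 2) ≤ (m : ℝ) ^ (2 * n) := by
    rw [pow_mul]
    calc _ ≤ ∏ l ∈ Finset.range n, ((m : ℝ) ^ 2) := by
          apply Finset.prod_le_prod
          · intro l hl
            have : (l : ℝ) ≤ m := by exact_mod_cast (Finset.mem_range.1 hl).le.trans hmn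
            have h0 : (0 : ℝ) ≤ l := Nat.cast_nonneg l
            nlinarith
          · intro l _
            nlinarith [sq_nonneg (l : ℝ)]
      _ = _ := by simp
  have h3 : 0 ≤ ∏ l ∈ Finset.range n, ((m : ℝ) ^ 2 - (l : ℝ) ^ 2) := by
    apply Finset.prod_nonneg
    intro l hl
    have : (l : ℝ) ≤ m := by exact_mod_cast (Finset.mem_range.1 hl).le.trans hmn
    have h0 : (0 : ℝ) ≤ l := Nat.cast_nonneg l
    nlinarith
  push_cast at h
  by_contra! hc
  have h4 : 0 ≤ (derivative^[n] (Chebyshev.T ℝ (m : ℤ))).eval 1 :=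
    (by positivity : (0 : ℝ) ≤ (m : ℝ) ^ (2 * n)).trans hc.le
  nlinarith

/-- Since `T_j(cosh κ) = cosh(jκ)` and `T_j(1) = 1`, a combination with nonnegative coefficients is
controlled by the sum of its coefficients, which is the value at `1`. -/
lemma norm_eval_cosh_le_of_mem_span {d : ℕ} {p : ℂ[X]}
    (hp : p ∈ Submodule.span ℕ ((fun m : ℕ => Chebyshev.T ℂ m) '' Set.Icc 0 d)) (κ : ℂ) :
    ∃ c : ℝ, p.eval 1 = c ∧ ‖p.eval (Complex.cosh κ)‖ ≤ c * Real.exp (d * |κ.re|) := by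
  induction hp using Submodule.span_induction with
  | mem x hx =>
    obtain ⟨j, hj, rfl⟩ := hx
    refine ⟨1, by simp [Chebyshev.T_eval_one], ?_⟩
    simp only [Chebyshev.T_complex_cosh]
    have e : ((j : ℤ) : ℂ) * κ = ((j : ℝ) : ℂ) * κ := by push_cast; rfl
    have hre : (((j : ℤ) : ℂ) * κ).re = j * κ.re := by rw [e, Complex.re_ofReal_mul]
    have hj' : (j : ℝ) * |κ.re| ≤ d * |κ.re| :=
      mul_le_mul_of_nonneg_right (by exact_mod_cast hj.2) (abs_nonneg _)
    have h1 : (j : ℝ) * κ.re ≤ d * |κ.re| :=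
      (mul_le_mul_of_nonneg_left (le_abs_self _) (Nat.cast_nonneg _)).trans hj'
    have h2 : -((j : ℝ) * κ.re) ≤ d * |κ.re| := by
      rw [← mul_neg]
      exact (mul_le_mul_of_nonneg_left (neg_le_abs _) (Nat.cast_nonneg _)).trans hj'
    rw [Complex.cosh, norm_div, Complex.norm_ofNat, one_mul, div_le_iff₀ (by norm_num)]
    refine (norm_add_le _ _).trans ?_
    rw [Complex.norm_exp, Complex.norm_exp, Complex.neg_re, hre]
    have := Real.exp_le_exp.2 h1
    have := Real.exp_le_exp.2 h2
    linarith
  | zero => exact ⟨0, by simp⟩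
  | add x y _ _ hx hy =>
    obtain ⟨c, h1, h2⟩ := hx
    obtain ⟨c', h1', h2'⟩ := hy
    refine ⟨c + c', by simp [h1, h1'], ?_⟩
    rw [eval_add, add_mul]
    exact (norm_add_le _ _).trans (add_le_add h2 h2')
  | smul a x _ hx =>
    obtain ⟨c, h1, h2⟩ := hx
    refine ⟨a * c, by simp [h1], ?_⟩
    rw [nsmul_eq_mul, eval_natCast_mul, norm_mul, Complex.norm_natCast, mul_assoc]
    exact mul_le_mul_of_nonneg_left h2 (Nat.cast_nonneg _)

/-- Derivatives of `T_m` are combinations of the `T_j`, `j ≤ m - n`, with natural coefficients. The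
exponent `m - n` in place of `m` is what later produces decay of the blocks in `m`. -/
lemma norm_chebDeriv_eval_cosh_le (n m : ℕ) (κ : ℂ) :
    ‖(chebDeriv ℂ n m).eval (Complex.cosh κ)‖ ≤
      (m : ℝ) ^ (2 * n) * Real.exp ((m - n : ℕ) * |κ.re|) := by
  obtain ⟨c, h1, h2⟩ := norm_eval_cosh_le_of_mem_span
    (Chebyshev.T_iterate_derivative_mem_span_T (R := ℂ) m n) κ
  refine h2.trans (mul_le_mul_of_nonneg_right ?_ (Real.exp_pos _).le)
  have h3 := chebDeriv_eval_ofReal n m 1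
  rw [chebDeriv, Complex.ofReal_one, h1] at h3
  rw [Complex.ofReal_injective h3]
  exact chebDeriv_eval_one_le n m

lemma abs_chebDeriv_eval_le (n m : ℕ) {x : ℝ} (hx : |x| ≤ 1) :
    |(chebDeriv ℝ n m).eval x| ≤ (m : ℝ) ^ (2 * n) := by
  obtain ⟨h1, h2⟩ := abs_le.1 hx
  -- On the imaginary axis the exponential factor is `1`.
  have h := norm_chebDeriv_eval_cosh_le n m (Real.arccos x * Complex.I)
  rw [Complex.cosh_mul_I, ← Complex.ofReal_cos, Real.cos_arccos h1 h2,
    chebDeriv_eval_ofReal] at h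
  simpa using h

/-- Comparison of the coefficients of degree `j` in the Gegenbauer differential equation. -/
lemma chebDeriv_coeff_recurrence (n m j : ℕ) :
    ((j : ℝ) + 2) * (j + 1) * (chebDeriv ℝ n m).coeff (j + 2) =
      (((j : ℝ) + n) ^ 2 - (m : ℝ) ^ 2) * (chebDeriv ℝ n m).coeff j := by
  have h := congr_arg (fun p => coeff p j)
    (Chebyshev.one_sub_X_sq_mul_iterate_derivative_T_eq_poly_in_T (R := ℝ) (m : ℤ) n)
  rw [Function.iterate_succ_apply', Function.iterate_succ_apply'] at h
  change coeff ((1 - X ^ 2) * derivative (derivative (chebDeriv ℝ n m))) j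
    = coeff (_ * X * derivative (chebDeriv ℝ n m) - _ * chebDeriv ℝ n m) j at h
  have e1 : ((2 * (n : ℝ[X]) + 1)) = C (2 * (n : ℝ) + 1) := by simp [← C_ofNat]
  have e2 : (((m : ℤ) : ℝ[X]) ^ 2 - (n : ℝ[X]) ^ 2) = C ((m : ℝ) ^ 2 - (n : ℝ) ^ 2) := by simp
  rw [e1, e2, sub_mul, one_mul, coeff_sub, coeff_sub, mul_assoc, coeff_C_mul, coeff_C_mul] at h
  rcases j with _ | _ | j
  · simp [coeff_derivative] at h ⊢
    linear_combination h
  · simp [coeff_X_pow_mul', coeff_derivative, coeff_X_mul] at h ⊢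
    linear_combination h
  · rw [coeff_X_pow_mul, coeff_X_mul] at h
    simp only [coeff_derivative] at h
    push_cast at h ⊢
    linear_combination h

lemma abs_chebDeriv_coeff_top_le (n k : ℕ) :
    |(chebDeriv ℝ n (k + n)).coeff k| ≤ 2 ^ (k + n) * ((k + n : ℕ) : ℝ) ^ n := by
  rw [chebDeriv, coeff_iterate_derivative]
  have h := Chebyshev.leadingCoeff_T ℝ ((k + n : ℕ) : ℤ)
  rw [leadingCoeff, Chebyshev.natDegree_T, Int.natAbs_natCast] at h
  rw [h, nsmul_eq_mul, abs_mul, Nat.abs_cast, abs_of_nonneg (by positivity), mul_comm]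
  gcongr
  · norm_num
  · omega
  · exact_mod_cast Nat.descFactorial_le_pow _ _

/-- The recurrence descends from the leading coefficient in steps of two. Each step costs at most a
factor `m`: for `i ≥ 1` the divisor `m² - (j + n)²` is at least `m`, while `(j + 2)(j + 1) ≤ m²`.
For `i = 1` the coefficient two degrees higher lies beyond the degree and vanishes. -/
lemma abs_chebDeriv_coeff_le {n : ℕ} (hn : 1 ≤ n) (i : ℕ) : ∀ j : ℕ,
    |(chebDeriv ℝ n (j + i + n)).coeff j| ≤
      2 ^ (j + i + n) * ((j + i + n : ℕ) : ℝ) ^ n * ((j + i + n : ℕ) : ℝ) ^ i := by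
  induction i using Nat.strong_induction_on with
  | _ i ih =>
  intro j
  rcases Nat.eq_zero_or_pos i with rfl | hi
  · simpa using abs_chebDeriv_coeff_top_le n j
  set m := j + i + n with hm
  have hm1 : (1 : ℝ) ≤ m := by exact_mod_cast (by omega : 1 ≤ m)
  have hi1 : (1 : ℝ) ≤ i := by exact_mod_cast hi
  have hmr : (m : ℝ) = j + i + n := by rw [hm]; push_cast; ring
  have hj0 : (0 : ℝ) ≤ j := Nat.cast_nonneg j
  have hn1 : (1 : ℝ) ≤ n := by exact_mod_cast hn
  have hrec := chebDeriv_coeff_recurrence n m j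
  set b := (chebDeriv ℝ n m).coeff j
  set b2 := (chebDeriv ℝ n m).coeff (j + 2) with hb2
  have hstep : |b| ≤ m * |b2| := by
    have h1 := congr_arg abs hrec
    rw [abs_mul, abs_mul _ b, abs_of_nonneg (by positivity : (0 : ℝ) ≤ (j + 2) * (j + 1)),
      abs_of_nonpos (by nlinarith : ((j : ℝ) + n) ^ 2 - (m : ℝ) ^ 2 ≤ 0)] at h1
    have h2 : (m : ℝ) ≤ -(((j : ℝ) + n) ^ 2 - (m : ℝ) ^ 2) := by nlinarith
    have h3 : ((j : ℝ) + 2) * (j + 1) ≤ m * m := by nlinarith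
    have h4 : (m : ℝ) * |b| ≤ m * (m * |b2|) := by
      calc (m : ℝ) * |b| ≤ _ * |b| := mul_le_mul_of_nonneg_right h2 (abs_nonneg _)
        _ = _ := h1.symm
        _ ≤ m * m * |b2| := mul_le_mul_of_nonneg_right h3 (abs_nonneg _)
        _ = _ := by ring
    exact le_of_mul_le_mul_left h4 (by linarith)
  rcases Nat.lt_or_ge i 2 with h2 | h2
  · have : b2 = 0 := by
      rw [hb2]
      apply coeff_eq_zero_of_natDegree_lt
      have := chebDeriv_natDegree_le n m
      omega
    rw [this, abs_zero, mul_zero] at hstep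
    exact hstep.trans (by positivity)
  · have := ih (i - 2) (by omega) (j + 2)
    rw [show j + 2 + (i - 2) + n = m by omega] at this
    calc |b| ≤ m * |b2| := hstep
      _ ≤ m * (2 ^ m * (m : ℝ) ^ n * (m : ℝ) ^ (i - 2)) :=
          mul_le_mul_of_nonneg_left this (by linarith)
      _ = 2 ^ m * (m : ℝ) ^ n * (m : ℝ) ^ (i - 2 + 1) := by ring
      _ ≤ 2 ^ m * (m : ℝ) ^ n * (m : ℝ) ^ i := by
          gcongr 2 ^ m * (m : ℝ) ^ n * ?_
          exact pow_le_pow_right₀ hm1 (by omega)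

lemma chebDeriv_zero_right {n : ℕ} (hn : 1 ≤ n) : chebDeriv ℝ n 0 = 0 :=
  chebDeriv_eq_zero (by omega)

lemma chebDeriv_eval_recurrence (n m : ℕ) (x : ℝ) :
    (chebDeriv ℝ n (m + 2)).eval x = 2 * x * (chebDeriv ℝ n (m + 1)).eval x
      + 2 * n * (chebDeriv ℝ (n - 1) (m + 1)).eval x - (chebDeriv ℝ n m).eval x := by
  have h : Chebyshev.T ℝ ((m + 2 : ℕ) : ℤ)
      = C 2 * (Chebyshev.T ℝ ((m + 1 : ℕ) : ℤ) * X) - Chebyshev.T ℝ (m : ℤ) := by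
    push_cast
    rw [Chebyshev.T_add_two]
    simp only [map_ofNat]; ring
  simp only [chebDeriv]
  rw [h, iterate_derivative_sub, iterate_derivative_C_mul, iterate_derivative_mul_X]
  simp
  ring

lemma summable_pow_mul_pow (k : ℕ) {r : ℝ} (hr0 : 0 ≤ r) (hr : r < 1) :
    Summable fun m : ℕ => (m : ℝ) ^ k * r ^ m :=
  summable_pow_mul_geometric_of_norm_lt_one k (by rwa [Real.norm_of_nonneg hr0])

lemma summable_chebDeriv_eval (n : ℕ) {x r : ℝ} (hx : |x| ≤ 1) (hr0 : 0 ≤ r) (hr : r < 1) :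
    Summable fun m : ℕ => 2 * (chebDeriv ℝ n m).eval x * r ^ m := by
  refine Summable.of_norm_bounded ((summable_pow_mul_pow (2 * n) hr0 hr).mul_left 2) fun m => ?_
  rw [norm_mul, norm_mul, Real.norm_ofNat, mul_assoc, Real.norm_of_nonneg (pow_nonneg hr0 m)]
  gcongr
  exact abs_chebDeriv_eval_le n m hx

lemma poisson_denominator_pos {x r : ℝ} (hx : |x| ≤ 1) (hr0 : 0 ≤ r) (hr : r < 1) :
    0 < 1 - 2 * x * r + r ^ 2 := by
  have := (abs_le.1 hx).2
  nlinarith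

/-- The generating function of the `n`-th derivatives of the Chebyshev polynomials. -/
lemma hasSum_chebDeriv {n : ℕ} (hn : 1 ≤ n) {x r : ℝ} (hx : |x| ≤ 1) (hr0 : 0 ≤ r)
    (hr : r < 1) :
    HasSum (fun m : ℕ => 2 * (chebDeriv ℝ n m).eval x * r ^ m)
      (n.factorial * (2 * r) ^ n * (1 - r ^ 2) / (1 - 2 * x * r + r ^ 2) ^ (n + 1)) := by
  have hD := poisson_denominator_pos hx hr0 hr
  set S : ℕ → ℝ := fun n => ∑' m : ℕ, 2 * (chebDeriv ℝ n m).eval x * r ^ m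
  -- The three-term recurrence, differentiated `n` times, expresses the sum for `n` through the sum
  -- for `n - 1`; multiplying by the denominator collects the terms containing `S n`.
  have key : ∀ n, (1 - 2 * x * r + r ^ 2) * S n = 2 * (chebDeriv ℝ n 0).eval x
      + 2 * (chebDeriv ℝ n 1).eval x * r - 4 * x * r * (chebDeriv ℝ n 0).eval x
      + 2 * n * r * (S (n - 1) - 2 * (chebDeriv ℝ (n - 1) 0).eval x) := by
    intro n
    have s := summable_chebDeriv_eval n hx hr0 hr
    have s' := summable_chebDeriv_eval (n - 1) hx hr0 hr
    have h1 := s.sum_add_tsum_nat_add 1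
    have h2 := s.sum_add_tsum_nat_add 2
    have h1' := s'.sum_add_tsum_nat_add 1
    have hs1 := (summable_nat_add_iff 1).2 s
    have hs1' := (summable_nat_add_iff 1).2 s'
    have e : ∑' m : ℕ, 2 * (chebDeriv ℝ n (m + 2)).eval x * r ^ (m + 2)
        = 2 * x * r * ∑' m : ℕ, 2 * (chebDeriv ℝ n (m + 1)).eval x * r ^ (m + 1)
        + 2 * n * r * ∑' m : ℕ, 2 * (chebDeriv ℝ (n - 1) (m + 1)).eval x * r ^ (m + 1)
        - r ^ 2 * ∑' m : ℕ, 2 * (chebDeriv ℝ n m).eval x * r ^ m := by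
      rw [← tsum_mul_left, ← tsum_mul_left, ← tsum_mul_left,
        ← (hs1.mul_left _).tsum_add (hs1'.mul_left _),
        ← ((hs1.mul_left _).add (hs1'.mul_left _)).tsum_sub (s.mul_left _)]
      refine tsum_congr fun m => ?_
      rw [chebDeriv_eval_recurrence]; ring
    simp only [Finset.sum_range_succ, Finset.sum_range_zero, pow_zero, pow_one, zero_add, mul_one]
      at h1 h2 h1'
    change _ = S n at h1
    change _ = S n at h2
    change _ = S (n - 1) at h1'
    change _ = _ - r ^ 2 * S n at e
    rw [e, eq_sub_of_add_eq' h1, eq_sub_of_add_eq' h1'] at h2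
    linear_combination -h2
  -- For `n = 0` the term `m = 0` enters with weight `2`, so the sum exceeds the closed form by `1`;
  -- the closed form starts at `n = 1`.
  have h0 : S 0 = (2 - 2 * x * r) / (1 - 2 * x * r + r ^ 2) := by
    rw [eq_div_iff hD.ne', mul_comm, key 0]
    simp [chebDeriv]
    ring
  have hS : ∀ k, S (k + 1) = (k + 1).factorial * (2 * r) ^ (k + 1) * (1 - r ^ 2)
      / (1 - 2 * x * r + r ^ 2) ^ (k + 2) := by
    intro k
    induction k with
    | zero =>
      have h := key 1
      rw [chebDeriv_zero_right le_rfl, h0] at h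
      simp [chebDeriv] at h
      field_simp at h ⊢
      simp
      linear_combination h
    | succ k ih =>
      have h := key (k + 2)
      rw [chebDeriv_zero_right (by omega), chebDeriv_eq_zero (by omega : 1 < k + 2),
        show k + 2 - 1 = k + 1 from rfl, chebDeriv_zero_right (by omega), ih] at h
      rw [eq_div_iff (by positivity), pow_succ (1 - 2 * x * r + r ^ 2) (k + 2),
        show k + 1 + 1 = k + 2 from rfl, Nat.factorial_succ (k + 1)]
      rw [mul_comm] at h
      generalize 1 - 2 * x * r + r ^ 2 = D at h hD ⊢
      calc _ = S (k + 2) * D * D ^ (k + 2) := by ring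
        _ = _ := by
          rw [h]
          simp only [eval_zero]
          field_simp
          push_cast
          ring
  obtain ⟨k, rfl⟩ := Nat.exists_eq_add_of_le' hn
  rw [← hS k]
  exact (summable_chebDeriv_eval _ hx hr0 hr).hasSum

end

section

open ComplexConjugate

/-! ### Series of exponentials in time and monomials in `ζ`, `ζ̄`, differentiated termwise. -/

section ExpSeries

variable {ι : Type*}

/-- The terms of a series of exponentials in `t` times monomials in `ζ` and `conj ζ`. -/
def expTerm (C : ι → ℂ) (lam : ι → ℝ) (a b : ι → ℕ) (i : ι) (p : ℝ × ℂ) : ℂ :=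
  C i * Real.exp (-(lam i * p.1)) * (p.2 ^ a i * conj p.2 ^ b i)

/-- The sum of the series `∑ C_i e^{-λ_i t} ζ^{a_i} (conj ζ)^{b_i}`. -/
def expSeries (C : ι → ℂ) (lam : ι → ℝ) (a b : ι → ℕ) (p : ℝ × ℂ) : ℂ :=
  ∑' i, expTerm C lam a b i p

/-- Absolute convergence of an exponential series for `t > t₀` and `|ζ| < ρ₀`. -/
structure ExpSummable (C : ι → ℂ) (lam : ι → ℝ) (a b : ι → ℕ) (t₀ ρ₀ : ℝ) : Prop where
  nonneg : ∀ i, C i ≠ 0 → 0 ≤ lam i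
  summable : ∀ t, t₀ < t → ∀ ρ, 0 < ρ → ρ < ρ₀ →
    Summable fun i => ‖C i‖ * Real.exp (-(lam i * t)) * ρ ^ (a i + b i)

variable {C : ι → ℂ} {lam : ι → ℝ} {a b : ι → ℕ} {t₀ ρ₀ : ℝ}

lemma norm_expTerm_le (h : ExpSummable C lam a b t₀ ρ₀) {t ρ : ℝ} (i : ι) {p : ℝ × ℂ}
    (ht : t ≤ p.1) (hρ : ‖p.2‖ ≤ ρ) :
    ‖expTerm C lam a b i p‖ ≤ ‖C i‖ * Real.exp (-(lam i * t)) * ρ ^ (a i + b i) := by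
  have h0 : 0 ≤ ρ := (norm_nonneg _).trans hρ
  rw [expTerm, norm_mul, norm_mul, norm_mul, norm_pow, norm_pow, RCLike.norm_conj, ← pow_add,
    Complex.norm_real, Real.norm_of_nonneg (Real.exp_pos _).le]
  by_cases hC : C i = 0
  · simp [hC]
  · have := h.nonneg i hC
    gcongr

lemma exists_between_expDomain {p : ℝ × ℂ} (ht : t₀ < p.1)
    (hρ : ‖p.2‖ < ρ₀) : ∃ t ρ, t₀ < t ∧ t < p.1 ∧ ‖p.2‖ < ρ ∧ 0 < ρ ∧ ρ < ρ₀ := by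
  obtain ⟨t, h1, h2⟩ := _root_.exists_between ht
  obtain ⟨ρ, h3, h4⟩ := _root_.exists_between hρ
  exact ⟨t, ρ, h1, h2, h3, (norm_nonneg _).trans_lt h3, h4⟩

lemma ExpSummable.summable_norm (h : ExpSummable C lam a b t₀ ρ₀) {p : ℝ × ℂ} (ht : t₀ < p.1)
    (hρ : ‖p.2‖ < ρ₀) : Summable fun i => ‖expTerm C lam a b i p‖ := by
  obtain ⟨t, ρ, h1, h2, h3, h4, h5⟩ := exists_between_expDomain ht hρ
  exact Summable.of_nonneg_of_le (fun _ => norm_nonneg _)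
    (fun i => norm_expTerm_le h i h2.le h3.le) (h.summable t h1 ρ h4 h5)

lemma ExpSummable.hasSum (h : ExpSummable C lam a b t₀ ρ₀) {p : ℝ × ℂ} (ht : t₀ < p.1)
    (hρ : ‖p.2‖ < ρ₀) : HasSum (fun i => expTerm C lam a b i p) (expSeries C lam a b p) :=
  (h.summable_norm ht hρ).of_norm.hasSum

/-- The factor `λ` is absorbed by moving to an earlier time `t' > t₀`: `λ e^{-λ(t - t')} ≤ 1/(t -
t')`. -/
lemma ExpSummable.time (h : ExpSummable C lam a b t₀ ρ₀) :
    ExpSummable (fun i => -(lam i : ℂ) * C i) lam a b t₀ ρ₀ := by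
  refine ⟨fun i hi => h.nonneg i (right_ne_zero_of_mul hi), fun t ht ρ hρ hρ' => ?_⟩
  obtain ⟨t', h1, h2⟩ := _root_.exists_between ht
  refine Summable.of_nonneg_of_le (fun i => by positivity) (fun i => ?_)
    ((h.summable t' h1 ρ hρ hρ').mul_left (t - t')⁻¹)
  rw [norm_mul, norm_neg, Complex.norm_real]
  by_cases hC : C i = 0
  · simp [hC]
  have hl := h.nonneg i hC
  have hpos : 0 < t - t' := by linarith
  have key : lam i * Real.exp (-(lam i * t)) ≤ (t - t')⁻¹ * Real.exp (-(lam i * t')) := by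
    rw [inv_mul_eq_div, le_div_iff₀ hpos]
    have e : Real.exp (-(lam i * t')) = Real.exp (-(lam i * t)) * Real.exp (lam i * (t - t')) := by
      rw [← Real.exp_add]; ring_nf
    rw [e, mul_right_comm, mul_comm]
    gcongr
    linarith [Real.add_one_le_exp (lam i * (t - t'))]
  rw [Real.norm_of_nonneg hl]
  calc lam i * ‖C i‖ * Real.exp (-(lam i * t)) * ρ ^ (a i + b i)
      = lam i * Real.exp (-(lam i * t)) * (‖C i‖ * ρ ^ (a i + b i)) := by ring
    _ ≤ (t - t')⁻¹ * Real.exp (-(lam i * t')) * (‖C i‖ * ρ ^ (a i + b i)) := by gcongr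
    _ = _ := by ring

/-- A Cauchy estimate for monomials: the factor `k` from a derivative is paid for by enlarging the
radius. -/
lemma natCast_mul_pow_pred_mul_le {x y : ℝ} (hx : 0 ≤ x) (hxy : x ≤ y) (k : ℕ) :
    (k : ℝ) * x ^ (k - 1) * (y - x) ≤ y ^ k := by
  induction k with
  | zero => simp
  | succ k ih =>
    have hk : (k : ℝ) * x ^ k = x * (k * x ^ (k - 1)) := by
      cases k with
      | zero => simp
      | succ k => simp [pow_succ]; ring
    have h1 : x ^ k ≤ y ^ k := pow_le_pow_left₀ hx hxy k
    simp only [Nat.add_sub_cancel]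
    push_cast
    calc ((k : ℝ) + 1) * x ^ k * (y - x) = x * (k * x ^ (k - 1) * (y - x)) + x ^ k * (y - x) := by
          rw [add_mul, hk]; ring
      _ ≤ x * y ^ k + y ^ k * (y - x) := by
          have : 0 ≤ y - x := by linarith
          gcongr
      _ = y ^ (k + 1) := by ring

lemma ExpSummable.fst (h : ExpSummable C lam a b t₀ ρ₀) :
    ExpSummable (fun i => (a i : ℂ) * C i) lam (fun i => a i - 1) b t₀ ρ₀ := by
  refine ⟨fun i hi => h.nonneg i (right_ne_zero_of_mul hi), fun t ht ρ hρ hρ' => ?_⟩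
  obtain ⟨ρ', h1, h2⟩ := _root_.exists_between hρ'
  have hρ0 := hρ.trans h1
  refine Summable.of_nonneg_of_le (fun i => by positivity) (fun i => ?_)
    ((h.summable t ht ρ' hρ0 h2).mul_left (ρ' - ρ)⁻¹)
  have hpos : 0 < ρ' - ρ := by linarith
  rw [norm_mul, Complex.norm_natCast]
  have key : (a i : ℝ) * ρ ^ (a i - 1) ≤ (ρ' - ρ)⁻¹ * ρ' ^ a i := by
    rw [inv_mul_eq_div, le_div_iff₀ hpos]
    exact natCast_mul_pow_pred_mul_le hρ.le h1.le _
  calc (a i : ℝ) * ‖C i‖ * Real.exp (-(lam i * t)) * ρ ^ (a i - 1 + b i)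
      = (a i : ℝ) * ρ ^ (a i - 1) * ρ ^ b i * (‖C i‖ * Real.exp (-(lam i * t))) := by
        rw [pow_add]; ring
    _ ≤ (ρ' - ρ)⁻¹ * ρ' ^ a i * ρ' ^ b i * (‖C i‖ * Real.exp (-(lam i * t))) := by gcongr
    _ = _ := by rw [pow_add]; ring

lemma ExpSummable.swap (h : ExpSummable C lam a b t₀ ρ₀) : ExpSummable C lam b a t₀ ρ₀ :=
  ⟨h.nonneg, fun t ht ρ hρ hρ' => by simpa only [add_comm] using h.summable t ht ρ hρ hρ'⟩

lemma ExpSummable.snd (h : ExpSummable C lam a b t₀ ρ₀) :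
    ExpSummable (fun i => (b i : ℂ) * C i) lam a (fun i => b i - 1) t₀ ρ₀ :=
  h.swap.fst.swap

/-- The differential of `t`, as a complex valued form on `ℝ × ℂ`. -/
def dTime : ℝ × ℂ →L[ℝ] ℂ := Complex.ofRealCLM ∘L ContinuousLinearMap.fst ℝ ℝ ℂ

/-- The differential of `ζ`. -/
def dZeta : ℝ × ℂ →L[ℝ] ℂ := ContinuousLinearMap.snd ℝ ℝ ℂ

/-- The differential of `conj ζ`. -/
def dZetaBar : ℝ × ℂ →L[ℝ] ℂ := (Complex.conjCLE : ℂ →L[ℝ] ℂ) ∘L ContinuousLinearMap.snd ℝ ℝ ℂ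

lemma norm_dTime_le : ‖dTime‖ ≤ 1 :=
  ContinuousLinearMap.opNorm_le_bound _ zero_le_one fun p => by
    simpa [dTime] using norm_fst_le p

lemma norm_dZeta_le : ‖dZeta‖ ≤ 1 :=
  ContinuousLinearMap.opNorm_le_bound _ zero_le_one fun p => by
    simpa [dZeta] using norm_snd_le p

lemma norm_dZetaBar_le : ‖dZetaBar‖ ≤ 1 :=
  ContinuousLinearMap.opNorm_le_bound _ zero_le_one fun p => by
    simpa [dZetaBar] using norm_snd_le p

/-- In the frame `dt, dζ, dζ̄` the components of the differential are terms of the same type. The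
truncated exponents `a - 1`, `b - 1` are harmless because their coefficients carry the factors `a`,
`b`. -/
lemma hasFDerivAt_expTerm (C : ι → ℂ) (lam : ι → ℝ) (a b : ι → ℕ) (i : ι) (p : ℝ × ℂ) :
    HasFDerivAt (expTerm C lam a b i)
      (expTerm (fun i => -(lam i : ℂ) * C i) lam a b i p • dTime
        + expTerm (fun i => (a i : ℂ) * C i) lam (fun i => a i - 1) b i p • dZeta
        + expTerm (fun i => (b i : ℂ) * C i) lam a (fun i => b i - 1) i p • dZetaBar) p := by
  have h1 : HasFDerivAt (fun p : ℝ × ℂ => ((Real.exp (-(lam i * p.1)) : ℝ) : ℂ))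
      ((-(lam i : ℂ) * Real.exp (-(lam i * p.1))) • dTime) p := by
    have h : HasDerivAt (fun t : ℝ => ((Real.exp (-(lam i * t)) : ℝ) : ℂ))
        (-(lam i : ℂ) * Real.exp (-(lam i * p.1))) p.1 := by
      have := (((hasDerivAt_id p.1).const_mul (lam i)).neg.exp).ofReal_comp
      convert! this using 1
      push_cast; simp; ring
    have := h.hasFDerivAt.comp p (hasFDerivAt_fst (𝕜 := ℝ))
    convert! this using 1
    ext x <;> simp [dTime]
  have h2 : HasFDerivAt (fun p : ℝ × ℂ => p.2) dZeta p := hasFDerivAt_snd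
  have h3 : HasFDerivAt (fun p : ℝ × ℂ => conj p.2) dZetaBar p :=
    dZetaBar.hasFDerivAt
  have h := ((h1.const_mul (C i)).mul ((h2.pow (a i)).mul (h3.pow (b i))))
  refine h.congr_fderiv ?_
  ext x <;> simp [expTerm] <;> ring

lemma ExpSummable.hasFDerivAt (h : ExpSummable C lam a b t₀ ρ₀) {p : ℝ × ℂ} (ht : t₀ < p.1)
    (hρ : ‖p.2‖ < ρ₀) :
    HasFDerivAt (expSeries C lam a b)
      (expSeries (fun i => -(lam i : ℂ) * C i) lam a b p • dTime
        + expSeries (fun i => (a i : ℂ) * C i) lam (fun i => a i - 1) b p • dZeta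
        + expSeries (fun i => (b i : ℂ) * C i) lam a (fun i => b i - 1) p • dZetaBar) p := by
  obtain ⟨t, ρ, h1, h2, h3, h4, h5⟩ := exists_between_expDomain ht hρ
  have hopen : IsOpen (Ioi t ×ˢ Metric.ball (0 : ℂ) ρ) := isOpen_Ioi.prod Metric.isOpen_ball
  have hconn : IsPreconnected (Ioi t ×ˢ Metric.ball (0 : ℂ) ρ) :=
    ((convex_Ioi t).prod (convex_ball _ _)).isPreconnected
  have hp : p ∈ Ioi t ×ˢ Metric.ball (0 : ℂ) ρ := ⟨h2, by simpa using h3⟩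
  have hu := ((h.time.summable t h1 ρ h4 h5).add (h.fst.summable t h1 ρ h4 h5)).add
    (h.snd.summable t h1 ρ h4 h5)
  have key := hasFDerivAt_tsum_of_isPreconnected hu hopen hconn
    (fun i q _ => hasFDerivAt_expTerm C lam a b i q) (fun i q hq => ?_) hp
    (h.summable_norm ht hρ).of_norm hp
  · refine key.congr_fderiv ?_
    have s1 := (h.time.hasSum ht hρ).smul_const dTime
    have s2 := (h.fst.hasSum ht hρ).smul_const dZeta
    have s3 := (h.snd.hasSum ht hρ).smul_const dZetaBar
    exact ((s1.add s2).add s3).tsum_eq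
  · have hq1 : t ≤ q.1 := le_of_lt hq.1
    have hq2 : ‖q.2‖ ≤ ρ := by simpa using (mem_ball_zero_iff.1 hq.2).le
    refine (norm_add₃_le).trans (add_le_add (add_le_add ?_ ?_) ?_)
    all_goals rw [norm_smul]
    · exact (mul_le_of_le_one_right (norm_nonneg _) norm_dTime_le).trans
        (norm_expTerm_le h.time i hq1 hq2)
    · exact (mul_le_of_le_one_right (norm_nonneg _) norm_dZeta_le).trans
        (norm_expTerm_le h.fst i hq1 hq2)
    · exact (mul_le_of_le_one_right (norm_nonneg _) norm_dZetaBar_le).trans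
        (norm_expTerm_le h.snd i hq1 hq2)

lemma isOpen_expDomain (t₀ ρ₀ : ℝ) : IsOpen (Ioi t₀ ×ˢ Metric.ball (0 : ℂ) ρ₀) :=
  isOpen_Ioi.prod Metric.isOpen_ball

/-- The class of these series is closed under differentiation, so the induction runs over all
coefficients and exponents at once. -/
lemma ExpSummable.contDiffOn (k : ℕ) : ∀ {C : ι → ℂ} {a b : ι → ℕ},
    ExpSummable C lam a b t₀ ρ₀ →
    ContDiffOn ℝ k (expSeries C lam a b) (Ioi t₀ ×ˢ Metric.ball (0 : ℂ) ρ₀) := by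
  induction k with
  | zero =>
    intro C a b h
    refine contDiffOn_zero.2 fun p hp => ?_
    exact (h.hasFDerivAt hp.1 (mem_ball_zero_iff.1 hp.2)).continuousAt.continuousWithinAt
  | succ k ih =>
    intro C a b h
    rw [Nat.cast_add, Nat.cast_one,
      contDiffOn_succ_iff_fderiv_of_isOpen (isOpen_expDomain t₀ ρ₀)]
    refine ⟨fun p hp => (h.hasFDerivAt hp.1
      (mem_ball_zero_iff.1 hp.2)).differentiableAt.differentiableWithinAt, by simp, ?_⟩
    have : ContDiffOn ℝ k (fun p =>
        (expSeries (fun i => -(lam i : ℂ) * C i) lam a b p • dTime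
        + expSeries (fun i => (a i : ℂ) * C i) lam (fun i => a i - 1) b p • dZeta
        + expSeries (fun i => (b i : ℂ) * C i) lam a (fun i => b i - 1) p • dZetaBar))
        (Ioi t₀ ×ˢ Metric.ball (0 : ℂ) ρ₀) :=
      (((ih h.time).smul contDiffOn_const).add ((ih h.fst).smul contDiffOn_const)).add
        ((ih h.snd).smul contDiffOn_const)
    exact this.congr fun p hp => (h.hasFDerivAt hp.1 (mem_ball_zero_iff.1 hp.2)).fderiv

end ExpSeries

/-! ### Zonal coefficients and eigenvalues; absolute convergence of the zonal series. -/

/-- The coefficient of `e^{-λ t} ζ^a (conj ζ)^b` in the zonal block of index `m`. -/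
def zonalCoeff (n : ℕ) (i : ℕ × ℕ × ℕ) : ℝ :=
  (chebDeriv ℝ n i.1).coeff (i.2.1 + i.2.2) * (i.2.1 + i.2.2).choose i.2.1 / 2 ^ (i.2.1 + i.2.2)

/-- The eigenvalue of `-Δ_C` that belongs to `ζ^a (conj ζ)^b` in the zonal block of index `m`. -/
def zonalEig (n : ℕ) (i : ℕ × ℕ × ℕ) : ℝ :=
  ((i.1 : ℝ) ^ 2 - (n : ℝ) ^ 2 - ((i.2.1 : ℝ) - i.2.2) ^ 2) / 2

lemma zonalCoeff_eq_zero {n m a b : ℕ} (h : m < a + b + n) :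
    zonalCoeff n (m, a, b) = 0 := by
  have : (chebDeriv ℝ n m).coeff (a + b) = 0 := by
    rcases lt_or_ge m n with hmn | hmn
    · rw [chebDeriv_eq_zero hmn, Polynomial.coeff_zero]
    · apply Polynomial.coeff_eq_zero_of_natDegree_lt
      have := chebDeriv_natDegree_le n m
      omega
  simp [zonalCoeff, this]

/-- `(a + b + n)² ≥ n² + (a - b)²`. The restriction to `a + b + n ≤ m` loses nothing, since the
other coefficients vanish. -/
lemma zonalEig_nonneg {n : ℕ} {m a b : ℕ} (h : a + b + n ≤ m) :
    0 ≤ zonalEig n (m, a, b) := by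
  have h' : (a : ℝ) + b + n ≤ m := by exact_mod_cast h
  have ha : (0 : ℝ) ≤ a := Nat.cast_nonneg a
  have hb : (0 : ℝ) ≤ b := Nat.cast_nonneg b
  have hn : (0 : ℝ) ≤ n := Nat.cast_nonneg n
  simp only [zonalEig]
  nlinarith [mul_nonneg ha hb, mul_nonneg ha hn, mul_nonneg hb hn]

lemma zonalEig_nonneg_of_coeff_ne {n : ℕ} (i : ℕ × ℕ × ℕ)
    (h : zonalCoeff n i ≠ 0) : 0 ≤ zonalEig n i := by
  obtain ⟨m, a, b⟩ := i
  by_contra hc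
  exact h (zonalCoeff_eq_zero (by_contra fun h' => hc (zonalEig_nonneg (by omega))))

/-- A bound for all terms of the zonal block of index `m`. -/
def zonalBound (n : ℕ) (t q : ℝ) (m : ℕ) : ℝ :=
  (2 * m : ℝ) ^ n * q ^ (m - n) * (max 1 (2 * m * Real.exp (-((m - n : ℕ) * t / 2)))) ^ m

/-- The coefficient and the binomial contribute about `m^{i+b}`. For `m = j + i + n` and `2b ≤ j`
the eigenvalue is at least `n(j + i) + (i + 2b)(j + i)/2`. The second summand gives one factor
`e^{-(m-n)t/2}` for each power of `m`; the first gives `e^{-nt}` to balance each factor `ρ`. -/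
lemma abs_zonalCoeff_mul_le_aux {n : ℕ} (hn : 1 ≤ n) {t ρ : ℝ} (ht : 0 < t) (hρ : 0 < ρ)
    (j i b : ℕ) (hb : 2 * b ≤ j) :
    |(chebDeriv ℝ n (j + i + n)).coeff j| * (j.choose b) / 2 ^ j *
      Real.exp (-(((((j + i + n : ℕ) : ℝ) ^ 2 - (n : ℝ) ^ 2 - ((j : ℝ) - 2 * b) ^ 2) / 2) * t))
      * ρ ^ j ≤ zonalBound n t (Real.exp (-(n * t)) * max ρ 1) (j + i + n) := by
  set m := j + i + n with hm
  have hm1 : (1 : ℝ) ≤ m := by exact_mod_cast (by omega : 1 ≤ m)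
  have hmr : (m : ℝ) = j + i + n := by rw [hm]; push_cast; ring
  have hbr : 2 * (b : ℝ) ≤ j := by exact_mod_cast hb
  have hi0 : (0 : ℝ) ≤ i := Nat.cast_nonneg i
  have hb0 : (0 : ℝ) ≤ b := Nat.cast_nonneg b
  have hn0 : (0 : ℝ) ≤ n := Nat.cast_nonneg n
  have hl : m - n = j + i := by omega
  have h1 := abs_chebDeriv_coeff_le hn i j
  rw [← hm] at h1
  have h2 : ((j.choose b : ℕ) : ℝ) ≤ (m : ℝ) ^ b := by
    calc ((j.choose b : ℕ) : ℝ) ≤ ((j ^ b : ℕ) : ℝ) := by exact_mod_cast Nat.choose_le_pow j b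
      _ ≤ (m : ℝ) ^ b := by
        push_cast
        gcongr
        linarith
  have hexp : Real.exp (-((((m : ℝ) ^ 2 - (n : ℝ) ^ 2 - ((j : ℝ) - 2 * b) ^ 2) / 2) * t)) ≤
      Real.exp (-(n * t)) ^ (j + i) * Real.exp (-((m - n : ℕ) * t / 2)) ^ (i + 2 * b) := by
    rw [← Real.exp_nat_mul, ← Real.exp_nat_mul, ← Real.exp_add, hl]
    apply Real.exp_le_exp.2
    push_cast
    have : (i + 2 * b : ℝ) * (j + i) / 2 + n * (j + i) ≤
        ((m : ℝ) ^ 2 - (n : ℝ) ^ 2 - ((j : ℝ) - 2 * b) ^ 2) / 2 := by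
      rw [hmr]
      nlinarith [mul_nonneg (by linarith : (0:ℝ) ≤ i + 2 * b) (by linarith : (0:ℝ) ≤ j - 2 * b)]
    nlinarith
  have hpow2 : (2 : ℝ) ^ m / 2 ^ j = 2 ^ n * 2 ^ i := by
    rw [div_eq_iff (by positivity), hm, pow_add, pow_add]; ring
  have hρ' : ρ ^ j ≤ max ρ 1 ^ (j + i) :=
    (pow_le_pow_left₀ hρ.le (le_max_left _ _) j).trans
      (pow_le_pow_right₀ (le_max_right _ _) (by omega))
  set E := Real.exp (-((m - n : ℕ) * t / 2)) with hE
  have hE0 : 0 < E := Real.exp_pos _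
  calc _ ≤ (2 ^ m * (m : ℝ) ^ n * (m : ℝ) ^ i) * (m : ℝ) ^ b / 2 ^ j
        * (Real.exp (-(n * t)) ^ (j + i) * E ^ (i + 2 * b)) * max ρ 1 ^ (j + i) := by
        gcongr
    _ = (2 * m : ℝ) ^ n * (Real.exp (-(n * t)) * max ρ 1) ^ (j + i) *
        ((2 * m) ^ i * (m : ℝ) ^ b * E ^ (i + 2 * b)) := by
        have : (2 ^ m * (m : ℝ) ^ n * (m : ℝ) ^ i) * (m : ℝ) ^ b / 2 ^ j
          = (2 ^ m / 2 ^ j) * ((m : ℝ) ^ n * (m : ℝ) ^ i * (m : ℝ) ^ b) := by ring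
        rw [this, hpow2, mul_pow, mul_pow, mul_pow]; ring
    _ ≤ (2 * m : ℝ) ^ n * (Real.exp (-(n * t)) * max ρ 1) ^ (j + i) *
        (2 * m * E) ^ (i + 2 * b) := by
        gcongr
        rw [mul_pow _ E]
        gcongr
        rw [pow_add (2 * (m : ℝ))]
        gcongr
        calc (m : ℝ) ^ b ≤ (2 * m) ^ b := by gcongr; linarith
          _ ≤ (2 * m) ^ (2 * b) := pow_le_pow_right₀ (by linarith) (by omega)
    _ ≤ (2 * m : ℝ) ^ n * (Real.exp (-(n * t)) * max ρ 1) ^ (j + i) * (max 1 (2 * m * E)) ^ m := by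
        gcongr
        exact (pow_le_pow_left₀ (by positivity) (le_max_right _ _) _).trans
          (pow_le_pow_right₀ (le_max_left _ _) (by omega))
    _ = _ := by rw [zonalBound, hl]; simp only [hE, hl]

lemma abs_zonalCoeff_mul_le {n : ℕ} (hn : 1 ≤ n) {t ρ : ℝ} (ht : 0 < t) (hρ : 0 < ρ)
    (m a b : ℕ) :
    |zonalCoeff n (m, a, b)| * Real.exp (-(zonalEig n (m, a, b) * t)) * ρ ^ (a + b) ≤
      if a ≤ m ∧ b ≤ m then zonalBound n t (Real.exp (-(n * t)) * max ρ 1) m else 0 := by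
  rcases lt_or_ge m (a + b + n) with h | h
  · rw [zonalCoeff_eq_zero h]
    split_ifs
    · simp [zonalBound]; positivity
    · simp
  rw [if_pos ⟨by omega, by omega⟩]
  obtain ⟨i, rfl⟩ := Nat.exists_eq_add_of_le h
  have e : a + b + n + i = a + b + i + n := by omega
  rw [e]
  -- The situation is symmetric in `a` and `b`; the smaller exponent takes the role of `b` in the
  -- auxiliary estimate.
  rcases le_total b a with hab | hab
  · have := abs_zonalCoeff_mul_le_aux hn ht hρ (a + b) i b (by omega)
    refine le_of_eq_of_le ?_ this
    simp only [zonalCoeff, zonalEig]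
    rw [abs_div, abs_mul, Nat.abs_cast, abs_of_pos (by positivity : (0 : ℝ) < 2 ^ (a + b)),
      Nat.choose_symm_add]
    push_cast
    ring_nf
  · have := abs_zonalCoeff_mul_le_aux hn ht hρ (a + b) i a (by omega)
    refine le_of_eq_of_le ?_ this
    simp only [zonalCoeff, zonalEig]
    rw [abs_div, abs_mul, Nat.abs_cast, abs_of_pos (by positivity : (0 : ℝ) < 2 ^ (a + b))]
    push_cast
    ring_nf

/-- Eventually `2m e^{-(m-n)t/2} ≤ 1`, so the maximum in the bound is `1` and a polynomial times
`q^m` remains. The factor `(m + 1)²` counts the pairs `(a, b)` in a block. -/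
lemma summable_zonalBound (n : ℕ) {t q : ℝ} (ht : 0 < t) (hq0 : 0 ≤ q) (hq : q < 1) :
    Summable fun m : ℕ => ((m : ℝ) + 1) ^ 2 * zonalBound n t q m := by
  have hev : ∀ᶠ m : ℕ in atTop, 2 * (m : ℝ) * Real.exp (-((m - n : ℕ) * t / 2)) ≤ 1 := by
    have h1 : Tendsto (fun m : ℕ => 2 * Real.exp (n * t / 2) * ((m : ℝ) ^ 1 *
        Real.exp (-(t / 2)) ^ m)) atTop (𝓝 (2 * Real.exp (n * t / 2) * 0)) := by
      apply Tendsto.const_mul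
      exact tendsto_pow_const_mul_const_pow_of_lt_one 1 (Real.exp_pos _).le
        ((Real.exp_lt_exp.2 (by linarith)).trans_eq Real.exp_zero)
    rw [mul_zero] at h1
    filter_upwards [h1.eventually (gt_mem_nhds zero_lt_one), eventually_ge_atTop n] with m hm hmn
    refine le_of_eq_of_le ?_ hm.le
    rw [← Real.exp_nat_mul, pow_one]
    have : Real.exp (-((m - n : ℕ) * t / 2))
      = Real.exp (n * t / 2) * Real.exp (m * -(t / 2)) := by
      rw [← Real.exp_add, Nat.cast_sub hmn]; ring_nf
    rw [this]; ring
  rw [← summable_nat_add_iff n]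
  have hs : Summable fun m : ℕ => (2 * ((m + n : ℕ) : ℝ) + 2) ^ (n + 2) * q ^ m := by
    have h1 : Summable fun m : ℕ => (4 + 2 * (n : ℝ)) ^ (n + 2) * ((m : ℝ) ^ (n + 2) * q ^ m) :=
      (summable_pow_mul_pow (n + 2) hq0 hq).mul_left _
    refine Summable.of_norm_bounded_eventually_nat h1 ?_
    filter_upwards [eventually_ge_atTop 1] with m hm
    have hm1 : (1 : ℝ) ≤ m := by exact_mod_cast hm
    have hn0 : (0 : ℝ) ≤ n := Nat.cast_nonneg n
    rw [Real.norm_of_nonneg (by positivity), ← mul_assoc, ← mul_pow]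
    gcongr
    push_cast
    nlinarith
  refine Summable.of_norm_bounded_eventually_nat hs ?_
  have hev' := (tendsto_add_atTop_nat n).eventually hev
  filter_upwards [hev'] with m hm
  rw [zonalBound, max_eq_left hm, Nat.add_sub_cancel, one_pow, mul_one,
    Real.norm_of_nonneg (by positivity), ← mul_assoc, pow_add _ n 2, mul_comm ((_ : ℝ) ^ 2)]
  have : (0 : ℝ) ≤ ((m + n : ℕ) : ℝ) := Nat.cast_nonneg _
  gcongr
  · linarith
  · linarith
  · norm_num

/-- The condition on `ρ` is exactly `e^{-nt} max(ρ, 1) < 1`. Radii greater than `1` are allowed,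
which permits differentiation at points with `|ζ| = 1`, in particular at the pole. -/
lemma summable_zonal {n : ℕ} (hn : 1 ≤ n) {t ρ : ℝ} (ht : 0 < t) (hρ : 0 < ρ)
    (hρt : ρ < Real.exp (n * t)) :
    Summable fun i : ℕ × ℕ × ℕ =>
      |zonalCoeff n i| * Real.exp (-(zonalEig n i * t)) * ρ ^ (i.2.1 + i.2.2) := by
  set q := Real.exp (-(n * t)) * max ρ 1
  have hn' : (0 : ℝ) < n := by exact_mod_cast hn
  have hq : q < 1 := by
    have h1 : max ρ 1 < Real.exp (n * t) :=
      max_lt hρt (Real.one_lt_exp_iff.2 (by positivity))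
    calc q < Real.exp (-(n * t)) * Real.exp (n * t) := by
          simp only [q]; gcongr
      _ = 1 := by rw [← Real.exp_add]; simp
  have hq0 : 0 ≤ q := by positivity
  have hB : ∀ m, 0 ≤ zonalBound n t q m := fun m => by rw [zonalBound]; positivity
  set g : ℕ × ℕ × ℕ → ℝ := fun i => if i.2.1 ≤ i.1 ∧ i.2.2 ≤ i.1 then zonalBound n t q i.1 else 0
  have hg : Summable g := by
    have hz : ∀ m : ℕ, ∀ p : ℕ × ℕ, p ∉ Finset.range (m + 1) ×ˢ Finset.range (m + 1) →
        g (m, p) = 0 := by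
      intro m p hp
      simp only [g]
      rw [if_neg]
      intro h
      apply hp
      simp only [Finset.mem_product, Finset.mem_range]
      omega
    rw [summable_prod_of_nonneg (fun i => by simp only [g]; split_ifs <;> simp [hB])]
    refine ⟨fun m => summable_of_ne_finset_zero (hz m), ?_⟩
    refine Summable.of_nonneg_of_le (fun m => ?_) (fun m => ?_) (summable_zonalBound n ht hq0 hq)
    · exact tsum_nonneg fun p => by simp only [g]; split_ifs <;> simp [hB]
    · rw [tsum_eq_sum (hz m)]
      refine (Finset.sum_le_card_nsmul _ _ (zonalBound n t q m) fun p _ => ?_).trans ?_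
      · simp only [g]; split_ifs <;> simp [hB]
      · rw [Finset.card_product, Finset.card_range, nsmul_eq_mul]
        push_cast
        rw [pow_two]
  refine Summable.of_nonneg_of_le (fun i => by positivity) (fun i => ?_) hg
  exact abs_zonalCoeff_mul_le hn ht hρ i.1 i.2.1 i.2.2

end

section

open ComplexConjugate

lemma hasSum_of_forall_eq {ι E : Type*} [AddCommMonoid E] [TopologicalSpace E] {f g : ι → E}
    {x : E} (h : HasSum f x) (e : ∀ i, f i = g i) : HasSum g x := by
  rwa [← funext e]

/-! ### First and second derivatives in `ζ` of the real part at fixed time. -/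

section Slice

variable {ι : Type*} {C : ι → ℂ} {lam : ι → ℝ} {a b : ι → ℕ} {t₀ ρ₀ : ℝ}

lemma ExpSummable.hasFDerivAt_slice (h : ExpSummable C lam a b t₀ ρ₀) {t : ℝ} {ζ : ℂ}
    (ht : t₀ < t) (hζ : ‖ζ‖ < ρ₀) :
    HasFDerivAt (fun ζ => expSeries C lam a b (t, ζ))
      (expSeries (fun i => (a i : ℂ) * C i) lam (fun i => a i - 1) b (t, ζ) •
          ContinuousLinearMap.id ℝ ℂ
        + expSeries (fun i => (b i : ℂ) * C i) lam a (fun i => b i - 1) (t, ζ) •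
          (Complex.conjCLE : ℂ →L[ℝ] ℂ)) ζ := by
  have h1 : HasFDerivAt (fun ζ : ℂ => (t, ζ)) (ContinuousLinearMap.inr ℝ ℝ ℂ) ζ :=
    hasFDerivAt_prodMk_right t ζ
  refine ((h.hasFDerivAt (p := (t, ζ)) ht hζ).comp ζ h1).congr_fderiv ?_
  ext v
  all_goals simp [dTime, dZeta, dZetaBar]

lemma ExpSummable.hasDerivAt_time (h : ExpSummable C lam a b t₀ ρ₀) {t : ℝ} {ζ : ℂ}
    (ht : t₀ < t) (hζ : ‖ζ‖ < ρ₀) :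
    HasDerivAt (fun t => expSeries C lam a b (t, ζ))
      (expSeries (fun i => -(lam i : ℂ) * C i) lam a b (t, ζ)) t := by
  have h1 : HasFDerivAt (fun t : ℝ => (t, ζ)) (ContinuousLinearMap.inl ℝ ℝ ℂ) t :=
    hasFDerivAt_prodMk_left t ζ
  have := ((h.hasFDerivAt (p := (t, ζ)) ht hζ).comp t h1).hasDerivAt
  refine HasDerivAt.congr_deriv this ?_
  simp [dTime, dZeta, dZetaBar]

lemma ExpSummable.fderiv_re (h : ExpSummable C lam a b t₀ ρ₀) {t : ℝ} {ζ : ℂ}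
    (ht : t₀ < t) (hζ : ‖ζ‖ < ρ₀) (v : ℂ) :
    fderiv ℝ (fun ζ => (expSeries C lam a b (t, ζ)).re) ζ v =
      (expSeries (fun i => (a i : ℂ) * C i) lam (fun i => a i - 1) b (t, ζ) * v
        + expSeries (fun i => (b i : ℂ) * C i) lam a (fun i => b i - 1) (t, ζ) * conj v).re := by
  have h1 := (Complex.reCLM.hasFDerivAt).comp ζ (h.hasFDerivAt_slice ht hζ)
  change fderiv ℝ (Complex.reCLM ∘ fun ζ => expSeries C lam a b (t, ζ)) ζ v = _
  rw [h1.fderiv]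
  simp

lemma ExpSummable.contDiffAt_re_slice (h : ExpSummable C lam a b t₀ ρ₀) {t : ℝ} {ζ : ℂ}
    (ht : t₀ < t) (hζ : ‖ζ‖ < ρ₀) (k : ℕ) :
    ContDiffAt ℝ k (fun ζ => (expSeries C lam a b (t, ζ)).re) ζ := by
  have h1 := (h.contDiffOn k).contDiffAt (x := (t, ζ))
    ((isOpen_expDomain t₀ ρ₀).mem_nhds ⟨ht, by simpa using hζ⟩)
  have h2 : ContDiffAt ℝ k (fun ζ : ℂ => (t, ζ)) ζ := contDiffAt_const.prodMk contDiffAt_id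
  have h3 : ContDiffAt ℝ k (fun ζ => expSeries C lam a b (t, ζ)) ζ := h1.comp ζ h2
  exact Complex.reCLM.contDiff.contDiffAt.comp ζ h3

lemma ExpSummable.fderiv_fderiv_re (h : ExpSummable C lam a b t₀ ρ₀) {t : ℝ} {ζ : ℂ}
    (ht : t₀ < t) (hζ : ‖ζ‖ < ρ₀) (v w : ℂ) :
    fderiv ℝ (fderiv ℝ (fun ζ => (expSeries C lam a b (t, ζ)).re)) ζ v w =
      ((expSeries (fun i => ((a i - 1 : ℕ) : ℂ) * ((a i : ℂ) * C i)) lam (fun i => a i - 1 - 1) b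
            (t, ζ) * v
          + expSeries (fun i => (b i : ℂ) * ((a i : ℂ) * C i)) lam (fun i => a i - 1)
            (fun i => b i - 1) (t, ζ) * conj v) * w
        + (expSeries (fun i => (a i : ℂ) * ((b i : ℂ) * C i)) lam (fun i => a i - 1)
            (fun i => b i - 1) (t, ζ) * v
          + expSeries (fun i => ((b i - 1 : ℕ) : ℂ) * ((b i : ℂ) * C i)) lam a
            (fun i => b i - 1 - 1) (t, ζ) * conj v) * conj w).re := by
  have hd : DifferentiableAt ℝ (fderiv ℝ (fun ζ => (expSeries C lam a b (t, ζ)).re)) ζ :=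
    ((h.contDiffAt_re_slice ht hζ 2).fderiv_right (m := 1) (by norm_num)).differentiableAt
      (by norm_num)
  have e1 : fderiv ℝ (fderiv ℝ (fun ζ => (expSeries C lam a b (t, ζ)).re)) ζ v w
      = fderiv ℝ (fun ζ => fderiv ℝ (fun ζ => (expSeries C lam a b (t, ζ)).re) ζ w) ζ v := by
    rw [fderiv_clm_apply hd (differentiableAt_const w)]
    simp
  rw [e1]
  have hev : (fun ζ => fderiv ℝ (fun ζ => (expSeries C lam a b (t, ζ)).re) ζ w) =ᶠ[𝓝 ζ]
      fun ζ => (expSeries (fun i => (a i : ℂ) * C i) lam (fun i => a i - 1) b (t, ζ) * w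
        + expSeries (fun i => (b i : ℂ) * C i) lam a (fun i => b i - 1) (t, ζ) * conj w).re := by
    filter_upwards [(isOpen_lt continuous_norm continuous_const).mem_nhds hζ] with ζ' hζ'
    exact h.fderiv_re ht hζ' w
  rw [hev.fderiv_eq]
  have h1 := (Complex.reCLM.hasFDerivAt).comp ζ
    (((h.fst.hasFDerivAt_slice ht hζ).mul_const w).add
      ((h.snd.hasFDerivAt_slice ht hζ).mul_const (conj w)))
  rw [HasFDerivAt.fderiv (f := fun ζ => (_ : ℂ).re) h1]
  simp
  ring

end Slice

/-! ### Differential equations of the zonal series in the variable `ζ`. -/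

/-- The zonal series `∑ ε_m e^{-λ t} c ζ^a (conj ζ)^b` whose block of index `m` has weight
`ε_m`. -/
def zonalSeries (n : ℕ) (ε : ℕ → ℝ) (p : ℝ × ℂ) : ℂ :=
  expSeries (fun i => ((ε i.1 * zonalCoeff n i : ℝ) : ℂ)) (zonalEig n) (fun i => i.2.1)
    (fun i => i.2.2) p

/-- Absolute convergence of a weighted zonal series. -/
def ZonalSummable (n : ℕ) (ε : ℕ → ℝ) (t₀ ρ₀ : ℝ) : Prop :=
  ExpSummable (fun i : ℕ × ℕ × ℕ => ((ε i.1 * zonalCoeff n i : ℝ) : ℂ)) (zonalEig n)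
    (fun i => i.2.1) (fun i => i.2.2) t₀ ρ₀

lemma zonalSummable_one {n : ℕ} (hn : 1 ≤ n) {t₀ : ℝ} (ht : 0 < t₀) :
    ZonalSummable n (fun _ => 1) t₀ (Real.exp (n * t₀)) := by
  refine ⟨fun i hi => zonalEig_nonneg_of_coeff_ne i fun h => hi (by simp [h]),
    fun t htt ρ hρ hρ' => ?_⟩
  have hn' : (0 : ℝ) < n := by exact_mod_cast hn
  have := summable_zonal hn (ht.trans htt) hρ
    (hρ'.trans (Real.exp_lt_exp.2 (mul_lt_mul_of_pos_left htt hn')))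
  simpa using this

/-- A single block is a finite sum, so time and radius are unrestricted; nonpositive times occur
later in the pairing with a heat kernel. -/
lemma zonalSummable_single (n m : ℕ) (t₀ ρ₀ : ℝ) :
    ZonalSummable n (Pi.single m 1) t₀ ρ₀ := by
  refine ⟨fun i hi => zonalEig_nonneg_of_coeff_ne i fun h => hi (by simp [h]),
    fun t htt ρ hρ hρ' => ?_⟩
  refine summable_of_ne_finset_zero
    (s := {m} ×ˢ (Finset.range (m + 1) ×ˢ Finset.range (m + 1))) fun i hi => ?_
  obtain ⟨m', a, b⟩ := i
  by_cases hm : m' = m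
  · subst hm
    have : m' < a + b + n := by
      by_contra hc
      apply hi
      simp only [Finset.mem_product, Finset.mem_singleton, Finset.mem_range, true_and]
      omega
    simp [zonalCoeff_eq_zero this]
  · simp [Pi.single_eq_of_ne hm]

lemma choose_mul_succ_mul_succ (a b : ℕ) :
    ((a : ℝ) + 1) * (b + 1) * (a + b + 2).choose (a + 1) =
      ((a + b : ℕ) + 2) * ((a + b : ℕ) + 1) * (a + b).choose a := by
  have h1 := Nat.add_one_mul_choose_eq (a + b + 1) a
  have h2 := Nat.choose_mul_succ_eq (a + b) a
  rw [show a + b + 1 - a = b + 1 by omega] at h2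
  have h1' : ((a : ℝ) + b + 1 + 1) * (a + b + 1).choose a =
      (a + b + 2).choose (a + 1) * (a + 1) := by
    exact_mod_cast h1
  have h2' : ((a + b).choose a : ℝ) * (a + b + 1) = (a + b + 1).choose a * (b + 1) := by
    exact_mod_cast h2
  push_cast
  linear_combination (-(b : ℝ) - 1) * h1' - (a + b + 2 : ℝ) * h2'

/-- The Gegenbauer recurrence in degree `a + b`, combined with an identity of binomial coefficients.
It is the heat equation read off at the monomial `ζ^a ζ̄^b`. -/
lemma zonalCoeff_recurrence (n m a b : ℕ) :
    2 * ((a : ℝ) + 1) * (b + 1) * zonalCoeff n (m, a + 1, b + 1) =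
      (-zonalEig n (m, a, b) + n * (a + b) + 2 * a * b) * zonalCoeff n (m, a, b) := by
  have h1 := choose_mul_succ_mul_succ a b
  have h2 := chebDeriv_coeff_recurrence n m (a + b)
  simp only [zonalCoeff, zonalEig]
  rw [show a + 1 + (b + 1) = a + b + 2 by ring]
  push_cast at h1 h2 ⊢
  rw [pow_add, mul_div_assoc', mul_div_assoc', div_eq_div_iff (by positivity) (by positivity)]
  linear_combination (2 : ℝ) ^ (a + b) * (2 * (chebDeriv ℝ n m).coeff (a + b + 2) * h1
    + 2 * ((a + b).choose a : ℝ) * h2)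

section Identities

variable {n : ℕ} {ε : ℕ → ℝ} {t₀ ρ₀ : ℝ}

/-- The mixed second derivative of a zonal series, rewritten by the coefficient recurrence. -/
lemma ZonalSummable.hasSum_mixed (h : ZonalSummable n ε t₀ ρ₀) {t : ℝ} {ζ : ℂ} (ht : t₀ < t)
    (hζ : ‖ζ‖ < ρ₀) :
    HasSum (fun i : ℕ × ℕ × ℕ =>
        ((-zonalEig n i + n * (i.2.1 + i.2.2) + 2 * i.2.1 * i.2.2 : ℝ) : ℂ) *
          expTerm (fun i => ((ε i.1 * zonalCoeff n i : ℝ) : ℂ)) (zonalEig n) (fun i => i.2.1)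
            (fun i => i.2.2) i (t, ζ))
      (2 * expSeries (fun i : ℕ × ℕ × ℕ =>
        (i.2.2 : ℂ) * ((i.2.1 : ℂ) * ((ε i.1 * zonalCoeff n i : ℝ) : ℂ))) (zonalEig n)
        (fun i => i.2.1 - 1) (fun i => i.2.2 - 1) (t, ζ)) := by
  have h1 := (ExpSummable.hasSum (p := (t, ζ)) h.fst.snd ht hζ).mul_left 2
  -- Shifting both exponents by one preserves `a - b`, hence the eigenvalue. Indices outside the
  -- range of the shift have `a = 0` or `b = 0`, and their terms vanish.
  have hinj : Function.Injective (fun i : ℕ × ℕ × ℕ => (i.1, i.2.1 + 1, i.2.2 + 1)) := by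
    rintro ⟨m, a, b⟩ ⟨m', a', b'⟩ hh
    simpa using hh
  rw [← hinj.hasSum_iff] at h1
  · refine hasSum_of_forall_eq h1 fun i => ?_
    obtain ⟨m, a, b⟩ := i
    have hr := zonalCoeff_recurrence n m a b
    have hr' := congr_arg (fun x : ℝ => (x : ℂ)) hr
    have he : zonalEig n (m, a + 1, b + 1) = zonalEig n (m, a, b) := by
      simp only [zonalEig]; push_cast; ring
    simp only [Function.comp, expTerm, Nat.add_sub_cancel, he]
    push_cast at hr' ⊢
    linear_combination (ε m : ℂ) * Complex.exp (-((zonalEig n (m, a, b) : ℂ) * t)) *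
      (ζ ^ a * conj ζ ^ b) * hr'
  · rintro ⟨m, a, b⟩ hi
    rcases a with _ | a
    · simp [expTerm]
    rcases b with _ | b
    · simp [expTerm]
    · exact absurd ⟨(m, a, b), rfl⟩ hi

lemma natCast_mul_pow_pred_mul (a : ℕ) (x : ℂ) : (a : ℂ) * x ^ (a - 1) * x = a * x ^ a := by
  cases a with
  | zero => simp
  | succ a => simp [pow_succ]; ring

lemma natCast_mul_pow_pred_pred_mul (a : ℕ) (x : ℂ) :
    ((a - 1 : ℕ) : ℂ) * (a * x ^ (a - 1 - 1)) * x ^ 2 = a * (a - 1) * x ^ a := by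
  rcases a with _ | _ | a
  · simp
  · simp
  · simp [pow_succ]; ring

/-- On zonal functions `Δ_C` becomes `2(1 - |ζ|²)∂∂̄ - n(ζ∂ + ζ̄∂̄)`. The last two parts multiply
`ζ^a ζ̄^b` by `-2ab - n(a + b)`, and the coefficient recurrence turns `2∂∂̄` into the rest. -/
lemma ZonalSummable.heat_complex (h : ZonalSummable n ε t₀ ρ₀) {t : ℝ} {ζ : ℂ} (ht : t₀ < t)
    (hζ : ‖ζ‖ < ρ₀) :
    expSeries (fun i : ℕ × ℕ × ℕ => -(zonalEig n i : ℂ) * ((ε i.1 * zonalCoeff n i : ℝ) : ℂ))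
        (zonalEig n) (fun i => i.2.1) (fun i => i.2.2) (t, ζ) =
      2 * (1 - ζ * conj ζ) * expSeries (fun i : ℕ × ℕ × ℕ =>
        (i.2.2 : ℂ) * ((i.2.1 : ℂ) * ((ε i.1 * zonalCoeff n i : ℝ) : ℂ))) (zonalEig n)
        (fun i => i.2.1 - 1) (fun i => i.2.2 - 1) (t, ζ)
      - n * (expSeries (fun i : ℕ × ℕ × ℕ => (i.2.1 : ℂ) * ((ε i.1 * zonalCoeff n i : ℝ) : ℂ))
          (zonalEig n) (fun i => i.2.1 - 1) (fun i => i.2.2) (t, ζ) * ζ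
        + expSeries (fun i : ℕ × ℕ × ℕ => (i.2.2 : ℂ) * ((ε i.1 * zonalCoeff n i : ℝ) : ℂ))
          (zonalEig n) (fun i => i.2.1) (fun i => i.2.2 - 1) (t, ζ) * conj ζ) := by
  have s1 := ExpSummable.hasSum (p := (t, ζ)) h.time ht hζ
  have s2 := (ExpSummable.hasSum (p := (t, ζ)) h.fst ht hζ).mul_right ζ
  have s3 := (ExpSummable.hasSum (p := (t, ζ)) h.snd ht hζ).mul_right (conj ζ)
  have s4 := (ExpSummable.hasSum (p := (t, ζ)) h.fst.snd ht hζ).mul_left (2 * (ζ * conj ζ))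
  have s5 := h.hasSum_mixed ht hζ
  have key := ((s1.add ((s2.add s3).mul_left (n : ℂ))).add s4).unique
    (hasSum_of_forall_eq s5 fun i => ?_)
  · linear_combination key
  · obtain ⟨m, a, b⟩ := i
    simp only [expTerm]
    have e1 := natCast_mul_pow_pred_mul a ζ
    have e2 := natCast_mul_pow_pred_mul b (conj ζ)
    push_cast
    generalize (ε m : ℂ) * (zonalCoeff n (m, a, b) : ℂ) = c
    generalize Complex.exp (-(zonalEig n (m, a, b) * t : ℂ)) = E
    linear_combination -(n : ℂ) * c * E * (conj ζ ^ b * e1 + ζ ^ a * e2)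
      - 2 * c * E * (a * ζ ^ a * e2 + b * conj ζ ^ (b - 1) * conj ζ * e1)

/-- The analogue for `Δ_S`: the additional terms compensate `(a - b)²` in the eigenvalue, so that
the multiplier depends on `m` alone. -/
lemma ZonalSummable.sphere_complex (h : ZonalSummable n ε t₀ ρ₀) {t : ℝ} {ζ : ℂ} (ht : t₀ < t)
    (hζ : ‖ζ‖ < ρ₀) :
    HasSum (fun i : ℕ × ℕ × ℕ => (((n : ℝ) ^ 2 - (i.1 : ℝ) ^ 2 : ℝ) : ℂ) / 2 *
        expTerm (fun i => ((ε i.1 * zonalCoeff n i : ℝ) : ℂ)) (zonalEig n) (fun i => i.2.1)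
            (fun i => i.2.2) i (t, ζ))
      ((2 - ζ * conj ζ) * expSeries (fun i : ℕ × ℕ × ℕ =>
        (i.2.2 : ℂ) * ((i.2.1 : ℂ) * ((ε i.1 * zonalCoeff n i : ℝ) : ℂ))) (zonalEig n)
        (fun i => i.2.1 - 1) (fun i => i.2.2 - 1) (t, ζ)
      - (expSeries (fun i : ℕ × ℕ × ℕ =>
          ((i.2.1 - 1 : ℕ) : ℂ) * ((i.2.1 : ℂ) * ((ε i.1 * zonalCoeff n i : ℝ) : ℂ)))
          (zonalEig n) (fun i => i.2.1 - 1 - 1) (fun i => i.2.2) (t, ζ) * ζ ^ 2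
        + expSeries (fun i : ℕ × ℕ × ℕ =>
          ((i.2.2 - 1 : ℕ) : ℂ) * ((i.2.2 : ℂ) * ((ε i.1 * zonalCoeff n i : ℝ) : ℂ)))
          (zonalEig n) (fun i => i.2.1) (fun i => i.2.2 - 1 - 1) (t, ζ) * conj ζ ^ 2) / 2
      - (2 * n + 1) / 2 *
        (expSeries (fun i : ℕ × ℕ × ℕ => (i.2.1 : ℂ) * ((ε i.1 * zonalCoeff n i : ℝ) : ℂ))
          (zonalEig n) (fun i => i.2.1 - 1) (fun i => i.2.2) (t, ζ) * ζ
        + expSeries (fun i : ℕ × ℕ × ℕ => (i.2.2 : ℂ) * ((ε i.1 * zonalCoeff n i : ℝ) : ℂ))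
          (zonalEig n) (fun i => i.2.1) (fun i => i.2.2 - 1) (t, ζ) * conj ζ)) := by
  have s2 := (ExpSummable.hasSum (p := (t, ζ)) h.fst ht hζ).mul_right ζ
  have s3 := (ExpSummable.hasSum (p := (t, ζ)) h.snd ht hζ).mul_right (conj ζ)
  have s22 := (ExpSummable.hasSum (p := (t, ζ)) h.fst.fst ht hζ).mul_right (ζ ^ 2)
  have s33 := (ExpSummable.hasSum (p := (t, ζ)) h.snd.snd ht hζ).mul_right (conj ζ ^ 2)
  have s4 := (ExpSummable.hasSum (p := (t, ζ)) h.fst.snd ht hζ).mul_left (ζ * conj ζ)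
  have s5 := h.hasSum_mixed ht hζ
  have key := ((s5.sub s4).sub ((s22.add s33).div_const 2)).sub
    ((s2.add s3).mul_left ((2 * n + 1) / 2 : ℂ))
  rw [← sub_mul] at key
  refine hasSum_of_forall_eq key fun i => ?_
  obtain ⟨m, a, b⟩ := i
  simp only [expTerm]
  have e1 := natCast_mul_pow_pred_mul a ζ
  have e2 := natCast_mul_pow_pred_mul b (conj ζ)
  have e3 := natCast_mul_pow_pred_pred_mul a ζ
  have e4 := natCast_mul_pow_pred_pred_mul b (conj ζ)
  have e5 : ((zonalEig n (m, a, b) : ℝ) : ℂ) = ((m : ℂ) ^ 2 - n ^ 2 - (a - b) ^ 2) / 2 := by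
    simp [zonalEig]
  push_cast
  generalize (ε m : ℂ) * (zonalCoeff n (m, a, b) : ℂ) = c
  generalize Complex.exp (-(zonalEig n (m, a, b) * t : ℂ)) = E
  rw [e5]
  linear_combination -((2 * n + 1) / 2 : ℂ) * c * E * (conj ζ ^ b * e1 + ζ ^ a * e2)
      - c * E * (a * ζ ^ a * e2 + b * conj ζ ^ (b - 1) * conj ζ * e1)
      - c * E / 2 * (conj ζ ^ b * e3 + ζ ^ a * e4)

end Identities

end

section

open ComplexConjugate

/-! ### `Δ_S`, `T²` and `Δ_C` through the derivatives of an arbitrary `C²` extension. -/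

section SecondOrder

variable {E F : Type*} [NormedAddCommGroup E] [NormedSpace ℝ E] [NormedAddCommGroup F]
  [NormedSpace ℝ F]

lemma iteratedDeriv_two_comp {f : E → F} {γ γ' : ℝ → E} {γ'' : E} {s : ℝ}
    (hf : ContDiffAt ℝ 2 f (γ s)) (h1 : ∀ᶠ r in 𝓝 s, HasDerivAt γ (γ' r) r)
    (h2 : HasDerivAt γ' γ'' s) :
    iteratedDeriv 2 (f ∘ γ) s =
      fderiv ℝ (fderiv ℝ f) (γ s) (γ' s) (γ' s) + fderiv ℝ f (γ s) γ'' := by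
  have hγ := h1.self_of_nhds
  have hev : deriv (f ∘ γ) =ᶠ[𝓝 s] fun r => fderiv ℝ f (γ r) (γ' r) := by
    filter_upwards [h1, hγ.continuousAt.eventually (hf.eventually (by simp))] with r hr hr'
    exact ((hr'.differentiableAt (by simp)).hasFDerivAt.comp_hasDerivAt r hr).deriv
  rw [iteratedDeriv_succ, iteratedDeriv_one, hev.deriv_eq]
  have hd : HasFDerivAt (fderiv ℝ f) (fderiv ℝ (fderiv ℝ f) (γ s)) (γ s) :=
    ((hf.fderiv_right (m := 1) (by norm_num)).differentiableAt (by simp)).hasFDerivAt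
  exact ((hd.comp_hasDerivAt s hγ).clm_apply h2).deriv

lemma fderiv_fderiv_eq_iteratedDeriv {f : E → F} {x v : E} (hf : ContDiffAt ℝ 2 f x) :
    fderiv ℝ (fderiv ℝ f) x v v = iteratedDeriv 2 (fun s : ℝ => f (x + s • v)) 0 := by
  have h1 : ∀ r : ℝ, HasDerivAt (fun s : ℝ => x + s • v) v r := fun r => by
    simpa using ((hasDerivAt_id r).smul_const v).const_add x
  have := iteratedDeriv_two_comp (f := f) (γ := fun s : ℝ => x + s • v) (γ' := fun _ => v)
    (γ'' := 0) (s := 0) (by simpa using hf) (Eventually.of_forall h1) (hasDerivAt_const 0 v)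
  simp only [zero_smul, add_zero, map_zero] at this
  exact this.symm

end SecondOrder

section Inner

variable {E : Type*} [NormedAddCommGroup E] [InnerProductSpace ℝ E]

lemma hasDerivAt_inv_norm_line {z v : E} {s : ℝ} (h : z + s • v ≠ 0) :
    HasDerivAt (fun s : ℝ => ‖z + s • v‖⁻¹)
      (-(inner ℝ (z + s • v) v * ‖z + s • v‖⁻¹ ^ 3)) s := by
  have h1 : HasDerivAt (fun s : ℝ => z + s • v) v s := by
    simpa using ((hasDerivAt_id s).smul_const v).const_add z
  have hpos : 0 < ‖z + s • v‖ := norm_pos_iff.2 h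
  have h2 := (h1.norm_sq.sqrt (by positivity)).inv (by positivity)
  have e : (fun s : ℝ => ‖z + s • v‖⁻¹) = fun s : ℝ => (√(‖z + s • v‖ ^ 2))⁻¹ := by
    ext s; rw [Real.sqrt_sq (norm_nonneg _)]
  rw [e]
  refine h2.congr_deriv ?_
  rw [Real.sqrt_sq (norm_nonneg _)]
  field_simp

/-- The second derivative of the radial extension of `f` at a unit vector. -/
lemma fderiv_fderiv_radial {f : E → ℝ} {z : E} (hz : ‖z‖ = 1) (hf : ContDiffAt ℝ 2 f z) (v : E) :
    fderiv ℝ (fderiv ℝ fun x => f (‖x‖⁻¹ • x)) z v v =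
      fderiv ℝ (fderiv ℝ f) z (v - inner ℝ z v • z) (v - inner ℝ z v • z)
      + fderiv ℝ f z ((3 * inner ℝ z v ^ 2 - ‖v‖ ^ 2) • z - (2 * inner ℝ z v) • v) := by
  have hz0 : z ≠ 0 := by rintro rfl; simp at hz
  have hπ : ContDiffAt ℝ 2 (fun x : E => ‖x‖⁻¹ • x) z :=
    ((contDiffAt_norm ℝ hz0).inv (by simp [hz])).smul contDiffAt_id
  have hF : ContDiffAt ℝ 2 (fun x => f (‖x‖⁻¹ • x)) z :=
    ContDiffAt.comp z (by simpa [hz] using hf) hπ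
  -- The second derivative is computed along the line `z + sv`; its projection to the sphere is a
  -- curve whose velocity and acceleration at `s = 0` give the two terms.
  rw [fderiv_fderiv_eq_iteratedDeriv hF]
  have hx : ∀ s : ℝ, HasDerivAt (fun s : ℝ => z + s • v) v s := fun s => by
    simpa using ((hasDerivAt_id s).smul_const v).const_add z
  have hne : ∀ᶠ s : ℝ in 𝓝 0, z + s • v ≠ 0 := by
    apply (hx 0).continuousAt.eventually_ne
    simpa using hz0
  have h1 : ∀ᶠ s : ℝ in 𝓝 0, HasDerivAt (fun s : ℝ => ‖z + s • v‖⁻¹ • (z + s • v))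
      (‖z + s • v‖⁻¹ • v + (-(inner ℝ (z + s • v) v * ‖z + s • v‖⁻¹ ^ 3)) • (z + s • v)) s := by
    filter_upwards [hne] with s hs
    exact (hasDerivAt_inv_norm_line hs).smul (hx s)
  have h0 : z + (0 : ℝ) • v ≠ 0 := by simpa using hz0
  have hi : HasDerivAt (fun s : ℝ => inner ℝ (z + s • v) v) (‖v‖ ^ 2) 0 := by
    have := (hx 0).inner ℝ (hasDerivAt_const (0 : ℝ) v)
    simpa using this
  have h2 := ((hasDerivAt_inv_norm_line h0).smul_const v).add
    (((hi.mul ((hasDerivAt_inv_norm_line h0).pow 3)).neg).smul (hx 0))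
  have key := iteratedDeriv_two_comp (f := f)
    (γ := fun s : ℝ => ‖z + s • v‖⁻¹ • (z + s • v)) (s := 0) (by simpa [hz] using hf) h1 h2
  refine Eq.trans ?_ (key.trans ?_)
  · rfl
  · simp only [zero_smul, add_zero, hz, inv_one, one_smul, one_pow, mul_one]
    congr 2
    · rw [neg_smul, ← sub_eq_add_neg]
    · rw [neg_smul, ← sub_eq_add_neg]
    · simp only [Pi.neg_apply, Pi.mul_apply, Pi.pow_apply, zero_smul, add_zero, hz]
      module

end Inner

/-- The orthonormal basis `e_1, i e_1, e_2, i e_2, …` of `ℂ^{n+1}` over `ℝ`. -/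
def realBasis (n : ℕ) : OrthonormalBasis (Σ _ : Fin (n + 1), Fin 2) ℝ (Cn n) :=
  Pi.orthonormalBasis fun _ => Complex.orthonormalBasisOneI

lemma finrank_Cn (n : ℕ) : Module.finrank ℝ (Cn n) = 2 * n + 2 := by
  rw [Module.finrank_eq_card_basis (realBasis n).toBasis]
  simp
  ring

lemma sum_inner_smul_realBasis {n : ℕ} (z : Cn n) :
    ∑ i, inner ℝ z (realBasis n i) • realBasis n i = z := by
  conv_rhs => rw [← (realBasis n).sum_repr' z]
  exact Finset.sum_congr rfl fun i _ => by rw [real_inner_comm]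

lemma sum_inner_sq_realBasis {n : ℕ} (z : Cn n) :
    ∑ i, inner ℝ z (realBasis n i) ^ 2 = ‖z‖ ^ 2 := by
  rw [← (realBasis n).sum_sq_norm_inner_left z]
  simp

lemma laplacian_eq_sum {n : ℕ} (f : Cn n → ℝ) (x : Cn n) :
    Laplacian.laplacian f x =
      ∑ i, fderiv ℝ (fderiv ℝ f) x (realBasis n i) (realBasis n i) := by
  rw [InnerProductSpace.laplacian_eq_iteratedFDeriv_orthonormalBasis f (realBasis n)]
  simp [iteratedFDeriv_two_apply]

/-- The trace over the tangent hyperplane is the full trace less the normal contribution. -/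
lemma sum_bilin_tangential {n : ℕ} (B : Cn n →L[ℝ] Cn n →L[ℝ] ℝ) {z : Cn n} (hz : ‖z‖ = 1) :
    ∑ i, B (realBasis n i - inner ℝ z (realBasis n i) • z)
        (realBasis n i - inner ℝ z (realBasis n i) • z) =
      ∑ i, B (realBasis n i) (realBasis n i) - B z z := by
  set b := realBasis n
  have hrep : ∑ i, inner ℝ z (b i) • b i = z := sum_inner_smul_realBasis z
  have h1 : ∑ i, inner ℝ z (b i) * B (b i) z = B z z := by
    have := congr_arg (fun v => B v z) hrep
    simpa only [map_sum, map_smul, sum_apply, smul_apply, smul_eq_mul] using this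
  have h2 : ∑ i, inner ℝ z (b i) * B z (b i) = B z z := by
    have := congr_arg (fun v => B z v) hrep
    simpa only [map_sum, map_smul, smul_eq_mul] using this
  have h3 : ∑ i, inner ℝ z (b i) ^ 2 = 1 := by
    rw [sum_inner_sq_realBasis, hz, one_pow]
  calc _ = ∑ i, (B (b i) (b i) - inner ℝ z (b i) * B (b i) z - inner ℝ z (b i) * B z (b i)
        + inner ℝ z (b i) ^ 2 * B z z) := by
        refine Finset.sum_congr rfl fun i _ => ?_
        simp only [map_sub, map_smul, sub_apply, smul_apply,
          smul_eq_mul]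
        ring
    _ = _ := by
        rw [Finset.sum_add_distrib, Finset.sum_sub_distrib, Finset.sum_sub_distrib, h1, h2,
          ← Finset.sum_mul, h3]
        ring

/-- The spherical Laplacian in terms of the derivatives of any `C²` extension. -/
lemma sphereLaplacian_eq {n : ℕ} {f : Cn n → ℝ} {z : Cn n} (hz : ‖z‖ = 1)
    (hf : ContDiffAt ℝ 2 f z) :
    sphereLaplacian n f z = (1 / 2) * (Laplacian.laplacian f z - fderiv ℝ (fderiv ℝ f) z z z
      - (2 * n + 1) * fderiv ℝ f z z) := by
  rw [sphereLaplacian, laplacian_eq_sum, laplacian_eq_sum]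
  have h := fun i => fderiv_fderiv_radial hz hf (realBasis n i)
  change 1 / 2 * ∑ i, fderiv ℝ (fderiv ℝ fun x => f (‖x‖⁻¹ • x)) z _ _ = _
  simp_rw [h]
  rw [Finset.sum_add_distrib, sum_bilin_tangential _ hz, ← map_sum, Finset.sum_sub_distrib,
    ← Finset.sum_smul]
  set b := realBasis n
  have hrep : ∑ i, inner ℝ z (b i) • b i = z := sum_inner_smul_realBasis z
  have h3 : ∑ i, inner ℝ z (b i) ^ 2 = 1 := by
    rw [sum_inner_sq_realBasis, hz, one_pow]
  have h4 : ∑ i, (3 * inner ℝ z (b i) ^ 2 - ‖b i‖ ^ 2) = (3 - (2 * n + 2) : ℝ) := by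
    rw [Finset.sum_sub_distrib, ← Finset.mul_sum, h3]
    simp [b.norm_eq_one]
    ring
  have h5 : ∑ i, (2 * inner ℝ z (b i)) • b i = (2 : ℝ) • z := by
    conv_rhs => rw [← hrep, Finset.smul_sum]
    simp_rw [mul_smul]
  rw [h4, h5, ← sub_smul, map_smul, smul_eq_mul]
  ring

lemma hasDerivAt_rotation {n : ℕ} (z : Cn n) (s : ℝ) :
    HasDerivAt (fun s : ℝ => Complex.exp (s * Complex.I) • z)
      (Complex.exp (s * Complex.I) • (Complex.I • z)) s := by
  have h1 : HasDerivAt (fun s : ℝ => Complex.exp (s * Complex.I))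
      (Complex.exp (s * Complex.I) * Complex.I) s := by
    have := ((hasDerivAt_id (s : ℂ)).mul_const Complex.I).cexp.comp_ofReal
    simpa using this
  have := h1.smul_const z
  rwa [mul_smul] at this

/-- The orbit `e^{is} z` has velocity `iz` and acceleration `-z`; the latter produces the
first-order term. -/
lemma rotationSq_eq {n : ℕ} {f : Cn n → ℝ} {z : Cn n} (hf : ContDiffAt ℝ 2 f z) :
    rotationSq n f z =
      fderiv ℝ (fderiv ℝ f) z (Complex.I • z) (Complex.I • z) - fderiv ℝ f z z := by
  have key := iteratedDeriv_two_comp (f := f)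
    (γ := fun s : ℝ => Complex.exp (s * Complex.I) • z) (s := 0) (by simpa using hf)
    (Eventually.of_forall (hasDerivAt_rotation z)) (hasDerivAt_rotation (Complex.I • z) 0)
  rw [rotationSq]
  refine Eq.trans ?_ (key.trans ?_)
  · rfl
  · simp [smul_smul]
    ring

/-- The sub-Laplacian in terms of the derivatives of any `C²` extension. -/
lemma subLaplacian_eq {n : ℕ} {f : Cn n → ℝ} {z : Cn n} (hz : ‖z‖ = 1)
    (hf : ContDiffAt ℝ 2 f z) :
    subLaplacian n f z = (1 / 2) * (Laplacian.laplacian f z - fderiv ℝ (fderiv ℝ f) z z z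
      - fderiv ℝ (fderiv ℝ f) z (Complex.I • z) (Complex.I • z) - 2 * n * fderiv ℝ f z z) := by
  rw [subLaplacian, sphereLaplacian_eq hz hf, rotationSq_eq hf]
  ring

lemma norm_inv_norm_smul {n : ℕ} {x : Cn n} (hx : x ≠ 0) : ‖(‖x‖⁻¹ : ℝ) • x‖ = 1 := by
  rw [norm_smul, norm_inv, norm_norm, inv_mul_cancel₀ (norm_ne_zero_iff.2 hx)]

lemma ne_zero_of_norm_eq_one {n : ℕ} {z : Cn n} (hz : ‖z‖ = 1) : z ≠ 0 := by
  rintro rfl; simp at hz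

lemma radialExt_eq_self {n : ℕ} (f : Cn n → ℝ) {z : Cn n} (hz : ‖z‖ = 1) :
    radialExt n f z = f z := by
  simp [radialExt, hz]

lemma radialExt_smul {n : ℕ} (f : Cn n → ℝ) {r : ℝ} (hr : 0 < r) (x : Cn n) :
    radialExt n f (r • x) = radialExt n f x := by
  simp only [radialExt]
  rw [norm_smul, smul_smul, Real.norm_of_nonneg hr.le, mul_inv, mul_assoc, mul_comm _ r,
    ← mul_assoc, inv_mul_cancel₀ hr.ne', one_mul]

lemma norm_rotation {n : ℕ} (s : ℝ) (z : Cn n) : ‖Complex.exp (s * Complex.I) • z‖ = ‖z‖ := by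
  rw [norm_smul, Complex.norm_exp_ofReal_mul_I, one_mul]

lemma rotationSq_congr {n : ℕ} {f g : Cn n → ℝ} (h : ∀ z, ‖z‖ = 1 → f z = g z) {z : Cn n}
    (hz : ‖z‖ = 1) : rotationSq n f z = rotationSq n g z := by
  rw [rotationSq, rotationSq]
  congr 1
  ext s
  exact h _ ((norm_rotation s z).trans hz)

end

section

open ComplexConjugate

/-! ### The operators on functions of `ζ = ⟨w, z⟩`. -/

section Zonal

/-- The inner product with `w`, as a real linear map. -/
def innerCLM (n : ℕ) (w : Cn n) : Cn n →L[ℝ] ℂ := (innerSL ℂ w).restrictScalars ℝ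

lemma innerCLM_apply {n : ℕ} (w z : Cn n) : innerCLM n w z = inner ℂ w z := rfl

lemma fderiv_fderiv_comp_clm {E F : Type*} [NormedAddCommGroup E] [NormedSpace ℝ E]
    [NormedAddCommGroup F] [NormedSpace ℝ F] {g : F → ℝ} (L : E →L[ℝ] F) {x : E}
    (hg : ContDiffAt ℝ 2 g (L x)) (v : E) :
    fderiv ℝ (fderiv ℝ fun x => g (L x)) x v v =
      fderiv ℝ (fderiv ℝ g) (L x) (L v) (L v) := by
  have h : ContDiffAt ℝ 2 (fun x => g (L x)) x := hg.comp x L.contDiff.contDiffAt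
  rw [fderiv_fderiv_eq_iteratedDeriv h, fderiv_fderiv_eq_iteratedDeriv hg]
  simp

/-- The vectors `v` and `iv` are orthogonal of length `‖v‖`, so they compute the trace up to `‖v‖²`.
-/
lemma bilin_add_bilin_I (B : ℂ →L[ℝ] ℂ →L[ℝ] ℝ) (v : ℂ) :
    B v v + B (Complex.I * v) (Complex.I * v) =
      ‖v‖ ^ 2 * (B 1 1 + B Complex.I Complex.I) := by
  have h1 : v = v.re • (1 : ℂ) + v.im • Complex.I := by
    apply Complex.ext <;> simp
  have h2 : Complex.I * v = (-v.im) • (1 : ℂ) + v.re • Complex.I := by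
    apply Complex.ext <;> simp
  rw [h2, Complex.sq_norm, Complex.normSq_apply]
  conv_lhs => rw [h1]
  simp only [map_add, map_smul, add_apply, smul_apply, smul_eq_mul]
  simp
  ring

/-- The `j`-th complex direction contributes `‖w_j‖²` times the Laplacian of `g` on `ℂ`, and these
weights sum to `1`. -/
lemma laplacian_zonal {n : ℕ} {w z : Cn n} (hw : ‖w‖ = 1) {g : ℂ → ℝ}
    (hg : ContDiffAt ℝ 2 g (inner ℂ w z)) :
    Laplacian.laplacian (fun z => g (inner ℂ w z)) z =
      fderiv ℝ (fderiv ℝ g) (inner ℂ w z) 1 1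
        + fderiv ℝ (fderiv ℝ g) (inner ℂ w z) Complex.I Complex.I := by
  rw [laplacian_eq_sum]
  have h := fun v => fderiv_fderiv_comp_clm (innerCLM n w) (x := z) (g := g) hg v
  simp only [innerCLM_apply] at h
  simp_rw [h]
  rw [Fintype.sum_sigma]
  have e : ∀ j : Fin (n + 1), ∑ c : Fin 2,
      fderiv ℝ (fderiv ℝ g) (inner ℂ w z) (inner ℂ w (realBasis n ⟨j, c⟩))
        (inner ℂ w (realBasis n ⟨j, c⟩)) =
      ‖w j‖ ^ 2 * (fderiv ℝ (fderiv ℝ g) (inner ℂ w z) 1 1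
        + fderiv ℝ (fderiv ℝ g) (inner ℂ w z) Complex.I Complex.I) := by
    intro j
    have e0 : inner ℂ w (realBasis n ⟨j, 0⟩) = conj (w j) := by
      simp [realBasis, Pi.orthonormalBasis_apply, PiLp.inner_apply]
    have e1 : inner ℂ w (realBasis n ⟨j, 1⟩) = Complex.I * conj (w j) := by
      simp [realBasis, Pi.orthonormalBasis_apply, PiLp.inner_apply]
    rw [Fin.sum_univ_two, e0, e1, bilin_add_bilin_I, RCLike.norm_conj]
  simp_rw [e]
  rw [← Finset.sum_mul, ← EuclideanSpace.norm_sq_eq, hw, one_pow, one_mul]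

lemma inner_I_smul {n : ℕ} (w z : Cn n) : inner ℂ w (Complex.I • z) = Complex.I * inner ℂ w z := by
  rw [inner_smul_right]

/-- The sub-Laplacian of a zonal function. -/
lemma subLaplacian_zonal {n : ℕ} {w z : Cn n} (hw : ‖w‖ = 1) (hz : ‖z‖ = 1) {g : ℂ → ℝ}
    (hg : ContDiffAt ℝ 2 g (inner ℂ w z)) :
    subLaplacian n (fun z => g (inner ℂ w z)) z =
      (1 - ‖inner ℂ w z‖ ^ 2) / 2 * (fderiv ℝ (fderiv ℝ g) (inner ℂ w z) 1 1
        + fderiv ℝ (fderiv ℝ g) (inner ℂ w z) Complex.I Complex.I)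
      - n * fderiv ℝ g (inner ℂ w z) (inner ℂ w z) := by
  have hf : ContDiffAt ℝ 2 (fun z => g (inner ℂ w z)) z :=
    ContDiffAt.comp z (g := g) (f := innerCLM n w) hg (innerCLM n w).contDiff.contDiffAt
  have h := fun v => fderiv_fderiv_comp_clm (innerCLM n w) (x := z) (g := g) hg v
  simp only [innerCLM_apply] at h
  have h1 : fderiv ℝ (fun z => g (inner ℂ w z)) z z = fderiv ℝ g (inner ℂ w z) (inner ℂ w z) := by
    have := ((hg.differentiableAt (by simp)).hasFDerivAt).comp z (innerCLM n w).hasFDerivAt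
    rw [HasFDerivAt.fderiv (f := fun z => g (inner ℂ w z)) this]
    rfl
  rw [subLaplacian_eq hz hf, laplacian_zonal hw hg, h, h, h1, inner_I_smul]
  have := bilin_add_bilin_I (fderiv ℝ (fderiv ℝ g) (inner ℂ w z)) (inner ℂ w z)
  linear_combination (-1 / 2) * this

/-- The spherical Laplacian of a zonal function. -/
lemma sphereLaplacian_zonal {n : ℕ} {w z : Cn n} (hw : ‖w‖ = 1) (hz : ‖z‖ = 1) {g : ℂ → ℝ}
    (hg : ContDiffAt ℝ 2 g (inner ℂ w z)) :
    sphereLaplacian n (fun z => g (inner ℂ w z)) z =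
      (1 / 2) * (fderiv ℝ (fderiv ℝ g) (inner ℂ w z) 1 1
        + fderiv ℝ (fderiv ℝ g) (inner ℂ w z) Complex.I Complex.I
        - fderiv ℝ (fderiv ℝ g) (inner ℂ w z) (inner ℂ w z) (inner ℂ w z)
        - (2 * n + 1) * fderiv ℝ g (inner ℂ w z) (inner ℂ w z)) := by
  have hf : ContDiffAt ℝ 2 (fun z => g (inner ℂ w z)) z :=
    ContDiffAt.comp z (g := g) (f := innerCLM n w) hg (innerCLM n w).contDiff.contDiffAt
  have h := fun v => fderiv_fderiv_comp_clm (innerCLM n w) (x := z) (g := g) hg v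
  simp only [innerCLM_apply] at h
  have h1 : fderiv ℝ (fun z => g (inner ℂ w z)) z z = fderiv ℝ g (inner ℂ w z) (inner ℂ w z) := by
    have := ((hg.differentiableAt (by simp)).hasFDerivAt).comp z (innerCLM n w).hasFDerivAt
    rw [HasFDerivAt.fderiv (f := fun z => g (inner ℂ w z)) this]
    rfl
  rw [sphereLaplacian_eq hz hf, laplacian_zonal hw hg, h, h1]

lemma norm_inner_le_one {n : ℕ} {w z : Cn n} (hw : ‖w‖ = 1) (hz : ‖z‖ = 1) :
    ‖inner ℂ w z‖ ≤ 1 := by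
  simpa [hw, hz] using norm_inner_le_norm (𝕜 := ℂ) w z

variable {n : ℕ} {ε : ℕ → ℝ} {t₀ ρ₀ : ℝ}

/-- Zonal series solve the heat equation of the sub-Laplacian. -/
lemma ZonalSummable.heat (h : ZonalSummable n ε t₀ ρ₀) (hρ : 1 < ρ₀) {t : ℝ} (ht : t₀ < t)
    {w z : Cn n} (hw : ‖w‖ = 1) (hz : ‖z‖ = 1) :
    HasDerivAt (fun s => (zonalSeries n ε (s, inner ℂ w z)).re)
      (subLaplacian n (fun z => (zonalSeries n ε (t, inner ℂ w z)).re) z) t := by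
  have hζ : ‖inner ℂ w z‖ < ρ₀ := (norm_inner_le_one hw hz).trans_lt hρ
  have hg : ContDiffAt ℝ 2 (fun ζ => (zonalSeries n ε (t, ζ)).re) (inner ℂ w z) :=
    ExpSummable.contDiffAt_re_slice h ht hζ 2
  rw [subLaplacian_zonal hw hz hg]
  have h1 := (Complex.reCLM.hasFDerivAt).comp_hasDerivAt t (ExpSummable.hasDerivAt_time h ht hζ)
  refine HasDerivAt.congr_deriv (f := fun s => (zonalSeries n ε (s, inner ℂ w z)).re) h1 ?_
  have e1 := fun v w => ExpSummable.fderiv_fderiv_re h ht hζ v w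
  have e2 := fun v => ExpSummable.fderiv_re h ht hζ v
  change ∀ v w', fderiv ℝ (fderiv ℝ fun ζ => (zonalSeries n ε (t, ζ)).re) (inner ℂ w z) v w' = _
    at e1
  change ∀ v, fderiv ℝ (fun ζ => (zonalSeries n ε (t, ζ)).re) (inner ℂ w z) v = _ at e2
  rw [e1, e1, e2, Complex.reCLM_apply, h.heat_complex ht hζ]
  have e3 : (fun i : ℕ × ℕ × ℕ => (i.2.1 : ℂ) * ((i.2.2 : ℂ) * ((ε i.1 * zonalCoeff n i : ℝ) : ℂ)))
      = fun i => (i.2.2 : ℂ) * ((i.2.1 : ℂ) * ((ε i.1 * zonalCoeff n i : ℝ) : ℂ)) := by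
    ext i; ring
  rw [e3, Complex.sq_norm, Complex.normSq_apply]
  clear e1 e2 h1 hg hζ
  generalize inner ℂ w z = ζ
  simp [Complex.mul_re, Complex.mul_im]
  ring

/-- The zonal blocks are eigenfunctions of the spherical Laplacian. -/
lemma sphereLaplacian_block (n m : ℕ) (t : ℝ) {w z : Cn n} (hw : ‖w‖ = 1) (hz : ‖z‖ = 1) :
    sphereLaplacian n (fun z => (zonalSeries n (Pi.single m 1) (t, inner ℂ w z)).re) z =
      ((n : ℝ) ^ 2 - (m : ℝ) ^ 2) / 2 *
        (zonalSeries n (Pi.single m 1) (t, inner ℂ w z)).re := by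
  have h := zonalSummable_single n m (t - 1) 2
  have ht : t - 1 < t := by linarith
  have hζ : ‖inner ℂ w z‖ < 2 := (norm_inner_le_one hw hz).trans_lt (by norm_num)
  have hg : ContDiffAt ℝ 2 (fun ζ => (zonalSeries n (Pi.single m 1) (t, ζ)).re) (inner ℂ w z) :=
    ExpSummable.contDiffAt_re_slice h ht hζ 2
  rw [sphereLaplacian_zonal hw hz hg]
  have e1 := fun v w => ExpSummable.fderiv_fderiv_re h ht hζ v w
  have e2 := fun v => ExpSummable.fderiv_re h ht hζ v
  change ∀ v w', fderiv ℝ (fderiv ℝ fun ζ => (zonalSeries n (Pi.single m 1) (t, ζ)).re)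
    (inner ℂ w z) v w' = _ at e1
  change ∀ v, fderiv ℝ (fun ζ => (zonalSeries n (Pi.single m 1) (t, ζ)).re) (inner ℂ w z) v = _
    at e2
  have hs := h.sphere_complex ht hζ
  have hs' := (ExpSummable.hasSum (p := (t, inner ℂ w z)) h ht hζ).mul_left
    ((((n : ℝ) ^ 2 - (m : ℝ) ^ 2 : ℝ) : ℂ) / 2)
  have hEq := hs.unique (hasSum_of_forall_eq hs' fun i => ?_)
  · have hre := congr_arg Complex.re hEq
    have hr : ∀ x : ℂ, ((((n : ℝ) ^ 2 - (m : ℝ) ^ 2 : ℝ) : ℂ) / 2 * x).re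
        = ((n : ℝ) ^ 2 - (m : ℝ) ^ 2) / 2 * x.re := by
      intro x
      rw [← Complex.ofReal_ofNat, ← Complex.ofReal_div, Complex.re_ofReal_mul]
    rw [hr] at hre
    refine Eq.trans ?_ hre
    rw [e1, e1, e1, e2]
    have e3 : (fun i : ℕ × ℕ × ℕ =>
        (i.2.1 : ℂ) * ((i.2.2 : ℂ) * (((Pi.single m 1 : ℕ → ℝ) i.1 * zonalCoeff n i : ℝ) : ℂ)))
        = fun i => (i.2.2 : ℂ) *
          ((i.2.1 : ℂ) * (((Pi.single m 1 : ℕ → ℝ) i.1 * zonalCoeff n i : ℝ) : ℂ)) := by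
      ext i; ring
    rw [e3]
    have hh : ((2 * n + 1) / 2 : ℂ) = (((2 * n + 1) / 2 : ℝ) : ℂ) := by push_cast; ring
    have h2 : ∀ x : ℂ, (x / 2).re = x.re / 2 := fun x => by
      rw [← Complex.ofReal_ofNat, Complex.div_ofReal_re]
    rw [hh, Complex.sub_re, Complex.sub_re, h2, Complex.re_ofReal_mul]
    simp [Complex.mul_re, Complex.mul_im, pow_two]
    ring
  · by_cases hm : i.1 = m
    · rw [hm]
    · simp [expTerm, Pi.single_eq_of_ne hm]

end Zonal

end

section

/-! ### Green's formula in a shell around the unit sphere. -/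

section Cutoff

variable {n : ℕ} {χ : ℝ → ℝ}

/-- The radial cutoff confines all integrations by parts to a compact shell away from the origin,
where functions constant on rays need not be differentiable. -/
lemma tsupport_comp_norm_sq (hs : tsupport χ ⊆ Icc 1 3) :
    tsupport (fun x : Cn n => χ (‖x‖ ^ 2)) ⊆ {x | 1 ≤ ‖x‖ ^ 2 ∧ ‖x‖ ^ 2 ≤ 3} := by
  refine closure_minimal (fun x hx => hs (subset_tsupport _ hx)) ?_
  have h : Continuous fun x : Cn n => ‖x‖ ^ 2 := by fun_prop
  exact (isClosed_le continuous_const h).inter (isClosed_le h continuous_const)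

lemma hasCompactSupport_comp_norm_sq (hs : tsupport χ ⊆ Icc 1 3) :
    HasCompactSupport (fun x : Cn n => χ (‖x‖ ^ 2)) := by
  refine HasCompactSupport.of_support_subset_isCompact (isCompact_closedBall (0 : Cn n) 2) ?_
  intro x hx
  have h := tsupport_comp_norm_sq hs (subset_tsupport _ hx)
  rw [mem_closedBall_zero_iff]
  have h2 : ‖x‖ ^ 2 ≤ 3 := h.2
  nlinarith [norm_nonneg x]

lemma ne_zero_of_mem_tsupport (hs : tsupport χ ⊆ Icc 1 3) {x : Cn n}
    (hx : x ∈ tsupport (fun x : Cn n => χ (‖x‖ ^ 2))) : x ≠ 0 := by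
  rintro rfl
  have h : (1 : ℝ) ≤ ‖(0 : Cn n)‖ ^ 2 := (tsupport_comp_norm_sq hs hx).1
  norm_num at h

lemma fderiv_comp_norm_sq (hχ : ContDiff ℝ 1 χ) (x v : Cn n) :
    fderiv ℝ (fun x : Cn n => χ (‖x‖ ^ 2)) x v = deriv χ (‖x‖ ^ 2) * (2 * inner ℝ x v) := by
  have h1 : HasDerivAt χ (deriv χ (‖x‖ ^ 2)) (‖x‖ ^ 2) :=
    (hχ.differentiable (by simp) _).hasDerivAt
  have h2 := h1.comp_hasFDerivAt x (hasStrictFDerivAt_norm_sq x).hasFDerivAt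
  rw [HasFDerivAt.fderiv (f := fun x : Cn n => χ (‖x‖ ^ 2)) h2]
  simp

lemma contDiff_comp_norm_sq (hχ : ContDiff ℝ 1 χ) :
    ContDiff ℝ 1 (fun x : Cn n => χ (‖x‖ ^ 2)) :=
  hχ.comp (contDiff_norm_sq ℝ)

end Cutoff

section Divergence

variable {n : ℕ}

/-- A compactly supported function has no mean variation along a Killing field. -/
lemma integral_fderiv_affine {ψ : Cn n → ℝ} (hψ : ContDiff ℝ 1 ψ) (hc : HasCompactSupport ψ)
    (L : Cn n →L[ℝ] Cn n) (hL : ∀ x, inner ℝ x (L x) = 0) (v : Cn n) :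
    ∫ x, fderiv ℝ ψ x (L x + v) = 0 := by
  set b := realBasis n
  have hd : ∀ i, Differentiable ℝ fun x : Cn n => inner ℝ (b i) (L x + v) := fun i =>
    (innerSL ℝ (b i)).differentiable.comp (L.differentiable.add_const v)
  have e : ∀ x, fderiv ℝ ψ x (L x + v) =
      ∑ i, inner ℝ (b i) (L x + v) * fderiv ℝ ψ x (b i) := by
    intro x
    conv_lhs => rw [← b.sum_repr' (L x + v)]
    simp
  have hcont : ∀ w, Continuous fun x => fderiv ℝ ψ x w := fun w =>
    (hψ.continuous_fderiv (by simp)).clm_apply continuous_const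
  -- The field `Lx + v` is divergence free because `⟨b_i, L b_i⟩ = 0`, so integration by parts
  -- leaves nothing.
  have hf : ∀ i x, fderiv ℝ (fun x : Cn n => inner ℝ (b i) (L x + v)) x (b i) = 0 := by
    intro i x
    have h1 : HasFDerivAt (fun x : Cn n => inner ℝ (b i) (L x + v))
        ((innerSL ℝ (b i)).comp L) x :=
      (innerSL ℝ (b i)).hasFDerivAt.comp x (L.hasFDerivAt.add_const v)
    rw [h1.fderiv]
    simp [hL]
  have hint : ∀ i, Integrable fun x => inner ℝ (b i) (L x + v) * fderiv ℝ ψ x (b i) := fun i =>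
    ((hd i).continuous.mul (hcont _)).integrable_of_hasCompactSupport
      ((hc.fderiv_apply ℝ (b i)).mul_left)
  simp_rw [e]
  rw [integral_finsetSum _ fun i _ => hint i]
  refine Finset.sum_eq_zero fun i _ => ?_
  rw [integral_mul_fderiv_eq_neg_fderiv_mul_of_integrable]
  · simp [hf]
  · simp [hf]
  · exact hint i
  · exact ((hd i).continuous.mul hψ.continuous).integrable_of_hasCompactSupport hc.mul_left
  · exact fun x _ => hd i x
  · exact fun x _ => hψ.differentiable (by simp) x

variable {χ : ℝ → ℝ} {F G : Cn n → ℝ}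

/-- The Wronskian-type field entering Green's formula. -/
def wronskian (χ : ℝ → ℝ) (F G : Cn n → ℝ) (L : Cn n →L[ℝ] Cn n) (v x : Cn n) : ℝ :=
  χ (‖x‖ ^ 2) * (G x * fderiv ℝ F x (L x + v) - F x * fderiv ℝ G x (L x + v))

lemma hasFDerivAt_fderiv_affine (hF : ContDiffAt ℝ 2 F x) (L : Cn n →L[ℝ] Cn n) (v : Cn n) :
    HasFDerivAt (fun x => fderiv ℝ F x (L x + v))
      ((fderiv ℝ F x).comp L + (fderiv ℝ (fderiv ℝ F) x).flip (L x + v)) x := by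
  have hd : HasFDerivAt (fderiv ℝ F) (fderiv ℝ (fderiv ℝ F) x) x :=
    ((hF.fderiv_right (m := 1) (by norm_num)).differentiableAt (by simp)).hasFDerivAt
  exact hd.clm_apply (L.hasFDerivAt.add_const v)

lemma contDiff_wronskian (hχ : ContDiff ℝ 1 χ) (hs : tsupport χ ⊆ Icc 1 3)
    (hF : ∀ x ≠ 0, ContDiffAt ℝ 2 F x) (hG : ∀ x ≠ 0, ContDiffAt ℝ 2 G x)
    (L : Cn n →L[ℝ] Cn n) (v : Cn n) : ContDiff ℝ 1 (wronskian χ F G L v) := by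
  refine contDiff_iff_contDiffAt.2 fun x => ?_
  -- Off the support the function is locally zero; on it `x ≠ 0`, so `F` and `G` are smooth enough
  -- there.
  by_cases hx : x ∈ tsupport (wronskian χ F G L v)
  swap
  · exact contDiffAt_const.congr_of_eventuallyEq (notMem_tsupport_iff_eventuallyEq.1 hx)
  have hx0 : x ≠ 0 := ne_zero_of_mem_tsupport hs (tsupport_mul_subset_left hx)
  have hX : ContDiffAt ℝ 1 (fun x : Cn n => L x + v) x := by fun_prop
  have h1 : ∀ {F : Cn n → ℝ}, ContDiffAt ℝ 2 F x →
      ContDiffAt ℝ 1 (fun x => fderiv ℝ F x (L x + v)) x := fun h =>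
    (h.fderiv_right (m := 1) (by norm_num)).clm_apply hX
  have hF' := hF x hx0
  have hG' := hG x hx0
  exact (contDiff_comp_norm_sq hχ).contDiffAt.mul
    (((hG'.of_le (by norm_num)).mul (h1 hF')).sub ((hF'.of_le (by norm_num)).mul (h1 hG')))

lemma hasCompactSupport_wronskian (hs : tsupport χ ⊆ Icc 1 3)
    (L : Cn n →L[ℝ] Cn n) (v : Cn n) : HasCompactSupport (wronskian χ F G L v) :=
  (hasCompactSupport_comp_norm_sq hs).mul_right

lemma fderiv_wronskian (hχ : ContDiff ℝ 1 χ) (hF : ContDiffAt ℝ 2 F x) (hG : ContDiffAt ℝ 2 G x)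
    (L : Cn n →L[ℝ] Cn n) (v : Cn n) :
    fderiv ℝ (wronskian χ F G L v) x (L x + v) =
      deriv χ (‖x‖ ^ 2) * (2 * inner ℝ x (L x + v)) *
        (G x * fderiv ℝ F x (L x + v) - F x * fderiv ℝ G x (L x + v))
      + χ (‖x‖ ^ 2) *
        (G x * (fderiv ℝ (fderiv ℝ F) x (L x + v) (L x + v) + fderiv ℝ F x (L (L x + v)))
        - F x * (fderiv ℝ (fderiv ℝ G) x (L x + v) (L x + v) + fderiv ℝ G x (L (L x + v)))) := by
  have h1 := ((contDiff_comp_norm_sq (n := n) hχ).differentiable (by simp) x).hasFDerivAt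
  have hF1 := (hF.differentiableAt (by simp)).hasFDerivAt
  have hG1 := (hG.differentiableAt (by simp)).hasFDerivAt
  have h2 := h1.mul ((hG1.mul (hasFDerivAt_fderiv_affine hF L v)).sub
    (hF1.mul (hasFDerivAt_fderiv_affine hG L v)))
  rw [HasFDerivAt.fderiv (f := wronskian χ F G L v) h2]
  simp [fderiv_comp_norm_sq hχ]
  ring

lemma integral_fderiv_wronskian (hχ : ContDiff ℝ 1 χ) (hs : tsupport χ ⊆ Icc 1 3)
    (hF : ∀ x ≠ 0, ContDiffAt ℝ 2 F x) (hG : ∀ x ≠ 0, ContDiffAt ℝ 2 G x)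
    (L : Cn n →L[ℝ] Cn n) (hL : ∀ x, inner ℝ x (L x) = 0) (v : Cn n) :
    ∫ x, fderiv ℝ (wronskian χ F G L v) x (L x + v) = 0 :=
  integral_fderiv_affine (contDiff_wronskian hχ hs hF hG L v)
    (hasCompactSupport_wronskian hs L v) L hL v

lemma integral_eq_of_ne_zero {f g : Cn n → ℝ} (h : ∀ x ≠ 0, f x = g x) :
    ∫ x, f x = ∫ x, g x := by
  refine integral_congr_ae ?_
  have : ∀ᵐ x : Cn n, x ≠ 0 := by
    rw [ae_iff]; simp
  filter_upwards [this] with x hx using h x hx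

lemma fderiv_self_eq_zero {F : Cn n → ℝ} (hh : ∀ r : ℝ, 0 < r → ∀ x, F (r • x) = F x) {x : Cn n}
    (hF : DifferentiableAt ℝ F x) : fderiv ℝ F x x = 0 := by
  have h1 : HasDerivAt (fun r : ℝ => r • x) x 1 := by
    simpa using (hasDerivAt_id (1 : ℝ)).smul_const x
  have h2 : HasDerivAt (fun r : ℝ => F (r • x)) (fderiv ℝ F x x) 1 := by
    have hF' : HasFDerivAt F (fderiv ℝ F x) ((1 : ℝ) • x) := by simpa using hF.hasFDerivAt
    exact hF'.comp_hasDerivAt 1 h1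
  have h3 : (fun r : ℝ => F (r • x)) =ᶠ[𝓝 1] fun _ => F x := by
    filter_upwards [lt_mem_nhds (zero_lt_one' ℝ)] with r hr using hh r hr x
  exact h2.unique ((hasDerivAt_const (1 : ℝ) (F x)).congr_of_eventuallyEq h3)

lemma fderiv_fderiv_smul {F : Cn n → ℝ} (hh : ∀ r : ℝ, 0 < r → ∀ x, F (r • x) = F x) {r : ℝ}
    (hr : 0 < r) (x v w : Cn n) :
    r ^ 2 * fderiv ℝ (fderiv ℝ F) (r • x) v w = fderiv ℝ (fderiv ℝ F) x v w := by
  have h1 : ∀ x, fderiv ℝ F x = r • fderiv ℝ F (r • x) := fun x => by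
    rw [← fderiv_comp_smul]
    congr 1
    ext y
    exact (hh r hr y).symm
  have h2 : fderiv ℝ (fderiv ℝ F) x = r • r • fderiv ℝ (fderiv ℝ F) (r • x) := by
    rw [← fderiv_comp_smul, ← Pi.smul_apply, ← fderiv_const_smul_field]
    congr 1
    ext1 y
    exact h1 y
  rw [h2]
  simp [pow_two, mul_assoc]

/-- Green's formula for functions that are constant on rays. -/
lemma integral_laplacian_wronskian (hχ : ContDiff ℝ 1 χ) (hs : tsupport χ ⊆ Icc 1 3)
    (hF : ∀ x ≠ 0, ContDiffAt ℝ 2 F x) (hG : ∀ x ≠ 0, ContDiffAt ℝ 2 G x)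
    (hFh : ∀ r : ℝ, 0 < r → ∀ x, F (r • x) = F x) (hGh : ∀ r : ℝ, 0 < r → ∀ x, G (r • x) = G x) :
    ∫ x, χ (‖x‖ ^ 2) * (G x * Laplacian.laplacian F x - F x * Laplacian.laplacian G x) = 0 := by
  set b := realBasis n
  have h0 : ∀ i, ∫ x, fderiv ℝ (wronskian χ F G 0 (b i)) x (b i) = 0 := fun i => by
    simpa using integral_fderiv_wronskian hχ hs hF hG 0 (by simp) (b i)
  have hint : ∀ i, Integrable fun x => fderiv ℝ (wronskian χ F G 0 (b i)) x (b i) := fun i =>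
    (((contDiff_wronskian hχ hs hF hG 0 (b i)).continuous_fderiv (by simp)).clm_apply
      continuous_const).integrable_of_hasCompactSupport
      ((hasCompactSupport_wronskian hs 0 (b i)).fderiv_apply ℝ (b i))
  have h1 := integral_finsetSum Finset.univ fun i _ => hint i
  simp only [h0, Finset.sum_const_zero] at h1
  rw [← h1]
  refine integral_eq_of_ne_zero fun x hx => ?_
  have hFx := hF x hx
  have hGx := hG x hx
  have h2 : ∀ i, fderiv ℝ (wronskian χ F G 0 (b i)) x (b i) =
      2 * deriv χ (‖x‖ ^ 2) * (G x * (inner ℝ x (b i) * fderiv ℝ F x (b i))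
        - F x * (inner ℝ x (b i) * fderiv ℝ G x (b i)))
      + χ (‖x‖ ^ 2) * (G x * fderiv ℝ (fderiv ℝ F) x (b i) (b i)
        - F x * fderiv ℝ (fderiv ℝ G) x (b i) (b i)) := fun i => by
    have := fderiv_wronskian hχ hFx hGx 0 (b i)
    simp only [zero_apply, zero_add, map_zero, add_zero] at this
    rw [this]
    ring
  -- The gradient of the cutoff is radial and radial derivatives of `F` and `G` vanish, so the
  -- cutoff contributes no term.
  have h3 : ∀ {F : Cn n → ℝ}, ContDiffAt ℝ 2 F x → (∀ r : ℝ, 0 < r → ∀ x, F (r • x) = F x) →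
      ∑ i, inner ℝ x (b i) * fderiv ℝ F x (b i) = 0 := fun {F} hF hFh => by
    rw [← fderiv_self_eq_zero hFh (hF.differentiableAt (by simp))]
    have := congr_arg (fderiv ℝ F x) (sum_inner_smul_realBasis x)
    simpa only [map_sum, map_smul, smul_eq_mul] using this
  simp_rw [h2]
  rw [Finset.sum_add_distrib, ← Finset.mul_sum, ← Finset.mul_sum, Finset.sum_sub_distrib,
    Finset.sum_sub_distrib, ← Finset.mul_sum, ← Finset.mul_sum, ← Finset.mul_sum, ← Finset.mul_sum,
    h3 hFx hFh, h3 hGx hGh, laplacian_eq_sum, laplacian_eq_sum]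
  ring

/-- Multiplication by `i`. -/
def rotI (n : ℕ) : Cn n →L[ℝ] Cn n :=
  (Complex.I • ContinuousLinearMap.id ℂ (Cn n)).restrictScalars ℝ

lemma rotI_apply (x : Cn n) : rotI n x = Complex.I • x := rfl

lemma inner_rotI (x : Cn n) : inner ℝ x (rotI n x) = 0 := by
  simp only [PiLp.inner_apply, rotI_apply]
  simp
  exact Finset.sum_eq_zero fun i _ => by ring

/-- The field `ix` is tangent to spheres, so the cutoff is not differentiated, and the first-order
term along `i(ix) = -x` vanishes on functions constant on rays. -/
lemma integral_rotation_wronskian (hχ : ContDiff ℝ 1 χ) (hs : tsupport χ ⊆ Icc 1 3)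
    (hF : ∀ x ≠ 0, ContDiffAt ℝ 2 F x) (hG : ∀ x ≠ 0, ContDiffAt ℝ 2 G x)
    (hFh : ∀ r : ℝ, 0 < r → ∀ x, F (r • x) = F x) (hGh : ∀ r : ℝ, 0 < r → ∀ x, G (r • x) = G x) :
    ∫ x, χ (‖x‖ ^ 2) * (G x * fderiv ℝ (fderiv ℝ F) x (Complex.I • x) (Complex.I • x)
      - F x * fderiv ℝ (fderiv ℝ G) x (Complex.I • x) (Complex.I • x)) = 0 := by
  rw [← integral_fderiv_wronskian hχ hs hF hG (rotI n) inner_rotI 0]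
  refine integral_eq_of_ne_zero fun x hx => ?_
  have hFx := hF x hx
  have hGx := hG x hx
  rw [fderiv_wronskian hχ hFx hGx, add_zero, inner_rotI]
  have h : rotI n (rotI n x) = -x := by
    simp [rotI_apply, smul_smul]
  rw [h, map_neg, map_neg, fderiv_self_eq_zero hFh (hFx.differentiableAt (by simp)),
    fderiv_self_eq_zero hGh (hGx.differentiableAt (by simp)), rotI_apply]
  ring

end Divergence

/-! ### Passage from the shell to the sphere; symmetry of the operators. -/

section Polar

variable {n : ℕ}

/-- The surface measure of the unit sphere. -/
abbrev sphereMeasure (n : ℕ) : Measure (Metric.sphere (0 : Cn n) 1) :=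
  (volume : Measure (Cn n)).toSphere

/-- Polar coordinates identify Lebesgue measure off the origin with a product of the surface measure
and a radial measure. -/
lemma integral_polar (a : ℝ → ℝ) {H : Cn n → ℝ}
    (hH : ∀ r : ℝ, 0 < r → ∀ z, ‖z‖ = 1 → H (r • z) = H z) :
    ∫ x, a ‖x‖ * H x = (∫ z : Metric.sphere (0 : Cn n) 1, H z ∂sphereMeasure n) *
      ∫ r : Ioi (0 : ℝ), a r ∂Measure.volumeIoiPow (Module.finrank ℝ (Cn n) - 1) := by
  rw [← integral_prod_mul, ← (volume : Measure (Cn n)).measurePreserving_homeomorphUnitSphereProd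
    |>.integral_comp (Homeomorph.measurableEmbedding _)]
  have h1 : ∫ x : ({(0)}ᶜ : Set (Cn n)), a ‖x.1‖ * H x.1 ∂((volume : Measure (Cn n)).comap (↑)) =
      ∫ x, a ‖x‖ * H x := by
    rw [integral_subtype_comap (measurableSet_singleton _).compl fun x : Cn n => a ‖x‖ * H x,
      restrict_compl_singleton]
  rw [← h1]
  refine integral_congr_ae (Eventually.of_forall fun x => ?_)
  have hx : (x : Cn n) ≠ 0 := x.2
  have hp : 0 < ‖(x : Cn n)‖ := norm_pos_iff.2 hx
  have h2 : ((homeomorphUnitSphereProd (Cn n) x).1 : Cn n) = ‖(x : Cn n)‖⁻¹ • (x : Cn n) := by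
    simp [homeomorphUnitSphereProd]
  have h3 : ((homeomorphUnitSphereProd (Cn n) x).2 : ℝ) = ‖(x : Cn n)‖ := by
    simp [homeomorphUnitSphereProd]
  have h4 : H x.1 = H (homeomorphUnitSphereProd (Cn n) x).1 := by
    rw [← hH _ hp _ (norm_eq_of_mem_sphere _), h2, smul_smul, mul_inv_cancel₀ hp.ne', one_smul]
  simp only [h3, h4]
  ring

/-- A bump function of the squared radius. -/
def radialBump : ContDiffBump (2 : ℝ) := ⟨1 / 2, 1, by norm_num, by norm_num⟩

lemma tsupport_radialBump : tsupport radialBump ⊆ Icc 1 3 := by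
  rw [radialBump.tsupport_eq, Real.closedBall_eq_Icc]
  simp [radialBump]
  norm_num

lemma tsupport_mul_radialBump : tsupport (fun s => s * radialBump s) ⊆ Icc 1 3 :=
  tsupport_mul_subset_right.trans tsupport_radialBump

/-- The integral over the shell is the spherical integral times a radial one. The radial factor is
nonzero, as the choice `H = 1` gives the integral of a nontrivial nonnegative function. -/
lemma integral_sphere_eq_zero {H : Cn n → ℝ}
    (hH : ∀ r : ℝ, 0 < r → ∀ z, ‖z‖ = 1 → H (r • z) = H z)
    (h0 : ∫ x, radialBump (‖x‖ ^ 2) * H x = 0) :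
    ∫ z : Metric.sphere (0 : Cn n) 1, H z ∂sphereMeasure n = 0 := by
  have h1 := integral_polar (n := n) (fun r => radialBump (r ^ 2)) (H := fun _ => 1) (by simp)
  have h2 := integral_polar (n := n) (fun r => radialBump (r ^ 2)) hH
  rw [h0] at h2
  refine (mul_eq_zero.1 h2.symm).resolve_right fun h => ?_
  rw [h, mul_zero] at h1
  have hcont : Continuous fun x : Cn n => radialBump (‖x‖ ^ 2) * 1 := by
    have h1 : Continuous fun x : Cn n => ‖x‖ ^ 2 := by fun_prop
    exact (radialBump.continuous.comp h1).mul continuous_const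
  -- The point `√2 e_0` has squared norm `2`, the centre of the bump.
  refine (hcont.integral_pos_of_hasCompactSupport_nonneg_nonzero
    (hasCompactSupport_comp_norm_sq tsupport_radialBump).mul_right
    (fun x => by simpa using radialBump.nonneg) (x := √2 • EuclideanSpace.single 0 1) ?_).ne' h1
  · have : ‖(√2 • EuclideanSpace.single 0 1 : Cn n)‖ ^ 2 = 2 := by
      rw [norm_smul]
      simp
    rw [this, radialBump.one_of_mem_closedBall (by simp [radialBump])]
    norm_num

/-- The radial extension of `f` is `k` times continuously differentiable off the origin. -/
def SphereContDiff (n : ℕ) (k : WithTop ℕ∞) (f : Cn n → ℝ) : Prop :=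
  ∀ x ≠ 0, ContDiffAt ℝ k (radialExt n f) x

variable {f g : Cn n → ℝ}

lemma SphereContDiff.continuous {k : WithTop ℕ∞} (hf : SphereContDiff n k f) :
    Continuous fun z : Metric.sphere (0 : Cn n) 1 => f z := by
  have h : (fun z : Metric.sphere (0 : Cn n) 1 => f z) =
      fun z : Metric.sphere (0 : Cn n) 1 => radialExt n f z := by
    ext z; rw [radialExt_eq_self f (norm_eq_of_mem_sphere z)]
  rw [h, continuous_iff_continuousAt]
  intro z
  exact ContinuousAt.comp (f := fun z : Metric.sphere (0 : Cn n) 1 => (z : Cn n)) (x := z)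
    (hf z (ne_zero_of_norm_eq_one (norm_eq_of_mem_sphere z))).continuousAt
    continuous_subtype_val.continuousAt

lemma SphereContDiff.continuous_fderiv_fderiv (hf : SphereContDiff n 2 f)
    {V : Cn n → Cn n} (hV : Continuous V) :
    Continuous fun z : Metric.sphere (0 : Cn n) 1 =>
      fderiv ℝ (fderiv ℝ (radialExt n f)) z (V z) (V z) := by
  rw [continuous_iff_continuousAt]
  intro z
  have h1 := (((hf z (ne_zero_of_norm_eq_one (norm_eq_of_mem_sphere z))).fderiv_right (m := 1)
    (by norm_num)).fderiv_right (m := 0) (by norm_num)).continuousAt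
  have h2 := (h1.clm_apply hV.continuousAt).clm_apply hV.continuousAt
  exact ContinuousAt.comp (f := fun z : Metric.sphere (0 : Cn n) 1 => (z : Cn n)) (x := z)
    h2 continuous_subtype_val.continuousAt

lemma SphereContDiff.continuous_sphereLaplacian (hf : SphereContDiff n 2 f) :
    Continuous fun z : Metric.sphere (0 : Cn n) 1 => sphereLaplacian n f z := by
  simp only [sphereLaplacian, laplacian_eq_sum]
  exact continuous_const.mul (continuous_finsetSum _ fun i _ =>
    hf.continuous_fderiv_fderiv continuous_const)

lemma SphereContDiff.rotationSq_eq (hf : SphereContDiff n 2 f) {z : Cn n} (hz : ‖z‖ = 1) :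
    rotationSq n f z =
      fderiv ℝ (fderiv ℝ (radialExt n f)) z (Complex.I • z) (Complex.I • z) := by
  have hd := hf z (ne_zero_of_norm_eq_one hz)
  rw [← rotationSq_congr (fun z hz => radialExt_eq_self f hz) hz, CRSphere.rotationSq_eq hd,
    fderiv_self_eq_zero (fun r hr x => radialExt_smul f hr x) (hd.differentiableAt (by simp)),
    sub_zero]

lemma SphereContDiff.continuous_rotationSq (hf : SphereContDiff n 2 f) :
    Continuous fun z : Metric.sphere (0 : Cn n) 1 => rotationSq n f z := by
  have h : (fun z : Metric.sphere (0 : Cn n) 1 => rotationSq n f z) =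
      fun z : Metric.sphere (0 : Cn n) 1 =>
      fderiv ℝ (fderiv ℝ (radialExt n f)) (z : Cn n) (rotI n z) (rotI n z) := by
    ext z; exact hf.rotationSq_eq (norm_eq_of_mem_sphere z)
  rw [h]
  exact hf.continuous_fderiv_fderiv (rotI n).continuous

lemma SphereContDiff.continuous_subLaplacian (hf : SphereContDiff n 2 f) :
    Continuous fun z : Metric.sphere (0 : Cn n) 1 => subLaplacian n f z :=
  hf.continuous_sphereLaplacian.sub (continuous_const.mul hf.continuous_rotationSq)

lemma integrable_sphere {φ : Metric.sphere (0 : Cn n) 1 → ℝ} (h : Continuous φ) :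
    Integrable φ (sphereMeasure n) :=
  h.integrable_of_hasCompactSupport (HasCompactSupport.of_compactSpace φ)

lemma integrable_sphere_mul {φ ψ : Metric.sphere (0 : Cn n) 1 → ℝ} (h : Continuous φ)
    (h' : Continuous ψ) : Integrable (fun z => φ z * ψ z) (sphereMeasure n) :=
  integrable_sphere (h.mul h')

/-- The spherical Laplacian is symmetric. -/
lemma integral_sphereLaplacian_mul (hf : SphereContDiff n 2 f) (hg : SphereContDiff n 2 g) :
    ∫ z : Metric.sphere (0 : Cn n) 1, sphereLaplacian n f z * g z ∂sphereMeasure n =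
      ∫ z : Metric.sphere (0 : Cn n) 1, f z * sphereLaplacian n g z ∂sphereMeasure n := by
  rw [← sub_eq_zero, ← integral_sub
    (integrable_sphere_mul hf.continuous_sphereLaplacian hg.continuous)
    (integrable_sphere_mul hf.continuous hg.continuous_sphereLaplacian)]
  have hF := fun (r : ℝ) (hr : 0 < r) x => radialExt_smul f hr x
  have hG := fun (r : ℝ) (hr : 0 < r) x => radialExt_smul g hr x
  -- Laplacians of functions constant on rays are homogeneous of degree `-2`. The extra factor
  -- `‖x‖²` in the cutoff makes the rest of the integrand constant on rays.
  have h1 := integral_laplacian_wronskian (contDiff_id.mul radialBump.contDiff)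
    tsupport_mul_radialBump hf hg hF hG
  have h2 := integral_sphere_eq_zero (H := fun x => ‖x‖ ^ 2 *
    (radialExt n g x * Laplacian.laplacian (radialExt n f) x
      - radialExt n f x * Laplacian.laplacian (radialExt n g) x)) (n := n) ?_ ?_
  · rw [← mul_zero (1 / 2 : ℝ), ← h2, ← integral_const_mul]
    refine integral_congr_ae (Eventually.of_forall fun z => ?_)
    have hz : ‖(z : Cn n)‖ = 1 := norm_eq_of_mem_sphere z
    simp only [hz, sphereLaplacian, radialExt_eq_self f hz, radialExt_eq_self g hz]
    ring
  · intro r hr z hz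
    rw [hF r hr, hG r hr, norm_smul, Real.norm_of_nonneg hr.le, hz, one_pow, one_mul, mul_one,
      laplacian_eq_sum, laplacian_eq_sum, laplacian_eq_sum, laplacian_eq_sum]
    simp_rw [← fderiv_fderiv_smul hF hr z, ← fderiv_fderiv_smul hG hr z]
    rw [← Finset.mul_sum, ← Finset.mul_sum]
    ring
  · rw [← h1]
    refine integral_congr_ae (Eventually.of_forall fun z => ?_)
    simp only [id]
    ring

/-- The square of the rotation field is symmetric. -/
lemma integral_rotationSq_mul (hf : SphereContDiff n 2 f) (hg : SphereContDiff n 2 g) :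
    ∫ z : Metric.sphere (0 : Cn n) 1, rotationSq n f z * g z ∂sphereMeasure n =
      ∫ z : Metric.sphere (0 : Cn n) 1, f z * rotationSq n g z ∂sphereMeasure n := by
  rw [← sub_eq_zero, ← integral_sub
    (integrable_sphere_mul hf.continuous_rotationSq hg.continuous)
    (integrable_sphere_mul hf.continuous hg.continuous_rotationSq)]
  have hF := fun (r : ℝ) (hr : 0 < r) x => radialExt_smul f hr x
  have hG := fun (r : ℝ) (hr : 0 < r) x => radialExt_smul g hr x
  have h1 := integral_rotation_wronskian radialBump.contDiff tsupport_radialBump hf hg hF hG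
  refine Eq.trans ?_ (integral_sphere_eq_zero ?_ h1)
  · refine integral_congr_ae (Eventually.of_forall fun z => ?_)
    have hz : ‖(z : Cn n)‖ = 1 := norm_eq_of_mem_sphere z
    simp only [hf.rotationSq_eq hz, hg.rotationSq_eq hz, radialExt_eq_self f hz,
      radialExt_eq_self g hz]
    ring
  · intro r hr z hz
    rw [hF r hr, hG r hr, smul_comm Complex.I r z, ← fderiv_fderiv_smul hF hr z,
      ← fderiv_fderiv_smul hG hr z]
    simp only [map_smul, smul_apply, smul_eq_mul]
    ring

/-- The sub-Laplacian is symmetric. -/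
lemma integral_subLaplacian_mul (hf : SphereContDiff n 2 f) (hg : SphereContDiff n 2 g) :
    ∫ z : Metric.sphere (0 : Cn n) 1, subLaplacian n f z * g z ∂sphereMeasure n =
      ∫ z : Metric.sphere (0 : Cn n) 1, f z * subLaplacian n g z ∂sphereMeasure n := by
  simp only [subLaplacian, sub_mul, mul_sub, mul_assoc, mul_left_comm _ (1 / 2 : ℝ)]
  rw [integral_sub (integrable_sphere_mul hf.continuous_sphereLaplacian hg.continuous)
      ((integrable_sphere_mul hf.continuous_rotationSq hg.continuous).const_mul _),
    integral_sub (integrable_sphere_mul hf.continuous hg.continuous_sphereLaplacian)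
      ((integrable_sphere_mul hf.continuous hg.continuous_rotationSq).const_mul _),
    integral_const_mul, integral_const_mul, integral_sphereLaplacian_mul hf hg,
    integral_rotationSq_mul hf hg]

end Polar

end

section

open ComplexConjugate

/-! ### The geometry of `cosh` and the bound on the real part of `κ`. -/

section Cosh

lemma norm_cosh_sub_one (κ : ℂ) : ‖Complex.cosh κ - 1‖ = Real.cosh κ.re - Real.cos κ.im := by
  have h : 0 ≤ Real.cosh κ.re - Real.cos κ.im := by
    linarith [Real.one_le_cosh κ.re, Real.cos_le_one κ.im]
  rw [← sq_eq_sq₀ (norm_nonneg _) h, Complex.sq_norm, Complex.normSq_apply]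
  obtain ⟨a, b⟩ := κ
  have e : Complex.cosh ⟨a, b⟩ =
      Real.cosh a * Real.cos b + Real.sinh a * Real.sin b * Complex.I := by
    rw [Complex.mk_eq_add_mul_I, Complex.cosh_add, Complex.cosh_mul_I, Complex.sinh_mul_I]
    push_cast
    ring
  rw [e]
  simp only [Complex.sub_re, Complex.add_re, Complex.mul_re, Complex.ofReal_re, Complex.ofReal_im,
    Complex.I_re, Complex.I_im, Complex.one_re, Complex.sub_im, Complex.add_im, Complex.mul_im,
    Complex.one_im]
  have h1 := Real.cosh_sq a
  have h2 := Real.sin_sq_add_cos_sq b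
  ring_nf
  nlinarith [h1, h2]

lemma norm_cosh_add_one (κ : ℂ) : ‖Complex.cosh κ + 1‖ = Real.cosh κ.re + Real.cos κ.im := by
  have h := norm_cosh_sub_one (κ + Real.pi * Complex.I)
  rw [Complex.cosh_add, Complex.cosh_mul_I, Complex.sinh_mul_I] at h
  simp at h
  rw [← h, ← norm_neg]
  congr 1
  ring

/-- The points `cosh κ` with fixed `|Re κ|` lie on an ellipse with foci `±1`, so `|Re κ|` can be
compared through sums of distances to the foci. -/
lemma norm_cosh_sub_one_add (κ : ℂ) :
    ‖Complex.cosh κ - 1‖ + ‖Complex.cosh κ + 1‖ = 2 * Real.cosh κ.re := by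
  rw [norm_cosh_sub_one, norm_cosh_add_one]
  ring

/-- Scaling `cosh s` by a factor `c` in `[0, 1]` does not increase the real part of the inverse
hyperbolic cosine. -/
lemma abs_re_le_of_cosh_eq {c : ℝ} (hc0 : 0 ≤ c) (hc : c ≤ 1) {κ s : ℂ}
    (h : Complex.cosh κ = c * Complex.cosh s) : |κ.re| ≤ |s.re| := by
  rw [← Real.cosh_le_cosh]
  have h1 := norm_cosh_sub_one_add κ
  have h2 := norm_cosh_sub_one_add s
  rw [h] at h1
  -- The weights `(1 ± c)/2` are nonnegative with sum `1`; adding the two estimates shows that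
  -- scaling by `c` does not increase the sum of the distances to the foci.
  have e1 : (c : ℂ) * Complex.cosh s - 1 = ((1 + c) / 2 : ℝ) * (Complex.cosh s - 1)
      - ((1 - c) / 2 : ℝ) * (Complex.cosh s + 1) := by
    push_cast; ring
  have e2 : (c : ℂ) * Complex.cosh s + 1 = ((1 + c) / 2 : ℝ) * (Complex.cosh s + 1)
      - ((1 - c) / 2 : ℝ) * (Complex.cosh s - 1) := by
    push_cast; ring
  have n1 : ‖(c : ℂ) * Complex.cosh s - 1‖ ≤ (1 + c) / 2 * ‖Complex.cosh s - 1‖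
      + (1 - c) / 2 * ‖Complex.cosh s + 1‖ := by
    rw [e1]
    refine (norm_sub_le _ _).trans_eq ?_
    rw [norm_mul, norm_mul, Complex.norm_real, Complex.norm_real, Real.norm_of_nonneg (by linarith),
      Real.norm_of_nonneg (by linarith)]
  have n2 : ‖(c : ℂ) * Complex.cosh s + 1‖ ≤ (1 + c) / 2 * ‖Complex.cosh s + 1‖
      + (1 - c) / 2 * ‖Complex.cosh s - 1‖ := by
    rw [e2]
    refine (norm_sub_le _ _).trans_eq ?_
    rw [norm_mul, norm_mul, Complex.norm_real, Complex.norm_real, Real.norm_of_nonneg (by linarith),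
      Real.norm_of_nonneg (by linarith)]
  linarith

/-- The point `ζ` of the unit disc shifted by the imaginary rotation `iu`. -/
def shiftedCosh (ζ : ℂ) (u : ℝ) : ℂ := (ζ * Complex.exp u + conj ζ * Complex.exp (-u)) / 2

lemma shiftedCosh_polar (c φ u : ℝ) :
    shiftedCosh (c * Complex.exp (Complex.I * φ)) u = c * Complex.cosh (u + Complex.I * φ) := by
  rw [shiftedCosh, Complex.cosh, map_mul, ← Complex.exp_conj, map_mul, Complex.conj_I,
    Complex.conj_ofReal, Complex.conj_ofReal, mul_assoc, mul_assoc, ← Complex.exp_add,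
    ← Complex.exp_add]
  ring_nf

lemma exists_cosh_eq_shiftedCosh {ζ : ℂ} (hζ : ‖ζ‖ ≤ 1) (u : ℝ) :
    ∃ κ : ℂ, Complex.cosh κ = shiftedCosh ζ u ∧ |κ.re| ≤ |u| := by
  obtain ⟨γ, hγ⟩ := Complex.cos_surjective (shiftedCosh ζ u)
  have h1 : Complex.cosh (γ * Complex.I) = shiftedCosh ζ u := by rw [Complex.cosh_mul_I, hγ]
  refine ⟨γ * Complex.I, h1, ?_⟩
  have h2 : ζ = ‖ζ‖ * Complex.exp (Complex.I * ζ.arg) := by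
    rw [mul_comm Complex.I, Complex.norm_mul_exp_arg_mul_I]
  rw [h2, shiftedCosh_polar] at h1
  simpa using abs_re_le_of_cosh_eq (norm_nonneg ζ) hζ h1

lemma norm_chebDeriv_shiftedCosh_le (n m : ℕ) {ζ : ℂ} (hζ : ‖ζ‖ ≤ 1) (u : ℝ) :
    ‖(chebDeriv ℂ n m).eval (shiftedCosh ζ u)‖ ≤
      (m : ℝ) ^ (2 * n) * Real.exp ((m - n : ℕ) * |u|) := by
  obtain ⟨κ, h1, h2⟩ := exists_cosh_eq_shiftedCosh hζ u
  rw [← h1]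
  refine (norm_chebDeriv_eval_cosh_le n m κ).trans ?_
  gcongr

end Cosh

/-! ### Zonal blocks as Gaussian averages over imaginary rotations; their decay. -/

section Block

/-- The zonal block of index `m`. -/
def zonalBlock (n m : ℕ) (t : ℝ) (ζ : ℂ) : ℂ :=
  ∑ j ∈ Finset.range (m + 1), ∑ p ∈ Finset.HasAntidiagonal.antidiagonal j,
    (zonalCoeff n (m, p) : ℂ) * Real.exp (-(zonalEig n (m, p) * t)) * (ζ ^ p.1 * conj ζ ^ p.2)

lemma zonalSeries_single (n m : ℕ) (t : ℝ) (ζ : ℂ) :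
    zonalSeries n (Pi.single m 1) (t, ζ) = zonalBlock n m t ζ := by
  rw [zonalSeries, expSeries, zonalBlock, Finset.sum_sigma',
    tsum_eq_sum (s := ((Finset.range (m + 1)).sigma fun j =>
      Finset.HasAntidiagonal.antidiagonal j).image
      fun x => (m, x.2))]
  · rw [Finset.sum_image]
    · refine Finset.sum_congr rfl fun x _ => ?_
      simp [expTerm]
    · rintro ⟨j, p⟩ hx ⟨j', p'⟩ hx' h
      simp only [Finset.coe_sigma, Set.mem_sigma_iff, Finset.mem_coe,
        Finset.HasAntidiagonal.mem_antidiagonal] at hx hx'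
      obtain ⟨-, rfl⟩ := Prod.mk.inj h
      have : j = j' := hx.2.symm.trans hx'.2
      subst this
      rfl
  · rintro ⟨m', a, b⟩ hi
    by_cases hm : m' = m
    · subst hm
      have : m' < a + b + n := by
        by_contra hc
        apply hi
        simp only [Finset.mem_image, Finset.mem_sigma, Finset.mem_range,
          Finset.HasAntidiagonal.mem_antidiagonal]
        exact ⟨⟨a + b, (a, b)⟩, ⟨by simp; omega, rfl⟩, rfl⟩
      simp [expTerm, zonalCoeff_eq_zero this]
    · simp [expTerm, Pi.single_eq_of_ne hm]

lemma chebDeriv_natDegree_lt (n m : ℕ) : (chebDeriv ℂ n m).natDegree < m + 1 := by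
  rw [← chebDeriv_map]
  have h1 := Polynomial.natDegree_map_le (f := algebraMap ℝ ℂ) (p := chebDeriv ℝ n m)
  have h2 := chebDeriv_natDegree_le n m
  omega

lemma chebDeriv_eval_half_add (n m : ℕ) (x y : ℂ) :
    (chebDeriv ℂ n m).eval ((x + y) / 2) =
      ∑ j ∈ Finset.range (m + 1), ∑ p ∈ Finset.HasAntidiagonal.antidiagonal j,
        (zonalCoeff n (m, p) : ℂ) * (x ^ p.1 * y ^ p.2) := by
  rw [Polynomial.eval_eq_sum_range' (chebDeriv_natDegree_lt n m)]
  refine Finset.sum_congr rfl fun j _ => ?_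
  rw [div_pow, (Commute.all x y).add_pow', Finset.sum_div, Finset.mul_sum]
  refine Finset.sum_congr rfl fun p hp => ?_
  rw [Finset.HasAntidiagonal.mem_antidiagonal] at hp
  have : (chebDeriv ℂ n m).coeff j = ((chebDeriv ℝ n m).coeff j : ℝ) := by
    rw [← chebDeriv_map, Polynomial.coeff_map]
    rfl
  rw [this, zonalCoeff, hp, nsmul_eq_mul]
  push_cast
  ring

/-- At time `0` the zonal block is a derivative of a Chebyshev polynomial. -/
lemma zonalBlock_zero (n m : ℕ) (ζ : ℂ) :
    zonalBlock n m 0 ζ = ((chebDeriv ℝ n m).eval ζ.re : ℝ) := by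
  rw [← chebDeriv_eval_ofReal, Complex.re_eq_add_conj, chebDeriv_eval_half_add, zonalBlock]
  simp

lemma integral_gaussian_mul_exp {t : ℝ} (ht : 0 < t) (c : ℝ) :
    ∫ u : ℝ, Complex.exp (-(1 / (2 * t)) * u ^ 2 + c * u) =
      (√(2 * Real.pi * t) * Real.exp (c ^ 2 * t / 2) : ℝ) := by
  have htc : (t : ℂ) ≠ 0 := by exact_mod_cast ht.ne'
  have hb : (-(1 / (2 * t)) : ℂ).re < 0 := by
    have : (-(1 / (2 * t)) : ℂ) = (-(1 / (2 * t)) : ℝ) := by push_cast; ring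
    rw [this, Complex.ofReal_re]
    simp; positivity
  have h := integral_cexp_quadratic hb c 0
  simp only [add_zero] at h
  rw [h]
  have e1 : (Real.pi : ℂ) / -(-(1 / (2 * t))) = (2 * Real.pi * t : ℝ) := by
    push_cast; field_simp
  have e2 : (0 - (c : ℂ) ^ 2 / (4 * -(1 / (2 * t)))) = (c ^ 2 * t / 2 : ℝ) := by
    push_cast; field_simp; ring
  rw [e1, e2, Real.sqrt_eq_rpow, ← Complex.ofReal_exp, Complex.ofReal_mul (_ ^ _),
    Complex.ofReal_cpow (by positivity)]
  norm_num

lemma integrable_gaussian_mul_exp {t : ℝ} (ht : 0 < t) (c : ℝ) :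
    Integrable fun u : ℝ => Complex.exp (-(1 / (2 * t)) * u ^ 2 + c * u) := by
  have hb : (-(1 / (2 * t)) : ℂ).re < 0 := by
    have : (-(1 / (2 * t)) : ℂ) = (-(1 / (2 * t)) : ℝ) := by push_cast; ring
    rw [this, Complex.ofReal_re]
    simp; positivity
  simpa using integrable_cexp_quadratic' hb c 0

/-- Replacing `ζ, ζ̄` by `ζe^u, ζ̄e^{-u}` multiplies `ζ^a ζ̄^b` by `e^{(a-b)u}`. Integration against
the Gaussian turns this into `e^{(a-b)²t/2}`, the part of `e^{-λt}` that depends on `a - b`. -/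
lemma gaussian_mul_eval (n m : ℕ) (t : ℝ) (ζ : ℂ) (u : ℝ) :
    Complex.exp (-(1 / (2 * t)) * u ^ 2) * (chebDeriv ℂ n m).eval (shiftedCosh ζ u) =
      ∑ j ∈ Finset.range (m + 1), ∑ p ∈ Finset.HasAntidiagonal.antidiagonal j,
        (zonalCoeff n (m, p) : ℂ) * (ζ ^ p.1 * conj ζ ^ p.2) *
          Complex.exp (-(1 / (2 * t)) * u ^ 2 + ((p.1 : ℝ) - p.2 : ℝ) * u) := by
  rw [shiftedCosh, chebDeriv_eval_half_add, Finset.mul_sum]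
  refine Finset.sum_congr rfl fun j _ => ?_
  rw [Finset.mul_sum]
  refine Finset.sum_congr rfl fun p _ => ?_
  rw [Complex.exp_add, mul_pow, mul_pow, ← Complex.exp_nat_mul, ← Complex.exp_nat_mul]
  have : Complex.exp (((p.1 : ℝ) - p.2 : ℝ) * u) =
      Complex.exp (p.1 * u) * Complex.exp (p.2 * -u) := by
    rw [← Complex.exp_add]
    congr 1
    push_cast
    ring
  rw [this]
  ring

lemma integrable_gaussian_mul_eval (n m : ℕ) {t : ℝ} (ht : 0 < t) (ζ : ℂ) :
    Integrable fun u : ℝ => Complex.exp (-(1 / (2 * t)) * u ^ 2) *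
      (chebDeriv ℂ n m).eval (shiftedCosh ζ u) := by
  simp_rw [gaussian_mul_eval]
  exact integrable_finsetSum _ fun j _ => integrable_finsetSum _ fun p _ =>
    (integrable_gaussian_mul_exp ht _).const_mul _

/-- The zonal blocks as Gaussian averages. -/
lemma integral_gaussian_mul_eval (n m : ℕ) {t : ℝ} (ht : 0 < t) (ζ : ℂ) :
    ∫ u : ℝ, Complex.exp (-(1 / (2 * t)) * u ^ 2) * (chebDeriv ℂ n m).eval (shiftedCosh ζ u) =
      (√(2 * Real.pi * t) * Real.exp (((m : ℝ) ^ 2 - (n : ℝ) ^ 2) * t / 2) : ℝ) *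
        zonalBlock n m t ζ := by
  simp_rw [gaussian_mul_eval]
  rw [integral_finsetSum _ fun j _ => integrable_finsetSum _ fun p _ =>
    (integrable_gaussian_mul_exp ht _).const_mul _, zonalBlock, Finset.mul_sum]
  refine Finset.sum_congr rfl fun j _ => ?_
  rw [integral_finsetSum _ fun p _ => (integrable_gaussian_mul_exp ht _).const_mul _,
    Finset.mul_sum]
  refine Finset.sum_congr rfl fun p _ => ?_
  rw [integral_const_mul, integral_gaussian_mul_exp ht]
  have : Real.exp (((p.1 : ℝ) - p.2) ^ 2 * t / 2) =
      Real.exp (((m : ℝ) ^ 2 - (n : ℝ) ^ 2) * t / 2) * Real.exp (-(zonalEig n (m, p) * t)) := by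
    rw [← Real.exp_add, zonalEig]
    congr 1
    ring
  rw [this]
  push_cast
  ring

/-- The polynomial grows at most like `e^{(m-n)|u|}`, and `e^{d|u|} ≤ e^{du} + e^{-du}` reduces this
to two explicit Gaussian integrals. -/
lemma integral_norm_gaussian_mul_eval_le (n m : ℕ) {t : ℝ} (ht : 0 < t) {ζ : ℂ} (hζ : ‖ζ‖ ≤ 1) :
    ∫ u : ℝ, ‖Complex.exp (-(1 / (2 * t)) * u ^ 2) *
        (chebDeriv ℂ n m).eval (shiftedCosh ζ u)‖ ≤
      2 * √(2 * Real.pi * t) * (m : ℝ) ^ (2 * n) * Real.exp (((m - n : ℕ) : ℝ) ^ 2 * t / 2) := by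
  set d : ℝ := ((m - n : ℕ) : ℝ)
  have hn : ∀ c u : ℝ, ‖Complex.exp (-(1 / (2 * t)) * u ^ 2 + c * u)‖ =
      Real.exp (-(1 / (2 * t)) * u ^ 2 + c * u) := fun c u => by
    rw [Complex.norm_exp]
    congr 1
    have : (-(1 / (2 * t)) * u ^ 2 + c * u : ℂ) = (-(1 / (2 * t)) * u ^ 2 + c * u : ℝ) := by
      push_cast; ring
    rw [this, Complex.ofReal_re]
  have hI : ∀ c : ℝ, Integrable fun u : ℝ => Real.exp (-(1 / (2 * t)) * u ^ 2 + c * u) := fun c =>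
    (integrable_gaussian_mul_exp ht c).norm.congr (Eventually.of_forall fun u => hn c u)
  have hv : ∀ c : ℝ, ∫ u : ℝ, Real.exp (-(1 / (2 * t)) * u ^ 2 + c * u) =
      √(2 * Real.pi * t) * Real.exp (c ^ 2 * t / 2) := fun c => by
    have h := integral_gaussian_mul_exp ht c
    have e : ∀ u : ℝ, Complex.exp (-(1 / (2 * t)) * u ^ 2 + c * u) =
        (Real.exp (-(1 / (2 * t)) * u ^ 2 + c * u) : ℝ) := fun u => by push_cast; ring_nf
    simp_rw [e] at h
    rw [integral_complex_ofReal] at h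
    exact_mod_cast h
  calc _ ≤ ∫ u : ℝ, (m : ℝ) ^ (2 * n) * (Real.exp (-(1 / (2 * t)) * u ^ 2 + d * u)
        + Real.exp (-(1 / (2 * t)) * u ^ 2 + -d * u)) := by
        refine integral_mono (integrable_gaussian_mul_eval n m ht ζ).norm
          (((hI _).add (hI _)).const_mul _) fun u => ?_
        have h1 := hn 0 u
        simp only [Complex.ofReal_zero, zero_mul, add_zero] at h1
        simp only [norm_mul, h1]
        calc _ ≤ Real.exp (-(1 / (2 * t)) * u ^ 2) * ((m : ℝ) ^ (2 * n) * Real.exp (d * |u|)) := by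
              gcongr
              exact norm_chebDeriv_shiftedCosh_le n m hζ u
          _ = (m : ℝ) ^ (2 * n) * (Real.exp (-(1 / (2 * t)) * u ^ 2) * Real.exp (d * |u|)) := by
              ring
          _ ≤ _ := by
              gcongr
              rw [Real.exp_add, Real.exp_add, ← mul_add]
              gcongr
              rcases abs_cases u with ⟨h, _⟩ | ⟨h, _⟩ <;> rw [h]
              · linarith [Real.exp_pos (-d * u)]
              · rw [mul_neg, ← neg_mul]
                linarith [Real.exp_pos (d * u)]
    _ = _ := by
        rw [integral_const_mul, integral_add (hI _) (hI _), hv, hv, neg_sq]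
        ring

/-- A bound for the zonal blocks on the closed unit disc that decays with the index. -/
lemma norm_zonalBlock_le_exp (n m : ℕ) {t : ℝ} (ht : 0 < t) {ζ : ℂ} (hζ : ‖ζ‖ ≤ 1) :
    ‖zonalBlock n m t ζ‖ ≤ 2 * (m : ℝ) ^ (2 * n) * Real.exp (-(n * (m - n : ℕ) * t)) := by
  rcases lt_or_ge m n with hmn | hmn
  · have : zonalBlock n m t ζ = 0 := Finset.sum_eq_zero fun j _ => Finset.sum_eq_zero fun p _ => by
      rw [show zonalCoeff n (m, p) = 0 from zonalCoeff_eq_zero (by omega)]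
      simp
    rw [this, norm_zero]
    positivity
  have h1 := integral_gaussian_mul_eval n m ht ζ
  have h2 := (norm_integral_le_integral_norm _).trans
    (integral_norm_gaussian_mul_eval_le n m ht hζ)
  have hs : 0 < √(2 * Real.pi * t) := by positivity
  rw [h1, norm_mul, Complex.norm_real, Real.norm_of_nonneg (by positivity)] at h2
  -- `(m - n)² - (m² - n²) = -2n(m - n)`: for `n ≥ 1` this is exponential decay in `m`.
  have h3 : Real.exp (((m - n : ℕ) : ℝ) ^ 2 * t / 2) =
      Real.exp (((m : ℝ) ^ 2 - (n : ℝ) ^ 2) * t / 2) * Real.exp (-(n * (m - n : ℕ) * t)) := by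
    rw [← Real.exp_add, Nat.cast_sub hmn]
    congr 1
    ring
  rw [h3] at h2
  refine le_of_mul_le_mul_left (h2.trans_eq ?_)
    (by positivity : 0 < √(2 * Real.pi * t) * Real.exp (((m : ℝ) ^ 2 - (n : ℝ) ^ 2) * t / 2))
  ring

/-- A uniform bound for the zonal blocks on the closed unit disc. -/
lemma norm_zonalBlock_le (n m : ℕ) {t : ℝ} (ht : 0 < t) {ζ : ℂ} (hζ : ‖ζ‖ ≤ 1) :
    ‖zonalBlock n m t ζ‖ ≤ 2 * (m : ℝ) ^ (2 * n) := by
  refine (norm_zonalBlock_le_exp n m ht hζ).trans (mul_le_of_le_one_right (by positivity) ?_)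
  rw [Real.exp_le_one_iff, neg_nonpos]
  positivity

/-- The bounds for the zonal blocks are summable. -/
lemma summable_zonalBlock_bound {n : ℕ} (hn : 1 ≤ n) {t : ℝ} (ht : 0 < t) :
    Summable fun m : ℕ => 2 * (m : ℝ) ^ (2 * n) * Real.exp (-(n * (m - n : ℕ) * t)) := by
  have hn' : (0 : ℝ) < n := by exact_mod_cast hn
  have h1 : Real.exp (-(n * t)) < 1 := by
    rw [Real.exp_lt_one_iff]
    simpa using mul_pos hn' ht
  refine Summable.of_nonneg_of_le (fun m => by positivity) (fun m => ?_)
    ((summable_pow_mul_pow (2 * n) (Real.exp_pos _).le h1).mul_left (2 * Real.exp (n * n * t)))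
  rw [← Real.exp_nat_mul]
  calc _ ≤ 2 * (m : ℝ) ^ (2 * n) * Real.exp (n * n * t + m * -(n * t)) := by
        gcongr
        have : (m : ℝ) - n ≤ (m - n : ℕ) := by
          rw [sub_le_iff_le_add]
          exact_mod_cast (by omega : m ≤ (m - n) + n)
        nlinarith [mul_le_mul_of_nonneg_right this (mul_pos hn' ht).le]
    _ = _ := by rw [Real.exp_add]; ring

end Block

end

section

open ComplexConjugate

/-! ### Blocks as functions on the sphere; spectral properties. -/

section PoleBlock

/-- The real zonal block with pole `w`. -/
def poleBlock (n m : ℕ) (t : ℝ) (w z : Cn n) : ℝ := (zonalBlock n m t (inner ℂ w z)).re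

lemma poleBlock_eq (n m : ℕ) (t : ℝ) (w : Cn n) : poleBlock n m t w =
    fun z => (zonalSeries n (Pi.single m 1) (t, inner ℂ w z)).re := by
  ext z
  rw [poleBlock, zonalSeries_single]

lemma poleBlock_zero (n m : ℕ) (w z : Cn n) :
    poleBlock n m 0 w z = (chebDeriv ℝ n m).eval (inner ℂ w z).re := by
  rw [poleBlock, zonalBlock_zero, Complex.ofReal_re]

lemma contDiff_poleBlock_uncurry (n m : ℕ) (w : Cn n) :
    ContDiff ℝ ∞ fun p : ℝ × Cn n => poleBlock n m p.1 w p.2 := by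
  have h1 : ContDiff ℝ ∞ fun p : ℝ × Cn n => inner ℂ w p.2 :=
    (innerCLM n w).contDiff.comp contDiff_snd
  have h2 : ContDiff ℝ ∞ fun p : ℝ × Cn n => conj (inner ℂ w p.2) :=
    Complex.conjCLE.contDiff.comp h1
  have h3 : ∀ c : ℝ, ContDiff ℝ ∞ fun p : ℝ × Cn n => ((Real.exp (-(c * p.1)) : ℝ) : ℂ) := fun c =>
    Complex.ofRealCLM.contDiff.comp
      (Real.contDiff_exp.comp (contDiff_const.mul contDiff_fst).neg)
  refine Complex.reCLM.contDiff.comp (f := fun p : ℝ × Cn n => zonalBlock n m p.1 (inner ℂ w p.2))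
    ?_
  simp only [zonalBlock]
  exact ContDiff.sum fun j _ => ContDiff.sum fun p _ =>
    (contDiff_const.mul (h3 _)).mul ((h1.pow _).mul (h2.pow _))

lemma contDiff_poleBlock (n m : ℕ) (t : ℝ) (w : Cn n) : ContDiff ℝ ∞ (poleBlock n m t w) :=
  ContDiff.comp (g := fun p : ℝ × Cn n => poleBlock n m p.1 w p.2) (f := fun z : Cn n => (t, z))
    (contDiff_poleBlock_uncurry n m w) (contDiff_const.prodMk contDiff_id)

lemma SphereContDiff.of_contDiffAt {n : ℕ} {k : WithTop ℕ∞} {f : Cn n → ℝ}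
    (h : ∀ z, ‖z‖ = 1 → ContDiffAt ℝ k f z) : SphereContDiff n k f := fun x hx =>
  ContDiffAt.comp x (g := f) (f := fun x : Cn n => ‖x‖⁻¹ • x) (h _ (norm_inv_norm_smul hx))
    (((contDiffAt_norm ℝ hx).inv (norm_ne_zero_iff.2 hx)).smul contDiffAt_id)

lemma sphereContDiff_poleBlock (n m : ℕ) (t : ℝ) (w : Cn n) {k : ℕ} :
    SphereContDiff n k (poleBlock n m t w) :=
  .of_contDiffAt fun _ _ => ((contDiff_poleBlock n m t w).of_le (by
    exact_mod_cast le_top)).contDiffAt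

lemma abs_poleBlock_le (n m : ℕ) {t : ℝ} (ht : 0 < t) {w z : Cn n} (hw : ‖w‖ = 1) (hz : ‖z‖ = 1) :
    |poleBlock n m t w z| ≤ 2 * (m : ℝ) ^ (2 * n) :=
  (Complex.abs_re_le_norm _).trans (norm_zonalBlock_le n m ht (norm_inner_le_one hw hz))

lemma abs_re_inner_le_one {n : ℕ} {w z : Cn n} (hw : ‖w‖ = 1) (hz : ‖z‖ = 1) :
    |(inner ℂ w z).re| ≤ 1 :=
  (Complex.abs_re_le_norm _).trans (norm_inner_le_one hw hz)

lemma abs_poleBlock_zero_le (n m : ℕ) {w z : Cn n} (hw : ‖w‖ = 1) (hz : ‖z‖ = 1) :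
    |poleBlock n m 0 w z| ≤ (m : ℝ) ^ (2 * n) := by
  rw [poleBlock_zero]
  exact abs_chebDeriv_eval_le n m (abs_re_inner_le_one hw hz)

lemma sphereLaplacian_poleBlock (n m : ℕ) (t : ℝ) {w z : Cn n} (hw : ‖w‖ = 1) (hz : ‖z‖ = 1) :
    sphereLaplacian n (poleBlock n m t w) z =
      ((n : ℝ) ^ 2 - (m : ℝ) ^ 2) / 2 * poleBlock n m t w z := by
  rw [poleBlock_eq]
  exact sphereLaplacian_block n m t hw hz

lemma hasDerivAt_poleBlock (n m : ℕ) (t : ℝ) {w z : Cn n} (hw : ‖w‖ = 1) (hz : ‖z‖ = 1) :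
    HasDerivAt (fun s => poleBlock n m s w z) (subLaplacian n (poleBlock n m t w) z) t := by
  simp only [poleBlock_eq]
  exact (zonalSummable_single n m (t - 1) 2).heat (by norm_num) (by linarith) hw hz

lemma sphereLaplacian_const (n : ℕ) (c : ℝ) (z : Cn n) : sphereLaplacian n (fun _ => c) z = 0 := by
  rw [sphereLaplacian, laplacian_eq_sum]
  have : radialExt n (fun _ => c) = fun _ => c := rfl
  rw [this]
  simp

/-- Spectral decomposition: pairing with a block turns `Δ_S` into multiplication. -/
lemma integral_sphereLaplacian_mul_poleBlock (n m : ℕ) (t : ℝ) {w : Cn n} (hw : ‖w‖ = 1)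
    {f : Cn n → ℝ} (hf : SphereContDiff n 2 f) :
    ∫ z : Metric.sphere (0 : Cn n) 1, sphereLaplacian n f z * poleBlock n m t w z ∂sphereMeasure n =
      ((n : ℝ) ^ 2 - (m : ℝ) ^ 2) / 2 *
        ∫ z : Metric.sphere (0 : Cn n) 1, f z * poleBlock n m t w z ∂sphereMeasure n := by
  rw [integral_sphereLaplacian_mul hf (sphereContDiff_poleBlock n m t w (k := 2)),
    ← integral_const_mul]
  refine integral_congr_ae (Eventually.of_forall fun z => ?_)
  simp only
  rw [sphereLaplacian_poleBlock n m t hw (norm_eq_of_mem_sphere z)]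
  ring

/-- An eigenfunction of `Δ_S` with nonzero eigenvalue is orthogonal to the constants. -/
lemma integral_poleBlock_eq_zero {n m : ℕ} (hm : n < m) (t : ℝ) {w : Cn n} (hw : ‖w‖ = 1) :
    ∫ z : Metric.sphere (0 : Cn n) 1, poleBlock n m t w z ∂sphereMeasure n = 0 := by
  have h := integral_sphereLaplacian_mul_poleBlock n m t hw (f := fun _ => 1)
    (fun x _ => contDiffAt_const)
  simp only [sphereLaplacian_const, zero_mul, integral_zero, one_mul] at h
  refine (mul_eq_zero.1 h.symm).resolve_left ?_
  have : (n : ℝ) < m := by exact_mod_cast hm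
  have hn : (0 : ℝ) ≤ n := Nat.cast_nonneg n
  nlinarith

lemma sphereMeasure_univ (n : ℕ) :
    (sphereMeasure n).real univ = 2 * Real.pi ^ (n + 1) / n.factorial := by
  have hd : Module.finrank ℝ (Cn n) = 2 * (n + 1) := by rw [finrank_Cn]; ring
  rw [sphereMeasure, Measure.toSphere_real_apply_univ, Measure.real,
    InnerProductSpace.volume_ball_of_dim_even hd]
  simp only [ENNReal.ofReal_one, one_pow, one_mul]
  rw [ENNReal.toReal_ofReal (by positivity), hd, Nat.factorial_succ]
  push_cast
  field_simp

lemma chebDeriv_self_eval (n : ℕ) (x : ℝ) :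
    (chebDeriv ℝ n n).eval x = 2 ^ (n - 1) * n.factorial := by
  have h0 : (chebDeriv ℝ n n).natDegree ≤ 0 := by simpa using chebDeriv_natDegree_le n n
  rw [Polynomial.eq_C_of_natDegree_le_zero h0, Polynomial.eval_C, chebDeriv,
    Polynomial.coeff_iterate_derivative]
  have h := Polynomial.Chebyshev.leadingCoeff_T ℝ (n : ℤ)
  rw [Polynomial.leadingCoeff, Polynomial.Chebyshev.natDegree_T, Int.natAbs_natCast] at h
  rw [zero_add, h, Nat.descFactorial_self, nsmul_eq_mul, mul_comm]

end PoleBlock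

/-! ### The Poisson kernel and Abel summation of block expansions. -/

section Poisson

variable {n : ℕ}

/-- The Poisson kernel of the unit sphere with pole `w`, multiplied by `r^n`. -/
def poisson (n : ℕ) (w : Cn n) (r : ℝ) (z : Cn n) : ℝ :=
  n.factorial * (2 * r) ^ n * (1 - r ^ 2) /
    (1 - 2 * (inner ℂ w z).re * r + r ^ 2) ^ (n + 1) / (2 * Real.pi) ^ (n + 1)

lemma hasSum_poisson (hn : 1 ≤ n) {w z : Cn n} (hw : ‖w‖ = 1) (hz : ‖z‖ = 1) {r : ℝ}
    (hr0 : 0 ≤ r) (hr : r < 1) :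
    HasSum (fun m => 2 / (2 * Real.pi) ^ (n + 1) * r ^ m * poleBlock n m 0 w z)
      (poisson n w r z) := by
  refine hasSum_of_forall_eq ((hasSum_chebDeriv hn (abs_re_inner_le_one hw hz) hr0 hr).div_const
    ((2 * Real.pi) ^ (n + 1))) fun m => ?_
  rw [poleBlock_zero]
  ring

lemma continuous_inner_sphere (w : Cn n) :
    Continuous fun z : Metric.sphere (0 : Cn n) 1 => inner ℂ w (z : Cn n) :=
  (innerCLM n w).continuous.comp continuous_subtype_val

lemma continuous_poleBlock_sphere (m : ℕ) (t : ℝ) (w : Cn n) :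
    Continuous fun z : Metric.sphere (0 : Cn n) 1 => poleBlock n m t w z :=
  (contDiff_poleBlock n m t w).continuous.comp continuous_subtype_val

lemma continuous_poisson_sphere {w : Cn n} (hw : ‖w‖ = 1) {r : ℝ} (hr0 : 0 ≤ r) (hr : r < 1) :
    Continuous fun z : Metric.sphere (0 : Cn n) 1 => poisson n w r z := by
  have h1 : Continuous fun z : Metric.sphere (0 : Cn n) 1 => (inner ℂ w (z : Cn n)).re :=
    Complex.continuous_re.comp (continuous_inner_sphere w)
  refine ((continuous_const.div (((continuous_const.sub
    ((continuous_const.mul h1).mul continuous_const)).add continuous_const).pow _)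
    fun z => ?_).div_const _)
  exact pow_ne_zero _ (poisson_denominator_pos
    (abs_re_inner_le_one hw (norm_eq_of_mem_sphere z)) hr0 hr).ne'

lemma exists_bound_sphere {h : Metric.sphere (0 : Cn n) 1 → ℝ} (hh : Continuous h) :
    ∃ C, 0 ≤ C ∧ ∀ z, |h z| ≤ C := by
  obtain ⟨C, hC⟩ := isCompact_univ.exists_bound_of_continuousOn hh.continuousOn
  refine ⟨max C 0, le_max_right _ _, fun z => (hC z (mem_univ z)).trans (le_max_left _ _)⟩

lemma integral_abs_le_of_bound {φ : Metric.sphere (0 : Cn n) 1 → ℝ} {C : ℝ} (hC : ∀ z, |φ z| ≤ C) :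
    ‖∫ z, φ z ∂sphereMeasure n‖ ≤ C * (sphereMeasure n).real univ :=
  norm_integral_le_of_norm_le_const (Eventually.of_forall hC)

lemma hasSum_integral_poisson (hn : 1 ≤ n) {w : Cn n} (hw : ‖w‖ = 1) {r : ℝ}
    (hr0 : 0 ≤ r) (hr : r < 1) {h : Metric.sphere (0 : Cn n) 1 → ℝ} (hh : Continuous h) :
    HasSum (fun m => 2 / (2 * Real.pi) ^ (n + 1) * r ^ m *
        ∫ z : Metric.sphere (0 : Cn n) 1, poleBlock n m 0 w z * h z ∂sphereMeasure n)
      (∫ z : Metric.sphere (0 : Cn n) 1, poisson n w r z * h z ∂sphereMeasure n) := by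
  obtain ⟨C, hC0, hC⟩ := exists_bound_sphere hh
  set K : ℝ := 2 / (2 * Real.pi) ^ (n + 1)
  have hK : 0 ≤ K := by positivity
  have hcont : ∀ m, Continuous fun z : Metric.sphere (0 : Cn n) 1 =>
      K * r ^ m * (poleBlock n m 0 w z * h z) := fun m =>
    continuous_const.mul ((continuous_poleBlock_sphere m 0 w).mul hh)
  have hint := fun m => integrable_sphere (hcont m)
  have hb : ∀ m (z : Metric.sphere (0 : Cn n) 1), ‖K * r ^ m * (poleBlock n m 0 w z * h z)‖ ≤
      K * C * ((m : ℝ) ^ (2 * n) * r ^ m) := fun m z => by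
    rw [norm_mul, norm_mul, norm_mul, Real.norm_of_nonneg hK,
      Real.norm_of_nonneg (pow_nonneg hr0 m), Real.norm_eq_abs, Real.norm_eq_abs]
    calc _ ≤ K * r ^ m * ((m : ℝ) ^ (2 * n) * C) := by
          gcongr
          · exact abs_poleBlock_zero_le n m hw (norm_eq_of_mem_sphere z)
          · exact hC z
      _ = _ := by ring
  have hs : Summable fun m => ∫ z : Metric.sphere (0 : Cn n) 1,
      ‖K * r ^ m * (poleBlock n m 0 w z * h z)‖ ∂sphereMeasure n := by
    refine Summable.of_nonneg_of_le (fun m => integral_nonneg fun _ => norm_nonneg _) (fun m => ?_)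
      (((summable_pow_mul_pow (2 * n) hr0 hr).mul_left (K * C)).mul_right
        ((sphereMeasure n).real univ))
    refine (le_abs_self _).trans (integral_abs_le_of_bound fun z => ?_)
    rw [abs_norm]
    exact hb m z
  have key := hasSum_integral_of_summable_integral_norm hint hs
  simp only [integral_const_mul] at key
  have e : ∫ z : Metric.sphere (0 : Cn n) 1, poisson n w r z * h z ∂sphereMeasure n =
      ∫ z : Metric.sphere (0 : Cn n) 1, (∑' m, K * r ^ m * (poleBlock n m 0 w z * h z))
        ∂sphereMeasure n := by
    refine integral_congr_ae (Eventually.of_forall fun z => ?_)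
    have := (hasSum_poisson hn hw (norm_eq_of_mem_sphere z) hr0 hr).mul_right (h z)
    simp only [mul_assoc] at this
    simp only [mul_assoc]
    exact this.tsum_eq.symm
  rw [e]
  exact key

/-- Blocks with `m < n` vanish and those with `m > n` integrate to zero, so only the constant block
`m = n` contributes. The constant `2/(2π)^{n+1}` is the one that gives mass `r^n`. -/
lemma integral_poisson (hn : 1 ≤ n) {w : Cn n} (hw : ‖w‖ = 1) {r : ℝ}
    (hr0 : 0 ≤ r) (hr : r < 1) :
    ∫ z : Metric.sphere (0 : Cn n) 1, poisson n w r z ∂sphereMeasure n = r ^ n := by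
  have h := hasSum_integral_poisson hn hw hr0 hr (h := fun _ => 1) continuous_const
  simp only [mul_one] at h
  refine h.unique ?_
  have e : r ^ n = 2 / (2 * Real.pi) ^ (n + 1) * r ^ n *
      ∫ z : Metric.sphere (0 : Cn n) 1, poleBlock n n 0 w z ∂sphereMeasure n := by
    simp only [poleBlock_zero, chebDeriv_self_eval]
    rw [integral_const, sphereMeasure_univ, smul_eq_mul, mul_pow, pow_succ (2 : ℝ) n]
    obtain ⟨k, rfl⟩ := Nat.exists_eq_add_of_le' hn
    rw [Nat.add_sub_cancel, pow_succ (2 : ℝ) k]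
    field_simp
  rw [e]
  refine hasSum_single n fun m hm => ?_
  rcases lt_or_gt_of_ne hm with hm | hm
  · simp [poleBlock_zero, chebDeriv_eq_zero hm]
  · rw [integral_poleBlock_eq_zero hm 0 hw, mul_zero]

lemma poisson_nonneg {w z : Cn n} (hw : ‖w‖ = 1) (hz : ‖z‖ = 1) {r : ℝ} (hr0 : 0 ≤ r)
    (hr : r < 1) : 0 ≤ poisson n w r z := by
  have h1 := poisson_denominator_pos (abs_re_inner_le_one hw hz) hr0 hr
  have h2 : 0 ≤ 1 - r ^ 2 := by nlinarith
  unfold poisson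
  positivity

lemma two_sub_two_mul_re_inner {w z : Cn n} (hw : ‖w‖ = 1) (hz : ‖z‖ = 1) :
    2 - 2 * (inner ℂ w z).re = ‖z - w‖ ^ 2 := by
  rw [norm_sub_rev, @norm_sub_sq ℂ, hw, hz, RCLike.re_eq_complex_re]
  ring

lemma poisson_le {w z : Cn n} (hw : ‖w‖ = 1) (hz : ‖z‖ = 1) {r ε : ℝ} (hr0 : 1 / 2 ≤ r)
    (hr : r < 1) (hε : 0 < ε) (h : ε ≤ ‖z - w‖) :
    poisson n w r z ≤ n.factorial * 2 ^ n / (ε ^ 2 / 2) ^ (n + 1) / (2 * Real.pi) ^ (n + 1) *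
      (1 - r ^ 2) := by
  have h1 := two_sub_two_mul_re_inner hw hz
  -- The right side is `(1 - r)² + r‖z - w‖²`, and `r ≥ 1/2`.
  have h2 : ε ^ 2 / 2 ≤ 1 - 2 * (inner ℂ w z).re * r + r ^ 2 := by
    have h3 : ε ^ 2 ≤ ‖z - w‖ ^ 2 := by gcongr
    nlinarith [sq_nonneg (1 - r)]
  have h3 : 0 ≤ 1 - r ^ 2 := by nlinarith
  have h4 : (2 * r) ^ n ≤ 2 ^ n := by
    apply pow_le_pow_left₀ <;> linarith
  unfold poisson
  calc _ ≤ n.factorial * 2 ^ n * (1 - r ^ 2) / (ε ^ 2 / 2) ^ (n + 1) / (2 * Real.pi) ^ (n + 1) := by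
        gcongr
    _ = _ := by ring

/-- The Poisson kernels form an approximate identity. -/
lemma tendsto_integral_poisson (hn : 1 ≤ n) {w : Cn n} (hw : ‖w‖ = 1)
    {h : Metric.sphere (0 : Cn n) 1 → ℝ} (hh : Continuous h) :
    Tendsto (fun r => ∫ z : Metric.sphere (0 : Cn n) 1, poisson n w r z * h z ∂sphereMeasure n)
      (𝓝[<] 1) (𝓝 (h ⟨w, by simpa using hw⟩)) := by
  have hr : ∀ᶠ r : ℝ in 𝓝[<] 1, 1 / 2 ≤ r ∧ r < 1 := by
    filter_upwards [Ico_mem_nhdsLT (show (1 / 2 : ℝ) < 1 by norm_num)] with r hr using hr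
  have key := tendsto_setIntegral_peak_smul_of_integrableOn_of_tendsto (μ := sphereMeasure n)
    (s := univ) (t := univ) (l := 𝓝[<] (1 : ℝ)) (x₀ := (⟨w, by simpa using hw⟩ : Metric.sphere _ _))
    (φ := fun r z => poisson n w r z) (g := h) (a := h ⟨w, by simpa using hw⟩)
    MeasurableSet.univ MeasurableSet.univ subset_rfl univ_mem (measure_ne_top _ _) ?_ ?_ ?_ ?_
    (integrable_sphere hh).integrableOn ?_
  · simpa using key
  · filter_upwards [hr] with r hr z _
    exact poisson_nonneg hw (norm_eq_of_mem_sphere z) (by linarith [hr.1]) hr.2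
  · intro u hu hwu
    obtain ⟨ε, hε, hball⟩ := Metric.isOpen_iff.1 hu _ hwu
    rw [Metric.tendstoUniformlyOn_iff]
    intro η hη
    have hlim : Tendsto (fun r : ℝ => n.factorial * 2 ^ n / (ε ^ 2 / 2) ^ (n + 1) /
        (2 * Real.pi) ^ (n + 1) * (1 - r ^ 2)) (𝓝[<] 1) (𝓝 0) := by
      refine tendsto_nhdsWithin_of_tendsto_nhds ?_
      have : Continuous fun r : ℝ => n.factorial * 2 ^ n / (ε ^ 2 / 2) ^ (n + 1) /
        (2 * Real.pi) ^ (n + 1) * (1 - r ^ 2) := by fun_prop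
      simpa using this.tendsto 1
    filter_upwards [hr, hlim.eventually (gt_mem_nhds hη)] with r hr hr' z hz
    have hd : ε ≤ ‖(z : Cn n) - w‖ := by
      by_contra hc
      exact hz.2 (hball (by rw [Metric.mem_ball, Subtype.dist_eq, dist_eq_norm]; simpa using hc))
    have hz1 := norm_eq_of_mem_sphere z
    rw [Pi.zero_apply, dist_zero_left,
      Real.norm_of_nonneg (poisson_nonneg hw hz1 (by linarith [hr.1]) hr.2)]
    exact (poisson_le hw hz1 hr.1 hr.2 hε hd).trans_lt hr'
  · have : Tendsto (fun r : ℝ => r ^ n) (𝓝[<] 1) (𝓝 1) := by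
      refine tendsto_nhdsWithin_of_tendsto_nhds ?_
      simpa using (continuous_pow n).tendsto (1 : ℝ)
    refine this.congr' ?_
    filter_upwards [hr] with r hr
    rw [setIntegral_univ, integral_poisson hn hw (by linarith [hr.1]) hr.2]
  · filter_upwards [hr] with r hr
    exact (continuous_poisson_sphere hw (by linarith [hr.1]) hr.2).aestronglyMeasurable
  · rw [nhdsWithin_univ]
    exact hh.tendsto _

/-- If the expansion of a continuous function in zonal blocks converges absolutely at the pole,
it converges to the value there. -/
lemma tsum_integral_poleBlock (hn : 1 ≤ n) {w : Cn n} (hw : ‖w‖ = 1)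
    {h : Metric.sphere (0 : Cn n) 1 → ℝ} (hh : Continuous h)
    (hs : Summable fun m => ∫ z : Metric.sphere (0 : Cn n) 1,
      poleBlock n m 0 w z * h z ∂sphereMeasure n) :
    ∑' m, 2 / (2 * Real.pi) ^ (n + 1) *
        ∫ z : Metric.sphere (0 : Cn n) 1, poleBlock n m 0 w z * h z ∂sphereMeasure n =
      h ⟨w, by simpa using hw⟩ := by
  set I : ℕ → ℝ := fun m =>
    ∫ z : Metric.sphere (0 : Cn n) 1, poleBlock n m 0 w z * h z ∂sphereMeasure n
  have hr : ∀ᶠ r : ℝ in 𝓝[<] 1, 1 / 2 ≤ r ∧ r < 1 := by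
    filter_upwards [Ico_mem_nhdsLT (show (1 / 2 : ℝ) < 1 by norm_num)] with r hr using hr
  -- Abel summation: the summable coefficients dominate as `r → 1`, while the same sums are Poisson
  -- integrals, which tend to the value at the pole.
  have h1 : Tendsto (fun r : ℝ => ∑' m, 2 / (2 * Real.pi) ^ (n + 1) * r ^ m * I m) (𝓝[<] 1)
      (𝓝 (∑' m, 2 / (2 * Real.pi) ^ (n + 1) * I m)) := by
    refine tendsto_tsum_of_dominated_convergence (hs.norm.mul_left (2 / (2 * Real.pi) ^ (n + 1)))
      (fun m => ?_) ?_
    · refine tendsto_nhdsWithin_of_tendsto_nhds ?_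
      have : Continuous fun r : ℝ => 2 / (2 * Real.pi) ^ (n + 1) * r ^ m * I m := by fun_prop
      simpa using this.tendsto 1
    · filter_upwards [hr] with r hr m
      have h0 : 0 ≤ r := by linarith [hr.1]
      rw [norm_mul, norm_mul, Real.norm_of_nonneg (by positivity : 0 ≤ 2 / (2 * Real.pi) ^ (n + 1)),
        Real.norm_of_nonneg (pow_nonneg h0 m), mul_assoc]
      gcongr
      exact mul_le_of_le_one_left (norm_nonneg _) (pow_le_one₀ h0 hr.2.le)
  refine tendsto_nhds_unique (h1.congr' ?_) (tendsto_integral_poisson hn hw hh)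
  filter_upwards [hr] with r hr
  exact (hasSum_integral_poisson hn hw (by linarith [hr.1]) hr.2 hh).tsum_eq

end Poisson

end

section

open ComplexConjugate

/-! ### Differentiation under the integral, and the zonal series as a sum of blocks. -/

section ParametricIntegral

variable {n : ℕ}

lemma isOpen_cylinder (n : ℕ) : IsOpen (Ioi (0 : ℝ) ×ˢ ({0}ᶜ : Set (Cn n))) :=
  isOpen_Ioi.prod isOpen_compl_singleton

lemma mem_cylinder {s : ℝ} (hs : 0 < s) {z : Cn n} (hz : z ≠ 0) :
    ((s, z) : ℝ × Cn n) ∈ Ioi (0 : ℝ) ×ˢ ({0}ᶜ : Set (Cn n)) := ⟨hs, hz⟩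

/-- Integrals over the sphere may be differentiated with respect to a parameter. -/
lemma hasDerivAt_integral_sphere {Φ : ℝ × Cn n → ℝ}
    (hΦ : ContDiffOn ℝ 1 Φ (Ioi (0 : ℝ) ×ˢ ({0}ᶜ : Set (Cn n)))) {s : ℝ} (hs : 0 < s) :
    HasDerivAt (fun s => ∫ z : Metric.sphere (0 : Cn n) 1, Φ (s, z) ∂sphereMeasure n)
      (∫ z : Metric.sphere (0 : Cn n) 1, fderiv ℝ Φ (s, z) (1, 0) ∂sphereMeasure n) s := by
  have hmem : ∀ {r : ℝ}, 0 < r → ∀ z : Metric.sphere (0 : Cn n) 1,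
      ((r, (z : Cn n)) : ℝ × Cn n) ∈ Ioi (0 : ℝ) ×ˢ ({0}ᶜ : Set (Cn n)) := fun hr z =>
    mem_cylinder hr (ne_zero_of_norm_eq_one (norm_eq_of_mem_sphere z))
  have hat : ∀ {r : ℝ}, 0 < r → ∀ z : Metric.sphere (0 : Cn n) 1, ContDiffAt ℝ 1 Φ (r, z) :=
    fun hr z => hΦ.contDiffAt ((isOpen_cylinder n).mem_nhds (hmem hr z))
  have hpair : ∀ r : ℝ, Continuous fun z : Metric.sphere (0 : Cn n) 1 => (r, (z : Cn n)) :=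
    fun r => by fun_prop
  have hcΦ : ∀ {r : ℝ}, 0 < r → Continuous fun z : Metric.sphere (0 : Cn n) 1 => Φ (r, z) :=
    fun {r} hr => continuous_iff_continuousAt.2 fun z =>
      ContinuousAt.comp (g := Φ) (hat hr z).continuousAt (hpair r).continuousAt
  have hD : ContinuousOn (fun p => fderiv ℝ Φ p (1, 0)) (Ioi (0 : ℝ) ×ˢ ({0}ᶜ : Set (Cn n))) :=
    (hΦ.continuousOn_fderiv_of_isOpen (isOpen_cylinder n) (by simp)).clm_apply continuousOn_const
  have hcD : Continuous fun z : Metric.sphere (0 : Cn n) 1 => fderiv ℝ Φ (s, z) (1, 0) :=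
    hD.comp_continuous (hpair s) (hmem hs)
  have hK : IsCompact (Icc (s / 2) (2 * s) ×ˢ Metric.sphere (0 : Cn n) 1) :=
    isCompact_Icc.prod (isCompact_sphere 0 1)
  obtain ⟨C, hC⟩ := hK.exists_bound_of_continuousOn (hD.mono fun p hp =>
    mem_cylinder (by have := hp.1.1; linarith)
      (ne_zero_of_norm_eq_one (by simpa using hp.2)))
  have hI : Icc (s / 2) (2 * s) ∈ 𝓝 s := Icc_mem_nhds (by linarith) (by linarith)
  refine (hasDerivAt_integral_of_dominated_loc_of_deriv_le (bound := fun _ => C)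
    (F := fun r (z : Metric.sphere (0 : Cn n) 1) => Φ (r, z))
    (F' := fun r (z : Metric.sphere (0 : Cn n) 1) => fderiv ℝ Φ (r, z) (1, 0)) hI ?_
    (integrable_sphere (hcΦ hs)) hcD.aestronglyMeasurable
    (Eventually.of_forall fun z r hr => hC (r, z) ⟨hr, z.2⟩) (integrable_const _)
    (Eventually.of_forall fun z r hr => ?_)).2
  · filter_upwards [lt_mem_nhds hs] with r hr using (hcΦ hr).aestronglyMeasurable
  · have hr0 : 0 < r := by have := hr.1; linarith
    exact ((hat hr0 z).differentiableAt (by simp)).hasFDerivAt.comp_hasDerivAt r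
      ((hasDerivAt_id r).prodMk (hasDerivAt_const r (z : Cn n)))

end ParametricIntegral

section BlockSum

variable {n : ℕ}

lemma hasSum_zonalBlock_fiber (n m : ℕ) (t : ℝ) (ζ : ℂ) :
    HasSum (fun p : ℕ × ℕ => (zonalCoeff n (m, p) : ℂ) * Real.exp (-(zonalEig n (m, p) * t)) *
      (ζ ^ p.1 * conj ζ ^ p.2)) (zonalBlock n m t ζ) := by
  have h0 : ∀ i : ℕ × ℕ × ℕ, i.1 ≠ m → expTerm (fun i : ℕ × ℕ × ℕ =>
      (((Pi.single m 1 : ℕ → ℝ) i.1 * zonalCoeff n i : ℝ) : ℂ)) (zonalEig n) (fun i => i.2.1)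
      (fun i => i.2.2) i (t, ζ) = 0 := fun i hi => by
    simp [expTerm, Pi.single_eq_of_ne hi]
  have hinj : Function.Injective fun p : ℕ × ℕ => (m, p) := fun p q h => (Prod.mk.inj h).2
  rw [← zonalSeries_single, zonalSeries]
  have h := ExpSummable.hasSum (p := (t, ζ)) (zonalSummable_single n m (t - 1) (‖ζ‖ + 1))
    (by simp) (by simp)
  rw [← hinj.hasSum_iff (fun i hi => h0 i fun h => hi ⟨i.2, by rw [← h]⟩)] at h
  refine hasSum_of_forall_eq h fun p => ?_
  simp [expTerm]

lemma ZonalSummable.hasSum_block {c t₀ ρ₀ : ℝ} (h : ZonalSummable n (fun _ => c) t₀ ρ₀) {t : ℝ}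
    {ζ : ℂ} (ht : t₀ < t) (hζ : ‖ζ‖ < ρ₀) :
    HasSum (fun m => (c : ℂ) * zonalBlock n m t ζ) (zonalSeries n (fun _ => c) (t, ζ)) := by
  refine (ExpSummable.hasSum (p := (t, ζ)) h ht hζ).prod_fiberwise fun m => ?_
  refine hasSum_of_forall_eq ((hasSum_zonalBlock_fiber n m t ζ).mul_left (c : ℂ)) fun p => ?_
  simp only [expTerm]
  push_cast
  ring

lemma zonalSummable_const (hn : 1 ≤ n) (c : ℝ) {t₀ : ℝ} (ht : 0 < t₀) :
    ZonalSummable n (fun _ => c) t₀ (Real.exp (n * t₀)) := by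
  have h := zonalSummable_one hn ht
  refine ⟨fun i hi => h.nonneg i fun h => hi (by simp at h; simp [h]), fun t ht ρ hρ hρ' => ?_⟩
  refine ((h.summable t ht ρ hρ hρ').mul_left |c|).congr fun i => ?_
  simp only [Complex.ofReal_mul, norm_mul, Complex.norm_real, Real.norm_eq_abs, abs_one]
  ring

/-- The heat kernel of the sub-Laplacian as a zonal series. -/
def zonalHeatKernel (n : ℕ) (w : Cn n) (t : ℝ) (z : Cn n) : ℝ :=
  (zonalSeries n (fun _ => 2 / (2 * Real.pi) ^ (n + 1)) (t, inner ℂ w z)).re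

lemma one_lt_exp_mul (hn : 1 ≤ n) {t : ℝ} (ht : 0 < t) : 1 < Real.exp (n * t) := by
  have : (0 : ℝ) < n := by exact_mod_cast hn
  exact Real.one_lt_exp_iff.2 (by positivity)

lemma hasSum_zonalHeatKernel (hn : 1 ≤ n) {w z : Cn n} (hw : ‖w‖ = 1) (hz : ‖z‖ = 1) {t : ℝ}
    (ht : 0 < t) :
    HasSum (fun m => 2 / (2 * Real.pi) ^ (n + 1) * poleBlock n m t w z)
      (zonalHeatKernel n w t z) := by
  have h := (zonalSummable_const hn (2 / (2 * Real.pi) ^ (n + 1)) (half_pos ht)).hasSum_block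
    (half_lt_self ht)
    ((norm_inner_le_one hw hz).trans_lt (one_lt_exp_mul hn (half_pos ht)))
  refine hasSum_of_forall_eq (Complex.hasSum_re h) fun m => ?_
  rw [Complex.re_ofReal_mul, poleBlock]

lemma zonalBlock_conj (n m : ℕ) (t : ℝ) (ζ : ℂ) :
    zonalBlock n m t (conj ζ) = conj (zonalBlock n m t ζ) := by
  simp only [zonalBlock, map_sum, map_mul, map_pow, Complex.conj_ofReal]

lemma poleBlock_comm (n m : ℕ) (t : ℝ) (w z : Cn n) :
    poleBlock n m t w z = poleBlock n m t z w := by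
  rw [poleBlock, poleBlock, ← inner_conj_symm, zonalBlock_conj, Complex.conj_re]

end BlockSum

/-! ### Uniqueness of the heat kernel by pairing with backward solutions. -/

section Uniqueness

variable {n : ℕ} {w : Cn n} {P : ℝ → Cn n → ℝ}

lemma IsHeatKernel.contDiffAt (hP : IsHeatKernel n w P) {t : ℝ} (ht : 0 < t) {x : Cn n}
    (hx : x ≠ 0) : ContDiffAt ℝ 2 (fun p : ℝ × Cn n => radialExt n (P p.1) p.2) (t, x) :=
  hP.regular.contDiffAt ((isOpen_cylinder n).mem_nhds (mem_cylinder ht hx))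

lemma IsHeatKernel.sphereContDiff (hP : IsHeatKernel n w P) {t : ℝ} (ht : 0 < t) :
    SphereContDiff n 2 (P t) := fun x hx =>
  ContDiffAt.comp (g := fun p : ℝ × Cn n => radialExt n (P p.1) p.2) x (hP.contDiffAt ht hx)
    (contDiffAt_const.prodMk contDiffAt_id)

lemma IsHeatKernel.continuous (hP : IsHeatKernel n w P) {t : ℝ} (ht : 0 < t) :
    Continuous fun z : Metric.sphere (0 : Cn n) 1 => P t z :=
  (hP.sphereContDiff ht).continuous

/-- The pairing of a heat kernel with a solution of the backward equation is stationary. -/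
lemma IsHeatKernel.hasDerivAt_pairing (hP : IsHeatKernel n w P) (m : ℕ) {w' : Cn n}
    (hw' : ‖w'‖ = 1) (τ : ℝ) {s : ℝ} (hs : 0 < s) :
    HasDerivAt (fun s => ∫ z : Metric.sphere (0 : Cn n) 1,
      P s z * poleBlock n m (τ - s) w' z ∂sphereMeasure n) 0 s := by
  have hB : ContDiff ℝ ∞ fun p : ℝ × Cn n => poleBlock n m (τ - p.1) w' p.2 :=
    ContDiff.comp (g := fun p : ℝ × Cn n => poleBlock n m p.1 w' p.2)
      (f := fun p : ℝ × Cn n => (τ - p.1, p.2))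
      (contDiff_poleBlock_uncurry n m w') ((contDiff_const.sub contDiff_fst).prodMk contDiff_snd)
  have hΦ : ContDiffOn ℝ 1
      (fun p : ℝ × Cn n => radialExt n (P p.1) p.2 * poleBlock n m (τ - p.1) w' p.2)
      (Ioi (0 : ℝ) ×ˢ ({0}ᶜ : Set (Cn n))) :=
    (hP.regular.of_le (by norm_num)).mul (hB.of_le (by exact_mod_cast le_top)).contDiffOn
  have key := hasDerivAt_integral_sphere hΦ hs
  have e1 : (fun s => ∫ z : Metric.sphere (0 : Cn n) 1,
      P s z * poleBlock n m (τ - s) w' z ∂sphereMeasure n) = fun s =>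
      ∫ z : Metric.sphere (0 : Cn n) 1, radialExt n (P s) z * poleBlock n m (τ - s) w' z
        ∂sphereMeasure n := by
    ext s
    refine integral_congr_ae (Eventually.of_forall fun z => ?_)
    simp only [radialExt_eq_self _ (norm_eq_of_mem_sphere z)]
  rw [e1]
  refine key.congr_deriv ?_
  have hS := hP.sphereContDiff hs
  have hS' := sphereContDiff_poleBlock n m (τ - s) w' (k := 2)
  have e2 : ∀ z : Metric.sphere (0 : Cn n) 1,
      fderiv ℝ (fun p : ℝ × Cn n => radialExt n (P p.1) p.2 * poleBlock n m (τ - p.1) w' p.2)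
        (s, z) (1, 0) = subLaplacian n (P s) z * poleBlock n m (τ - s) w' z
          - P s z * subLaplacian n (poleBlock n m (τ - s) w') z := by
    intro z
    have hz := norm_eq_of_mem_sphere z
    have hd : DifferentiableAt ℝ
        (fun p : ℝ × Cn n => radialExt n (P p.1) p.2 * poleBlock n m (τ - p.1) w' p.2) (s, z) :=
      (hΦ.contDiffAt ((isOpen_cylinder n).mem_nhds
        (mem_cylinder hs (ne_zero_of_norm_eq_one hz)))).differentiableAt (by simp)
    have h1 := hd.hasFDerivAt.comp_hasDerivAt s
      ((hasDerivAt_id s).prodMk (hasDerivAt_const s (z : Cn n)))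
    have h2 := (hasDerivAt_poleBlock n m (τ - s) hw' hz).comp_const_sub τ s
    have h3 := (hP.heat s hs z hz).mul h2
    have h4 : (fun s => radialExt n (P s) (z : Cn n) * poleBlock n m (τ - s) w' z) =
        fun s => P s z * poleBlock n m (τ - s) w' z := by
      ext s; rw [radialExt_eq_self _ hz]
    change HasDerivAt (fun s => radialExt n (P s) (z : Cn n) * poleBlock n m (τ - s) w' z) _ s at h1
    rw [h4] at h1
    rw [h1.unique h3]
    ring
  simp_rw [e2]
  rw [integral_sub (integrable_sphere_mul hS.continuous_subLaplacian hS'.continuous)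
    (integrable_sphere_mul hS.continuous hS'.continuous_subLaplacian),
    integral_subLaplacian_mul hS hS', sub_self]

/-- The real part of a monomial in `ζ = ⟨w, z⟩` and its conjugate. -/
def poleMonomial (n : ℕ) (w : Cn n) (p : ℕ × ℕ) (z : Cn n) : ℝ :=
  (inner ℂ w z ^ p.1 * conj (inner ℂ w z) ^ p.2).re

lemma contDiff_poleMonomial (w : Cn n) (p : ℕ × ℕ) : ContDiff ℝ ∞ (poleMonomial n w p) := by
  have h1 : ContDiff ℝ ∞ fun z : Cn n => inner ℂ w z := (innerCLM n w).contDiff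
  have h2 : ContDiff ℝ ∞ fun z : Cn n => conj (inner ℂ w z) := Complex.conjCLE.contDiff.comp h1
  exact Complex.reCLM.contDiff.comp ((h1.pow p.1).mul (h2.pow p.2))

lemma poleBlock_eq_sum (n m : ℕ) (t : ℝ) (w z : Cn n) :
    poleBlock n m t w z = ∑ j ∈ Finset.range (m + 1),
      ∑ p ∈ Finset.HasAntidiagonal.antidiagonal j,
        zonalCoeff n (m, p) * Real.exp (-(zonalEig n (m, p) * t)) * poleMonomial n w p z := by
  simp only [poleBlock, zonalBlock, Complex.re_sum, poleMonomial, ← Complex.ofReal_mul,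
    Complex.re_ofReal_mul]

/-- The initial condition only tests against fixed smooth functions, whereas the block moves with
`s`. Expanded in monomials it depends on `s` only through finitely many continuous scalar factors.
-/
lemma IsHeatKernel.tendsto_pairing (hP : IsHeatKernel n w P) (m : ℕ) (w' : Cn n) (τ : ℝ) :
    Tendsto (fun s => ∫ z : Metric.sphere (0 : Cn n) 1,
      P s z * poleBlock n m (τ - s) w' z ∂sphereMeasure n) (𝓝[>] 0)
      (𝓝 (poleBlock n m τ w' w)) := by
  have h1 : ∀ p : ℕ × ℕ, Tendsto (fun s => zonalCoeff n (m, p) *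
      Real.exp (-(zonalEig n (m, p) * (τ - s))) *
        ∫ z : Metric.sphere (0 : Cn n) 1, P s z * poleMonomial n w' p z ∂sphereMeasure n) (𝓝[>] 0)
      (𝓝 (zonalCoeff n (m, p) * Real.exp (-(zonalEig n (m, p) * τ)) * poleMonomial n w' p w)) := by
    intro p
    refine Tendsto.mul (tendsto_nhdsWithin_of_tendsto_nhds ?_)
      (hP.initial _ (contDiff_poleMonomial w' p))
    have : Continuous fun s => zonalCoeff n (m, p) *
      Real.exp (-(zonalEig n (m, p) * (τ - s))) := by fun_prop
    simpa using this.tendsto 0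
  have h2 := tendsto_finsetSum (Finset.range (m + 1)) fun j _ =>
    tendsto_finsetSum (Finset.HasAntidiagonal.antidiagonal j) fun p _ => h1 p
  rw [← poleBlock_eq_sum] at h2
  refine h2.congr' ?_
  filter_upwards [self_mem_nhdsWithin] with s hs
  have hs' : 0 < s := hs
  have hint : ∀ p : ℕ × ℕ, Integrable (fun z : Metric.sphere (0 : Cn n) 1 =>
      zonalCoeff n (m, p) * Real.exp (-(zonalEig n (m, p) * (τ - s))) *
        (P s z * poleMonomial n w' p z)) (sphereMeasure n) := fun p =>
    (integrable_sphere_mul (hP.continuous hs')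
      ((contDiff_poleMonomial w' p).continuous.comp continuous_subtype_val)).const_mul _
  simp_rw [poleBlock_eq_sum, Finset.mul_sum, mul_left_comm (P s _)]
  rw [integral_finsetSum _ fun j _ => integrable_finsetSum _ fun p _ => hint p]
  refine Finset.sum_congr rfl fun j _ => ?_
  rw [integral_finsetSum _ fun p _ => hint p]
  refine Finset.sum_congr rfl fun p _ => ?_
  rw [integral_const_mul]

/-- The pairing is constant on `(0, ∞)`; it is evaluated at `s = τ` and in the limit `s → 0`. -/
lemma IsHeatKernel.integral_mul_poleBlock (hP : IsHeatKernel n w P) (m : ℕ) {w' : Cn n}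
    (hw' : ‖w'‖ = 1) {τ : ℝ} (hτ : 0 < τ) :
    ∫ z : Metric.sphere (0 : Cn n) 1, P τ z * poleBlock n m 0 w' z ∂sphereMeasure n =
      poleBlock n m τ w' w := by
  set u : ℝ → ℝ := fun s => ∫ z : Metric.sphere (0 : Cn n) 1,
      P s z * poleBlock n m (τ - s) w' z ∂sphereMeasure n
  have hu : ∀ s ∈ Ioi (0 : ℝ), HasDerivAt u 0 s := fun s hs => hP.hasDerivAt_pairing m hw' τ hs
  have hconst : ∀ s ∈ Ioi (0 : ℝ), u s = u τ := fun s hs => by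
    refine isOpen_Ioi.is_const_of_deriv_eq_zero isPreconnected_Ioi
      (fun s hs => (hu s hs).differentiableAt.differentiableWithinAt) (fun s hs => (hu s hs).deriv)
      hs hτ
  have hlim : Tendsto u (𝓝[>] 0) (𝓝 (u τ)) := by
    refine tendsto_const_nhds.congr' ?_
    filter_upwards [self_mem_nhdsWithin] with s hs using (hconst s hs).symm
  have := tendsto_nhds_unique hlim (hP.tendsto_pairing m w' τ)
  rw [← this]
  simp [u]

/-- Uniqueness of the heat kernel. -/
lemma IsHeatKernel.eq_zonalHeatKernel (hn : 1 ≤ n) (hw : ‖w‖ = 1) (hP : IsHeatKernel n w P)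
    {τ : ℝ} (hτ : 0 < τ) {z : Cn n} (hz : ‖z‖ = 1) : P τ z = zonalHeatKernel n w τ z := by
  have hsum := hasSum_zonalHeatKernel hn hw hz hτ
  -- `P τ` is expanded about its own argument `z`, not about `w`; by the symmetry of the blocks its
  -- coefficients are the terms of the zonal series, which also supplies summability.
  have e : ∀ m, ∫ x : Metric.sphere (0 : Cn n) 1, poleBlock n m 0 z x * P τ x ∂sphereMeasure n =
      poleBlock n m τ w z := fun m => by
    rw [poleBlock_comm n m τ w z, ← hP.integral_mul_poleBlock m hz hτ]
    simp only [mul_comm]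
  have h := tsum_integral_poleBlock hn hz (hP.continuous hτ) ?_
  · simp_rw [e] at h
    rw [← hsum.tsum_eq, h]
  · simp_rw [e]
    exact (summable_mul_left_iff (a := 2 / (2 * Real.pi) ^ (n + 1)) (by positivity)).1
      hsum.summable

end Uniqueness

end

section

/-! ### Existence: the zonal series has the right initial value. -/

section Existence

variable {n : ℕ} {w : Cn n}

lemma SphereContDiff.sphereLaplacian {f : Cn n → ℝ} (hf : SphereContDiff n ∞ f) :
    SphereContDiff n ∞ (sphereLaplacian n f) := by
  refine .of_contDiffAt fun z hz => ?_
  have h1 : ContDiffAt ℝ ∞ (fderiv ℝ (fderiv ℝ (radialExt n f))) z :=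
    ((hf z (ne_zero_of_norm_eq_one hz)).fderiv_right (m := ∞) (by simp)).fderiv_right (by simp)
  have h2 : CRSphere.sphereLaplacian n f = fun z => (1 / 2 : ℝ) *
      ∑ i, fderiv ℝ (fderiv ℝ (radialExt n f)) z (realBasis n i) (realBasis n i) := by
    ext z; rw [CRSphere.sphereLaplacian, laplacian_eq_sum]
  rw [h2]
  exact contDiffAt_const.mul (ContDiffAt.sum fun i _ =>
    (h1.clm_apply contDiffAt_const).clm_apply contDiffAt_const)

lemma SphereContDiff.of_top {f : Cn n → ℝ} (hf : SphereContDiff n ∞ f) : SphereContDiff n 2 f :=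
  fun x hx => (hf x hx).of_le
    (show ((2 : ℕ∞) : WithTop ℕ∞) ≤ ∞ by exact_mod_cast le_top)

lemma integral_iterate_sphereLaplacian (m : ℕ) (t : ℝ) (hw : ‖w‖ = 1) {f : Cn n → ℝ}
    (hf : SphereContDiff n ∞ f) (N : ℕ) :
    SphereContDiff n ∞ ((sphereLaplacian n)^[N] f) ∧
    ∫ z : Metric.sphere (0 : Cn n) 1, (sphereLaplacian n)^[N] f z * poleBlock n m t w z
        ∂sphereMeasure n =
      (((n : ℝ) ^ 2 - (m : ℝ) ^ 2) / 2) ^ N *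
        ∫ z : Metric.sphere (0 : Cn n) 1, f z * poleBlock n m t w z ∂sphereMeasure n := by
  induction N with
  | zero => exact ⟨hf, by simp⟩
  | succ N ih =>
    rw [Function.iterate_succ_apply']
    refine ⟨ih.1.sphereLaplacian, ?_⟩
    rw [integral_sphereLaplacian_mul_poleBlock n m t hw ih.1.of_top, ih.2]
    ring

/-- Rapid decay of the pairings of a smooth function with the zonal blocks. -/
lemma exists_bound_integral_mul_poleBlock (hw : ‖w‖ = 1) {f : Cn n → ℝ}
    (hf : SphereContDiff n ∞ f) :
    ∃ C, ∀ m : ℕ, n < m → ∀ t : ℝ, 0 ≤ t →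
      ‖∫ z : Metric.sphere (0 : Cn n) 1, poleBlock n m t w z * f z ∂sphereMeasure n‖ ≤
        C * (1 / (m : ℝ) ^ 2) := by
  -- Each application of `Δ_S` gains at least a factor `m/2` when `m > n`. Of these, `2n` compensate
  -- the growth `m^{2n}` of the blocks and two more give summability.
  set N := 2 * n + 2
  set g := (sphereLaplacian n)^[N] f
  have hg : SphereContDiff n ∞ g := (integral_iterate_sphereLaplacian 0 0 hw hf N).1
  obtain ⟨C, hC0, hC⟩ := exists_bound_sphere hg.continuous
  refine ⟨2 ^ N * (C * 2 * (sphereMeasure n).real univ), fun m hm t ht => ?_⟩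
  have hm' : (n : ℝ) + 1 ≤ m := by exact_mod_cast hm
  have hn0 : (0 : ℝ) ≤ n := Nat.cast_nonneg n
  have hm0 : (0 : ℝ) < m := by linarith
  have hB : ∀ z : Metric.sphere (0 : Cn n) 1,
      |g z * poleBlock n m t w z| ≤ C * (2 * (m : ℝ) ^ (2 * n)) := fun z => by
    rw [abs_mul]
    refine mul_le_mul (hC z) ?_ (abs_nonneg _) hC0
    rcases ht.eq_or_lt with rfl | ht
    · refine (abs_poleBlock_zero_le n m hw (norm_eq_of_mem_sphere z)).trans ?_
      linarith [pow_pos hm0 (2 * n)]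
    · exact abs_poleBlock_le n m ht hw (norm_eq_of_mem_sphere z)
  have h1 := integral_abs_le_of_bound hB
  rw [(integral_iterate_sphereLaplacian m t hw hf N).2, norm_mul, norm_pow] at h1
  have h2 : (m : ℝ) / 2 ≤ ‖((n : ℝ) ^ 2 - (m : ℝ) ^ 2) / 2‖ := by
    rw [Real.norm_eq_abs, abs_of_nonpos (by nlinarith)]
    nlinarith
  have h3 : ((m : ℝ) / 2) ^ N *
      ‖∫ z : Metric.sphere (0 : Cn n) 1, f z * poleBlock n m t w z ∂sphereMeasure n‖ ≤
      C * (2 * (m : ℝ) ^ (2 * n)) * (sphereMeasure n).real univ := by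
    refine le_trans ?_ h1
    gcongr
  simp_rw [mul_comm (poleBlock n m t w _)]
  rw [← le_div_iff₀' (by positivity)] at h3
  refine h3.trans_eq ?_
  have e : ((m : ℝ) / 2) ^ N = (m : ℝ) ^ (2 * n) * (m : ℝ) ^ 2 / 2 ^ N := by
    rw [div_pow, ← pow_add]
  rw [e]
  field_simp

/-- One majorant serves all `t ≥ 0`, so dominated convergence reaches `t = 0`. The finitely many
indices `m ≤ n`, not covered by the decay estimate, are bounded trivially. -/
lemma summable_integral_poleBlock_bound (hw : ‖w‖ = 1) {f : Cn n → ℝ}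
    (hf : SphereContDiff n ∞ f) :
    ∃ b : ℕ → ℝ, Summable b ∧ ∀ m : ℕ, ∀ t : ℝ, 0 ≤ t →
      ‖∫ z : Metric.sphere (0 : Cn n) 1, poleBlock n m t w z * f z ∂sphereMeasure n‖ ≤ b m := by
  obtain ⟨C, hC⟩ := exists_bound_integral_mul_poleBlock hw hf
  obtain ⟨D, hD0, hD⟩ := exists_bound_sphere hf.continuous
  refine ⟨fun m => if m ≤ n then 2 * (m : ℝ) ^ (2 * n) * D * (sphereMeasure n).real univ
    else C * (1 / (m : ℝ) ^ 2), ?_, fun m t ht => ?_⟩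
  · refine (summable_congr_cofinite ?_).1
      ((Real.summable_one_div_nat_pow.2 (by norm_num : 1 < 2)).mul_left C)
    filter_upwards [Nat.cofinite_eq_atTop ▸ eventually_gt_atTop n] with m hm
    rw [if_neg (by omega)]
  · by_cases hm : m ≤ n
    · simp only [if_pos hm]
      refine integral_abs_le_of_bound fun z => ?_
      rw [abs_mul]
      refine mul_le_mul ?_ (hD z) (abs_nonneg _) (by positivity)
      rcases ht.eq_or_lt with rfl | ht
      · refine (abs_poleBlock_zero_le n m hw (norm_eq_of_mem_sphere z)).trans ?_
        linarith [pow_nonneg (Nat.cast_nonneg (α := ℝ) m) (2 * n)]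
      · exact abs_poleBlock_le n m ht hw (norm_eq_of_mem_sphere z)
    · simp only [if_neg hm]
      exact hC m (by omega) t ht

lemma hasSum_integral_zonalHeatKernel (hn : 1 ≤ n) (hw : ‖w‖ = 1)
    {f : Metric.sphere (0 : Cn n) 1 → ℝ} (hf : Continuous f) {t : ℝ} (ht : 0 < t) :
    HasSum (fun m => 2 / (2 * Real.pi) ^ (n + 1) *
        ∫ z : Metric.sphere (0 : Cn n) 1, poleBlock n m t w z * f z ∂sphereMeasure n)
      (∫ z : Metric.sphere (0 : Cn n) 1, zonalHeatKernel n w t z * f z ∂sphereMeasure n) := by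
  obtain ⟨C, hC0, hC⟩ := exists_bound_sphere hf
  set K : ℝ := 2 / (2 * Real.pi) ^ (n + 1)
  have hK : 0 ≤ K := by positivity
  have hint : ∀ m, Integrable (fun z : Metric.sphere (0 : Cn n) 1 =>
      K * (poleBlock n m t w z * f z)) (sphereMeasure n) := fun m =>
    (integrable_sphere_mul (continuous_poleBlock_sphere m t w) hf).const_mul K
  have hs : Summable fun m => ∫ z : Metric.sphere (0 : Cn n) 1,
      ‖K * (poleBlock n m t w z * f z)‖ ∂sphereMeasure n := by
    refine Summable.of_nonneg_of_le (fun m => integral_nonneg fun _ => norm_nonneg _) (fun m => ?_)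
      ((((summable_zonalBlock_bound hn ht).mul_right C).mul_left K).mul_right
        ((sphereMeasure n).real univ))
    refine (le_abs_self _).trans (integral_abs_le_of_bound fun z => ?_)
    rw [abs_norm, norm_mul, norm_mul, Real.norm_of_nonneg hK, Real.norm_eq_abs, Real.norm_eq_abs]
    gcongr
    · exact (Complex.abs_re_le_norm _).trans
        (norm_zonalBlock_le_exp n m ht (norm_inner_le_one hw (norm_eq_of_mem_sphere z)))
    · exact hC z
  have key := hasSum_integral_of_summable_integral_norm hint hs
  simp only [integral_const_mul] at key
  have e : ∫ z : Metric.sphere (0 : Cn n) 1, zonalHeatKernel n w t z * f z ∂sphereMeasure n =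
      ∫ z : Metric.sphere (0 : Cn n) 1, (∑' m, K * (poleBlock n m t w z * f z))
        ∂sphereMeasure n := by
    refine integral_congr_ae (Eventually.of_forall fun z => ?_)
    have := (hasSum_zonalHeatKernel hn hw (norm_eq_of_mem_sphere z) ht).mul_right (f z)
    simp only [mul_assoc] at this
    exact this.tsum_eq.symm
  rw [e]
  exact key

lemma continuous_integral_poleBlock (m : ℕ) {f : Metric.sphere (0 : Cn n) 1 → ℝ}
    (hf : Continuous f) : Continuous fun t : ℝ =>
      ∫ z : Metric.sphere (0 : Cn n) 1, poleBlock n m t w z * f z ∂sphereMeasure n := by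
  have h := continuous_parametric_integral_of_continuous (μ := sphereMeasure n)
    (f := fun t (z : Metric.sphere (0 : Cn n) 1) => poleBlock n m t w z * f z) ?_ isCompact_univ
  · simpa using h
  · have h1 : Continuous fun p : ℝ × Metric.sphere (0 : Cn n) 1 => (p.1, (p.2 : Cn n)) := by
      fun_prop
    exact ((contDiff_poleBlock_uncurry n m w).continuous.comp h1).mul (hf.comp continuous_snd)

lemma contDiffOn_zonalHeatKernel (hn : 1 ≤ n) (hw : ‖w‖ = 1) :
    ContDiffOn ℝ 2 (fun p : ℝ × Cn n => radialExt n (zonalHeatKernel n w p.1) p.2)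
      (Ioi (0 : ℝ) ×ˢ ({0}ᶜ : Set (Cn n))) := by
  rintro ⟨t, x⟩ ⟨ht, hx⟩
  have ht' : 0 < t := ht
  have hx' : x ≠ 0 := hx
  refine ContDiffAt.contDiffWithinAt ?_
  have h1 := (ExpSummable.contDiffOn 2
    (zonalSummable_const hn (2 / (2 * Real.pi) ^ (n + 1)) (half_pos ht'))).contDiffAt
      (x := (t, inner ℂ w (‖x‖⁻¹ • x)))
      ((isOpen_expDomain _ _).mem_nhds ⟨half_lt_self ht', by
        rw [mem_ball_zero_iff]
        exact (norm_inner_le_one hw (norm_inv_norm_smul hx')).trans_lt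
          (one_lt_exp_mul hn (half_pos ht'))⟩)
  have h2 : ContDiffAt ℝ 2 (fun x : Cn n => ‖x‖⁻¹ • x) x :=
    ((contDiffAt_norm ℝ hx').inv (norm_ne_zero_iff.2 hx')).smul contDiffAt_id
  have h3 : ContDiffAt ℝ 2 (fun p : ℝ × Cn n => (p.1, inner ℂ w (‖p.2‖⁻¹ • p.2))) (t, x) :=
    contDiffAt_fst.prodMk ((innerCLM n w).contDiff.contDiffAt.comp (t, x)
      (ContDiffAt.comp (g := fun x : Cn n => ‖x‖⁻¹ • x) (t, x) h2 contDiffAt_snd))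
  exact Complex.reCLM.contDiff.contDiffAt.comp (t, x) (h1.comp (t, x) h3)

/-- The zonal series is a heat kernel. -/
lemma isHeatKernel_zonalHeatKernel (hn : 1 ≤ n) (hw : ‖w‖ = 1) :
    IsHeatKernel n w (zonalHeatKernel n w) where
  regular := contDiffOn_zonalHeatKernel hn hw
  heat t ht z hz := (zonalSummable_const hn (2 / (2 * Real.pi) ^ (n + 1)) (half_pos ht)).heat
    (one_lt_exp_mul hn (half_pos ht)) (half_lt_self ht) hw hz
  initial f hf := by
    have hS : SphereContDiff n ∞ f := .of_contDiffAt fun z _ => hf.contDiffAt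
    obtain ⟨b, hb, hbound⟩ := summable_integral_poleBlock_bound hw hS
    have hlim : Tendsto (fun t : ℝ => ∑' m, 2 / (2 * Real.pi) ^ (n + 1) *
        ∫ z : Metric.sphere (0 : Cn n) 1, poleBlock n m t w z * f z ∂sphereMeasure n) (𝓝[>] 0)
        (𝓝 (∑' m, 2 / (2 * Real.pi) ^ (n + 1) *
        ∫ z : Metric.sphere (0 : Cn n) 1, poleBlock n m 0 w z * f z ∂sphereMeasure n)) := by
      refine tendsto_tsum_of_dominated_convergence (hb.mul_left (2 / (2 * Real.pi) ^ (n + 1)))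
        (fun m => tendsto_nhdsWithin_of_tendsto_nhds
          ((continuous_const.mul (continuous_integral_poleBlock m hS.continuous)).tendsto 0)) ?_
      filter_upwards [self_mem_nhdsWithin] with t ht m
      rw [norm_mul, Real.norm_of_nonneg (by positivity)]
      gcongr
      exact hbound m t (le_of_lt ht)
    rw [tsum_integral_poleBlock hn hw hS.continuous
      (Summable.of_norm_bounded hb fun m => hbound m 0 le_rfl)] at hlim
    refine hlim.congr' ?_
    filter_upwards [self_mem_nhdsWithin] with t ht
    exact (hasSum_integral_zonalHeatKernel hn hw hS.continuous ht).tsum_eq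

end Existence

end

section

/-! ### The branch `κ`: strip and measurability. -/

section Kappa

lemma half_cpow_sq (x : ℂ) : (x ^ (1 / 2 : ℂ)) ^ 2 = x := by
  rw [one_div]
  exact Complex.cpow_nat_inv_pow x two_ne_zero

lemma arccos_aux (x : ℂ) : (x + Complex.I * (1 - x ^ 2) ^ (1 / 2 : ℂ)) *
    (x - Complex.I * (1 - x ^ 2) ^ (1 / 2 : ℂ)) = 1 := by
  have h := half_cpow_sq (1 - x ^ 2)
  linear_combination h - ((1 - x ^ 2) ^ (1 / 2 : ℂ)) ^ 2 * Complex.I_sq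

lemma cos_arccos (x : ℂ) : Complex.cos (arccos x) = x := by
  have h := arccos_aux x
  have hw : x + Complex.I * (1 - x ^ 2) ^ (1 / 2 : ℂ) ≠ 0 := left_ne_zero_of_mul_eq_one h
  rw [Complex.cos, arccos]
  have e1 : -Complex.I * Complex.log (x + Complex.I * (1 - x ^ 2) ^ (1 / 2 : ℂ)) * Complex.I =
      Complex.log (x + Complex.I * (1 - x ^ 2) ^ (1 / 2 : ℂ)) := by
    linear_combination -Complex.log (x + Complex.I * (1 - x ^ 2) ^ (1 / 2 : ℂ)) * Complex.I_sq
  rw [neg_mul (-Complex.I * _), e1, Complex.exp_neg, Complex.exp_log hw,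
    inv_eq_of_mul_eq_one_right h]
  ring

lemma arccos_re (x : ℂ) :
    (arccos x).re = (x + Complex.I * (1 - x ^ 2) ^ (1 / 2 : ℂ)).arg := by
  simp [arccos, Complex.log_im]

/-- The imaginary part is `Im x + Re √y` with `y = 1 - x²`. Here `(Re √y)² = (|y| + Re y)/2 ≥ (Im
x)²`, because `|y| ≥ |x|² - 1`. The logarithm is thus taken in the closed upper half plane, whence
`0 ≤ Im κ ≤ π`. -/
lemma arccos_aux_im_nonneg (x : ℂ) : 0 ≤ (x + Complex.I * (1 - x ^ 2) ^ (1 / 2 : ℂ)).im := by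
  have h1 : ‖x‖ ^ 2 - 1 ≤ ‖1 - x ^ 2‖ := by
    have := norm_sub_norm_le (x ^ 2) 1
    rw [norm_sub_rev, norm_pow, norm_one] at this
    exact this
  have h2 : |x.im| ≤ ((1 - x ^ 2) ^ (1 / 2 : ℂ)).re := by
    rw [one_div, Complex.cpow_inv_two_re]
    apply Real.abs_le_sqrt
    rw [Complex.sq_norm, Complex.normSq_apply] at h1
    have h3 : (1 - x ^ 2).re = 1 - (x.re ^ 2 - x.im ^ 2) := by
      simp [pow_two]
    rw [h3]
    nlinarith
  have h3 : (x + Complex.I * (1 - x ^ 2) ^ (1 / 2 : ℂ)).im =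
      x.im + ((1 - x ^ 2) ^ (1 / 2 : ℂ)).re := by
    rw [Complex.add_im, Complex.I_mul_im]
  rw [h3]
  linarith [neg_abs_le x.im]

lemma cosh_kappa (θ φ u : ℝ) :
    Complex.cosh (kappa θ φ u) = Real.cos θ * Complex.cosh (u + Complex.I * φ) := by
  rw [kappa, mul_comm Complex.I (arccos _), Complex.cosh_mul_I, cos_arccos]

lemma kappa_im_nonneg (θ φ u : ℝ) : 0 ≤ (kappa θ φ u).im := by
  rw [kappa, Complex.I_mul_im, arccos_re, Complex.arg_nonneg_iff]
  exact arccos_aux_im_nonneg _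

lemma kappa_im_le_pi (θ φ u : ℝ) : (kappa θ φ u).im ≤ Real.pi := by
  rw [kappa, Complex.I_mul_im, arccos_re]
  exact Complex.arg_le_pi _

lemma abs_kappa_re_le {θ : ℝ} (hθ : 0 ≤ Real.cos θ) (φ u : ℝ) : |(kappa θ φ u).re| ≤ |u| := by
  simpa using abs_re_le_of_cosh_eq hθ (Real.cos_le_one θ) (cosh_kappa θ φ u)

lemma measurable_kappa (θ φ : ℝ) : Measurable (kappa θ φ) := by
  have h1 : Continuous fun u : ℝ => (Real.cos θ * Complex.cosh (u + Complex.I * φ) : ℂ) := by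
    fun_prop
  have h2 : Measurable arccos := by
    unfold arccos
    refine measurable_const.mul (Complex.measurable_log.comp (measurable_id.add
      (measurable_const.mul ?_)))
    exact (measurable_const.sub (measurable_id.pow_const 2)).pow_const _
  exact measurable_const.mul (h2.comp h1.measurable)

end Kappa

/-! ### Structure and growth of the iterated `cosh`-derivatives of the Gaussian. -/

section Dcosh

variable {t : ℝ}

/-- The iterated `cosh`-derivatives of the Gaussian `e^{κ²/2t}`. -/
def gaussDeriv (n : ℕ) (t : ℝ) : ℂ → ℂ :=
  (dcosh t)^[n] fun κ => Complex.exp (κ ^ 2 / (2 * t))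

lemma gaussDeriv_succ (n : ℕ) (t : ℝ) : gaussDeriv (n + 1) t = dcosh t (gaussDeriv n t) :=
  Function.iterate_succ_apply' _ _ _

lemma hasDerivAt_gauss (t : ℝ) (κ : ℂ) :
    HasDerivAt (fun κ : ℂ => Complex.exp (κ ^ 2 / (2 * t)))
      (Complex.exp (κ ^ 2 / (2 * t)) * (κ / t)) κ := by
  have h := ((hasDerivAt_pow 2 κ).div_const (2 * t : ℂ)).cexp
  refine h.congr_deriv ?_
  have : ((2 : ℕ) : ℂ) * κ ^ (2 - 1) / (2 * t) = κ / t := by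
    push_cast
    rw [pow_one, mul_div_mul_left _ _ two_ne_zero]
  rw [this]

lemma dcosh_gauss (ht : t ≠ 0) : dcosh t (fun κ => Complex.exp (κ ^ 2 / (2 * t))) =
    fun z => Complex.exp (z ^ 2 / (2 * t)) * (z / Complex.sinh z) := by
  ext κ
  have htc : (t : ℂ) ≠ 0 := by exact_mod_cast ht
  rw [dcosh, (hasDerivAt_gauss t κ).deriv, div_mul_eq_mul_div,
    mul_left_comm, mul_div_cancel₀ κ htc, mul_div_assoc]

/-- The function differentiated in `V_n` is already one `cosh`-derivative of `e^{κ²/2t}`, so `n - 1`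
derivatives become `n`; the prefactor `e^{-κ²/2t}` cancels the exponential of `κ` in `I_k`. -/
lemma integrand_eq {n : ℕ} (hn : 1 ≤ n) (ht : t ≠ 0) (k : ℤ) (θ φ u : ℝ) :
    integrand n t k θ φ u = Complex.exp (-(1 / (2 * t)) * u ^ 2) *
      gaussDeriv n t (kappa θ φ u + Complex.I * (2 * k * Real.pi)) := by
  obtain ⟨j, rfl⟩ := Nat.exists_eq_add_of_le' hn
  rw [integrand, Vn, Nat.add_sub_cancel, ← dcosh_gauss ht, ← Function.iterate_succ_apply,
    ← gaussDeriv, ← mul_assoc, ← Complex.exp_add]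
  congr 2
  ring

lemma measurable_gaussDeriv (n : ℕ) (t : ℝ) : Measurable (gaussDeriv n t) := by
  cases n with
  | zero =>
    have : Continuous (gaussDeriv 0 t) := by
      simp only [gaussDeriv, Function.iterate_zero, id]
      fun_prop
    exact this.measurable
  | succ n =>
    rw [gaussDeriv_succ]
    exact (measurable_const.div Complex.continuous_sinh.measurable).mul (measurable_deriv _)

lemma isOpen_sinh_ne_zero : IsOpen {κ : ℂ | Complex.sinh κ ≠ 0} :=
  isOpen_ne_fun Complex.continuous_sinh continuous_const

/-- The functions `κ^a cosh^b κ / sinh^c κ` with `a ≤ n` and `b + n ≤ c`. -/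
def hypMonomials (n : ℕ) : Set (ℂ → ℂ) :=
  {R | ∃ a b c : ℕ, a ≤ n ∧ b + n ≤ c ∧
    R = fun κ => κ ^ a * Complex.cosh κ ^ b * (Complex.sinh κ)⁻¹ ^ c}

lemma hasDerivAt_inv_sinh_pow {κ : ℂ} (h : Complex.sinh κ ≠ 0) (c : ℕ) :
    HasDerivAt (fun κ => (Complex.sinh κ)⁻¹ ^ c)
      (-(c * Complex.cosh κ * (Complex.sinh κ)⁻¹ ^ (c + 1))) κ := by
  refine (((Complex.hasDerivAt_sinh κ).inv h).pow c).congr_deriv ?_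
  cases c with
  | zero => simp
  | succ c =>
    simp only [Nat.add_sub_cancel, Pi.inv_apply]
    rw [div_eq_mul_inv, ← inv_pow]
    ring

lemma differentiableAt_of_mem_span {n : ℕ} {R : ℂ → ℂ}
    (hR : R ∈ Submodule.span ℂ (hypMonomials n)) {κ : ℂ} (h : Complex.sinh κ ≠ 0) :
    DifferentiableAt ℂ R κ := by
  induction hR using Submodule.span_induction with
  | mem R hR =>
    obtain ⟨a, b, c, -, -, rfl⟩ := hR
    exact ((differentiableAt_id.pow a).mul (Complex.differentiable_cosh κ |>.pow b)).mul
      (hasDerivAt_inv_sinh_pow h c).differentiableAt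
  | zero => exact differentiableAt_const 0
  | add R S _ _ h1 h2 => exact h1.add h2
  | smul c R _ h1 => exact h1.const_smul c

/-- Conjugated by the Gaussian, the `cosh`-derivative is `R ↦ (κR + tR')/sinh κ`. The constraint `b
+ n ≤ c` records that each application gains one net power of `1/sinh κ`. -/
lemma exists_mem_span_deriv (t : ℝ) {n : ℕ} {R : ℂ → ℂ}
    (hR : R ∈ Submodule.span ℂ (hypMonomials n)) :
    ∃ S ∈ Submodule.span ℂ (hypMonomials (n + 1)), ∀ κ, Complex.sinh κ ≠ 0 →
      S κ = (κ * R κ + t * deriv R κ) * (Complex.sinh κ)⁻¹ := by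
  induction hR using Submodule.span_induction with
  | mem R hR =>
    obtain ⟨a, b, c, ha, hb, rfl⟩ := hR
    refine ⟨(fun κ => κ ^ (a + 1) * Complex.cosh κ ^ b * (Complex.sinh κ)⁻¹ ^ (c + 1))
      + (t * a : ℂ) • (fun κ => κ ^ (a - 1) * Complex.cosh κ ^ b * (Complex.sinh κ)⁻¹ ^ (c + 1))
      + (t * b : ℂ) • (fun κ => κ ^ a * Complex.cosh κ ^ (b - 1) *
        (Complex.sinh κ)⁻¹ ^ (if b = 0 then n + 1 else c))
      + (-(t * c) : ℂ) • (fun κ => κ ^ a * Complex.cosh κ ^ (b + 1) *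
        (Complex.sinh κ)⁻¹ ^ (c + 2)), ?_, fun κ hκ => ?_⟩
    · refine Submodule.add_mem _ (Submodule.add_mem _ (Submodule.add_mem _ ?_ ?_) ?_) ?_
      · exact Submodule.subset_span ⟨a + 1, b, c + 1, by omega, by omega, rfl⟩
      · exact Submodule.smul_mem _ _
          (Submodule.subset_span ⟨a - 1, b, c + 1, by omega, by omega, rfl⟩)
      · refine Submodule.smul_mem _ _ (Submodule.subset_span ⟨a, b - 1, _, by omega, ?_, rfl⟩)
        split_ifs <;> omega
      · exact Submodule.smul_mem _ _
          (Submodule.subset_span ⟨a, b + 1, c + 2, by omega, by omega, rfl⟩)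
    · have h := ((hasDerivAt_pow a κ).mul ((Complex.hasDerivAt_cosh κ).pow b)).mul
        (hasDerivAt_inv_sinh_pow hκ c)
      rw [HasDerivAt.deriv (f := fun κ => κ ^ a * Complex.cosh κ ^ b * (Complex.sinh κ)⁻¹ ^ c) h]
      simp only [Pi.add_apply, Pi.smul_apply, smul_eq_mul, Pi.mul_apply, Pi.pow_apply]
      by_cases hb0 : b = 0
      · simp only [hb0, Nat.cast_zero]
        ring
      · simp only [if_neg hb0]
        have e : Complex.sinh κ * (Complex.sinh κ)⁻¹ = 1 := mul_inv_cancel₀ hκ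
        linear_combination (-(t : ℂ) * b * κ ^ a * Complex.cosh κ ^ (b - 1) *
          (Complex.sinh κ)⁻¹ ^ c) * e
  | zero =>
    refine ⟨0, Submodule.zero_mem _, fun κ _ => ?_⟩
    have : deriv (0 : ℂ → ℂ) κ = 0 := by simp
    simp [this]
  | add R S hR hS h1 h2 =>
    obtain ⟨R', hR', h1⟩ := h1
    obtain ⟨S', hS', h2⟩ := h2
    refine ⟨R' + S', Submodule.add_mem _ hR' hS', fun κ hκ => ?_⟩
    rw [deriv_add (differentiableAt_of_mem_span hR hκ) (differentiableAt_of_mem_span hS hκ)]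
    simp only [Pi.add_apply, h1 κ hκ, h2 κ hκ]
    ring
  | smul c R hR h1 =>
    obtain ⟨R', hR', h1⟩ := h1
    refine ⟨c • R', Submodule.smul_mem _ _ hR', fun κ hκ => ?_⟩
    rw [deriv_const_smul c (differentiableAt_of_mem_span hR hκ)]
    simp only [Pi.smul_apply, h1 κ hκ, smul_eq_mul]
    ring

/-- The structure of the iterated `cosh`-derivatives of the Gaussian. -/
lemma exists_gaussDeriv_eq (n : ℕ) (ht : t ≠ 0) :
    ∃ R ∈ Submodule.span ℂ (hypMonomials n), ∀ κ, Complex.sinh κ ≠ 0 →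
      gaussDeriv n t κ = Complex.exp (κ ^ 2 / (2 * t)) * R κ := by
  have htc : (t : ℂ) ≠ 0 := by exact_mod_cast ht
  induction n with
  | zero =>
    refine ⟨fun _ => 1, Submodule.subset_span ⟨0, 0, 0, le_rfl, le_rfl, by simp⟩, fun κ _ => ?_⟩
    simp [gaussDeriv]
  | succ n ih =>
    obtain ⟨R, hR, h⟩ := ih
    obtain ⟨S, hS, h'⟩ := exists_mem_span_deriv t hR
    refine ⟨S, hS, fun κ hκ => ?_⟩
    have hev : gaussDeriv n t =ᶠ[𝓝 κ] fun κ => Complex.exp (κ ^ 2 / (2 * t)) * R κ := by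
      filter_upwards [isOpen_sinh_ne_zero.mem_nhds hκ] with x hx using h x hx
    have hd := (hasDerivAt_gauss t κ).mul (differentiableAt_of_mem_span hR hκ).hasDerivAt
    rw [gaussDeriv_succ, dcosh, hev.deriv_eq,
      HasDerivAt.deriv (f := fun κ => Complex.exp (κ ^ 2 / (2 * t)) * R κ) hd, h' κ hκ]
    field_simp

lemma norm_cosh_le_exp (κ : ℂ) : ‖Complex.cosh κ‖ ≤ Real.exp |κ.re| := by
  have h1 := norm_cosh_sub_one_add κ
  have h2 : 2 * ‖Complex.cosh κ‖ ≤ ‖Complex.cosh κ - 1‖ + ‖Complex.cosh κ + 1‖ := by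
    have := norm_add_le (Complex.cosh κ - 1) (Complex.cosh κ + 1)
    have e : Complex.cosh κ - 1 + (Complex.cosh κ + 1) = 2 * Complex.cosh κ := by ring
    rw [e, norm_mul, Complex.norm_ofNat] at this
    exact this
  have h3 : Real.cosh κ.re ≤ Real.exp |κ.re| := by
    rw [← Real.cosh_abs, Real.cosh_eq]
    have : Real.exp (-|κ.re|) ≤ Real.exp |κ.re| := Real.exp_le_exp.2 (by
      linarith [abs_nonneg κ.re])
    linarith
  linarith

lemma norm_sinh_sq (κ : ℂ) :
    ‖Complex.sinh κ‖ ^ 2 = ‖Complex.cosh κ - 1‖ * ‖Complex.cosh κ + 1‖ := by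
  rw [← norm_mul, ← norm_pow]
  congr 1
  linear_combination Complex.sinh_sq κ

/-- `|sinh κ| ≥ sinh |Re κ|` handles large real parts, and the lower bound `c` handles the others.
-/
lemma exp_abs_re_le_mul_norm_sinh {c : ℝ} (hc : 0 < c) {κ : ℂ} (h : c ≤ ‖Complex.sinh κ‖) :
    Real.exp |κ.re| ≤ (2 + 1 / c) * ‖Complex.sinh κ‖ := by
  have h1 : Real.sinh |κ.re| ≤ ‖Complex.sinh κ‖ := by
    apply le_of_sq_le_sq _ (norm_nonneg _)
    rw [norm_sinh_sq, norm_cosh_sub_one, norm_cosh_add_one, Real.sinh_sq, Real.cosh_abs]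
    nlinarith [Real.cos_sq_le_one κ.im]
  have h2 : Real.exp |κ.re| ≤ 2 * Real.sinh |κ.re| + 1 := by
    rw [Real.sinh_eq]
    have : Real.exp (-|κ.re|) ≤ 1 := Real.exp_le_one_iff.2 (by linarith [abs_nonneg κ.re])
    linarith
  have h3 : 1 ≤ 1 / c * ‖Complex.sinh κ‖ := by
    rw [one_div, inv_mul_eq_div, le_div_iff₀ hc, one_mul]
    exact h
  linarith

/-- At least `n` inverse powers of `sinh` remain after the powers of `cosh` are compensated; each
supplies `e^{-|Re κ|}`. -/
lemma exists_bound_of_mem_span {n : ℕ} {R : ℂ → ℂ} (hR : R ∈ Submodule.span ℂ (hypMonomials n))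
    {c₀ : ℝ} (hc₀ : 0 < c₀) :
    ∃ C, 0 ≤ C ∧ ∀ κ, c₀ ≤ ‖Complex.sinh κ‖ →
      ‖R κ‖ ≤ C * (1 + ‖κ‖) ^ n * Real.exp (-(n * |κ.re|)) := by
  induction hR using Submodule.span_induction with
  | mem R hR =>
    obtain ⟨a, b, c, ha, hb, rfl⟩ := hR
    set A := 2 + 1 / c₀
    have hA : 1 ≤ A := by
      have : 0 < 1 / c₀ := by positivity
      simp only [A]; linarith
    refine ⟨A ^ c, by positivity, fun κ hκ => ?_⟩
    have hs : 0 < ‖Complex.sinh κ‖ := hc₀.trans_le hκ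
    have h1 := exp_abs_re_le_mul_norm_sinh hc₀ hκ
    have hE := Real.exp_pos |κ.re|
    have h2 : ‖Complex.sinh κ‖⁻¹ ≤ A * Real.exp (-|κ.re|) := by
      rw [Real.exp_neg, inv_le_iff_one_le_mul₀ hs]
      calc (1 : ℝ) = Real.exp |κ.re| * (Real.exp |κ.re|)⁻¹ := (mul_inv_cancel₀ hE.ne').symm
        _ ≤ (A * ‖Complex.sinh κ‖) * (Real.exp |κ.re|)⁻¹ := by gcongr
        _ = _ := by ring
    obtain ⟨d, rfl⟩ := Nat.exists_eq_add_of_le hb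
    rw [norm_mul, norm_mul, norm_pow, norm_pow, norm_pow, norm_inv]
    calc _ ≤ (1 + ‖κ‖) ^ n * Real.exp |κ.re| ^ b * (A * Real.exp (-|κ.re|)) ^ (b + n + d) := by
          gcongr
          · calc ‖κ‖ ^ a ≤ (1 + ‖κ‖) ^ a := by gcongr; linarith
              _ ≤ _ := pow_le_pow_right₀ (by linarith [norm_nonneg κ]) ha
          · exact norm_cosh_le_exp κ
      _ = A ^ (b + n + d) * (1 + ‖κ‖) ^ n * (Real.exp |κ.re| * Real.exp (-|κ.re|)) ^ b *
          Real.exp (-|κ.re|) ^ n * Real.exp (-|κ.re|) ^ d := by ring_nf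
      _ ≤ A ^ (b + n + d) * (1 + ‖κ‖) ^ n * 1 * Real.exp (-|κ.re|) ^ n * 1 := by
          gcongr
          · rw [← Real.exp_add, add_neg_cancel, Real.exp_zero, one_pow]
          · exact pow_le_one₀ (Real.exp_pos _).le
              (Real.exp_le_one_iff.2 (by linarith [abs_nonneg κ.re]))
      _ = _ := by
          rw [← Real.exp_nat_mul]
          ring_nf
  | zero => exact ⟨0, le_rfl, fun κ _ => by simp⟩
  | add R S _ _ h1 h2 =>
    obtain ⟨C, hC, h1⟩ := h1
    obtain ⟨D, hD, h2⟩ := h2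
    refine ⟨C + D, by positivity, fun κ hκ => ?_⟩
    refine (norm_add_le _ _).trans ?_
    have := h1 κ hκ
    have := h2 κ hκ
    linarith
  | smul c R _ h1 =>
    obtain ⟨C, hC, h1⟩ := h1
    refine ⟨‖c‖ * C, by positivity, fun κ hκ => ?_⟩
    rw [Pi.smul_apply, norm_smul, mul_assoc, mul_assoc]
    have := h1 κ hκ
    rw [mul_assoc] at this
    gcongr

lemma exists_bound_gaussDeriv (n : ℕ) (ht : t ≠ 0) {c₀ : ℝ} (hc₀ : 0 < c₀) :
    ∃ C, 0 ≤ C ∧ ∀ κ, c₀ ≤ ‖Complex.sinh κ‖ →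
      ‖gaussDeriv n t κ‖ ≤ C * (1 + ‖κ‖) ^ n * Real.exp (-(n * |κ.re|)) *
        Real.exp ((κ.re ^ 2 - κ.im ^ 2) / (2 * t)) := by
  obtain ⟨R, hR, h⟩ := exists_gaussDeriv_eq n ht
  obtain ⟨C, hC, hb⟩ := exists_bound_of_mem_span hR hc₀
  refine ⟨C, hC, fun κ hκ => ?_⟩
  rw [h κ (norm_pos_iff.1 (hc₀.trans_le hκ)), norm_mul, Complex.norm_exp, mul_comm]
  have e : (κ ^ 2 / (2 * t)).re = (κ.re ^ 2 - κ.im ^ 2) / (2 * t) := by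
    have : (2 * t : ℂ) = ((2 * t : ℝ) : ℂ) := by push_cast; ring
    rw [this, Complex.div_ofReal_re]
    simp [pow_two]
  rw [e]
  exact mul_le_mul_of_nonneg_right (hb κ hκ) (Real.exp_pos _).le

end Dcosh

end

section

/-! ### `cosh`-derivatives under translation, and of even functions at the origin. -/

section DcoshCalculus

variable {t : ℝ} {V : Set ℂ} {g h : ℂ → ℂ}

lemma dcosh_iterate_succ (n : ℕ) (g : ℂ → ℂ) :
    (dcosh t)^[n + 1] g = dcosh t ((dcosh t)^[n] g) := Function.iterate_succ_apply' _ _ _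

lemma dcosh_iterate_congr (hV : IsOpen V) (hgh : EqOn g h V) (n : ℕ) :
    EqOn ((dcosh t)^[n] g) ((dcosh t)^[n] h) V := by
  induction n with
  | zero => exact hgh
  | succ n ih =>
    intro s hs
    rw [dcosh_iterate_succ, dcosh_iterate_succ, dcosh, dcosh,
      (ih.eventuallyEq_of_mem (hV.mem_nhds hs)).deriv_eq]

lemma differentiableOn_dcosh_iterate (hV : IsOpen V) (hs : ∀ s ∈ V, Complex.sinh s ≠ 0)
    (hg : DifferentiableOn ℂ g V) (n : ℕ) : DifferentiableOn ℂ ((dcosh t)^[n] g) V := by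
  induction n with
  | zero => exact hg
  | succ n ih =>
    rw [dcosh_iterate_succ]
    exact ((differentiableOn_const _).div Complex.differentiable_sinh.differentiableOn hs).mul
      (ih.deriv hV)

lemma dcosh_iterate_add (hV : IsOpen V) (hs : ∀ s ∈ V, Complex.sinh s ≠ 0)
    (hg : DifferentiableOn ℂ g V) (hh : DifferentiableOn ℂ h V) (n : ℕ) :
    EqOn ((dcosh t)^[n] (g + h)) ((dcosh t)^[n] g + (dcosh t)^[n] h) V := by
  induction n with
  | zero => exact fun _ _ => rfl
  | succ n ih =>
    intro s hsV
    have h1 := (differentiableOn_dcosh_iterate (t := t) hV hs hg n).differentiableAt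
      (hV.mem_nhds hsV)
    have h2 := (differentiableOn_dcosh_iterate (t := t) hV hs hh n).differentiableAt
      (hV.mem_nhds hsV)
    rw [dcosh_iterate_succ, dcosh_iterate_succ, dcosh_iterate_succ, dcosh,
      (ih.eventuallyEq_of_mem (hV.mem_nhds hsV)).deriv_eq, deriv_add h1 h2, mul_add]
    rfl

lemma dcosh_const_smul (c : ℂ) (g : ℂ → ℂ) : dcosh t (c • g) = c • dcosh t g := by
  ext s
  simp only [dcosh, deriv_const_smul_field, Pi.smul_apply, smul_eq_mul]
  ring

lemma dcosh_iterate_const_smul (c : ℂ) (g : ℂ → ℂ) (n : ℕ) :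
    (dcosh t)^[n] (c • g) = c • (dcosh t)^[n] g := by
  induction n with
  | zero => rfl
  | succ n ih => rw [dcosh_iterate_succ, ih, dcosh_const_smul, dcosh_iterate_succ]

lemma sinh_add_int_mul_pi (s : ℂ) (m : ℤ) :
    Complex.sinh (s + m * (Real.pi * Complex.I)) = (-1) ^ m * Complex.sinh s := by
  have h : Complex.cos (m * Real.pi) = (-1) ^ m := by
    rw [← Complex.ofReal_intCast, ← Complex.ofReal_mul, ← Complex.ofReal_cos,
      Real.cos_int_mul_pi]
    push_cast
    rfl
  rw [← mul_assoc, Complex.sinh_add, Complex.cosh_mul_I, Complex.sinh_mul_I,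
    Complex.sin_int_mul_pi, h]
  ring

lemma neg_one_zpow_mul_self (m : ℤ) : ((-1 : ℂ) ^ m) * (-1) ^ m = 1 := by
  rw [← mul_zpow]
  simp

/-- Translation by `mπi` changes `sinh` by the sign `(-1)^m`, and with it the operator. -/
lemma dcosh_shift (g : ℂ → ℂ) (m : ℤ) :
    dcosh t (fun s => g (s + m * (Real.pi * Complex.I))) =
      ((-1 : ℂ) ^ m) • fun s => dcosh t g (s + m * (Real.pi * Complex.I)) := by
  ext s
  have hσ := neg_one_zpow_mul_self m
  have hne : ((-1 : ℂ) ^ m) ≠ 0 := left_ne_zero_of_mul_eq_one hσ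
  simp only [dcosh, Pi.smul_apply, smul_eq_mul]
  have e : (t : ℂ) / Complex.sinh s = (-1) ^ m * (t / ((-1) ^ m * Complex.sinh s)) := by
    rw [← mul_div_assoc, mul_div_mul_left _ _ hne]
  rw [deriv_comp_add_const, sinh_add_int_mul_pi, e]
  ring

lemma dcosh_iterate_shift (g : ℂ → ℂ) (m : ℤ) (n : ℕ) :
    (dcosh t)^[n] (fun s => g (s + m * (Real.pi * Complex.I))) =
      ((-1 : ℂ) ^ m) ^ n • fun s => (dcosh t)^[n] g (s + m * (Real.pi * Complex.I)) := by
  induction n with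
  | zero => simp
  | succ n ih =>
    rw [dcosh_iterate_succ, ih, dcosh_const_smul, dcosh_shift, smul_smul, ← pow_succ,
      dcosh_iterate_succ]

/-- The zeros of `sinh` are the multiples of `πi`, and `3 < π`; this is why balls of radius `3` are
used. -/
lemma sinh_ne_zero_of_norm_lt {s : ℂ} (hs0 : s ≠ 0) (hs : ‖s‖ < 3) : Complex.sinh s ≠ 0 := by
  intro h
  have h1 : Complex.sin (s * Complex.I) = 0 := by
    rw [Complex.sin_mul_I, h, zero_mul]
  obtain ⟨k, hk⟩ := Complex.sin_eq_zero_iff.1 h1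
  have h2 : ‖s‖ = |(k : ℝ)| * Real.pi := by
    have := congr_arg norm hk
    simpa [abs_of_pos Real.pi_pos] using this
  have hk0 : k ≠ 0 := by
    rintro rfl
    simp at h2
    exact hs0 h2
  have h3 : (1 : ℝ) ≤ |(k : ℝ)| := by exact_mod_cast Int.one_le_abs hk0
  nlinarith [Real.pi_gt_three]

/-- The `cosh`-derivative of an even holomorphic function is even and holomorphic at `0`. -/
lemma exists_even_extension_dcosh (hg : DifferentiableOn ℂ g (Metric.ball 0 3))
    (he : ∀ s ∈ Metric.ball (0 : ℂ) 3, g (-s) = g s) :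
    ∃ G : ℂ → ℂ, DifferentiableOn ℂ G (Metric.ball 0 3) ∧
      (∀ s ∈ Metric.ball (0 : ℂ) 3, G (-s) = G s) ∧
      ∀ s ∈ Metric.ball (0 : ℂ) 3, s ≠ 0 → dcosh t g s = G s := by
  have hB : IsOpen (Metric.ball (0 : ℂ) 3) := Metric.isOpen_ball
  have h0 : Metric.ball (0 : ℂ) 3 ∈ 𝓝 0 := Metric.ball_mem_nhds 0 (by norm_num)
  have hodd : ∀ s ∈ Metric.ball (0 : ℂ) 3, deriv g (-s) = -deriv g s := fun s hs => by
    have h1 : deriv (fun x => g (-x)) s = deriv g s :=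
      (Filter.eventuallyEq_of_mem (hB.mem_nhds hs) he).deriv_eq
    rw [deriv_comp_neg] at h1
    rw [← h1, neg_neg]
  have hd0 : deriv g 0 = 0 := by
    have := hodd 0 (Metric.mem_ball_self (by norm_num))
    rw [neg_zero] at this
    exact self_eq_neg.1 this
  -- The derivative of an even function vanishes at `0`, so numerator and denominator can both be
  -- divided by `s`; the divided differences are holomorphic at `0`.
  have hS : ∀ s ∈ Metric.ball (0 : ℂ) 3, s ≠ 0 →
      dcosh t g s = t * dslope (deriv g) 0 s / dslope Complex.sinh 0 s := fun s hs hs0 => by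
    have hsinh := sinh_ne_zero_of_norm_lt hs0 (by simpa using hs)
    rw [dslope_of_ne _ hs0, dslope_of_ne _ hs0, slope_def_field, slope_def_field, hd0,
      Complex.sinh_zero, sub_zero, sub_zero, sub_zero, dcosh]
    field_simp
  have hne : ∀ s ∈ Metric.ball (0 : ℂ) 3, dslope Complex.sinh 0 s ≠ 0 := fun s hs => by
    by_cases hs0 : s = 0
    · subst hs0
      rw [dslope_same, Complex.deriv_sinh, Complex.cosh_zero]
      exact one_ne_zero
    · rw [dslope_of_ne _ hs0, slope_def_field, Complex.sinh_zero, sub_zero, sub_zero]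
      exact div_ne_zero (sinh_ne_zero_of_norm_lt hs0 (by simpa using hs)) hs0
  refine ⟨fun s => t * dslope (deriv g) 0 s / dslope Complex.sinh 0 s, ?_, fun s hs => ?_, hS⟩
  · exact ((differentiableOn_const _).mul
      ((Complex.differentiableOn_dslope h0).2 (hg.deriv hB))).div
      ((Complex.differentiableOn_dslope h0).2 Complex.differentiable_sinh.differentiableOn) hne
  · by_cases hs0 : s = 0
    · rw [hs0, neg_zero]
    · have hs' : -s ∈ Metric.ball (0 : ℂ) 3 := by simpa using hs
      change t * dslope (deriv g) 0 (-s) / _ = t * dslope (deriv g) 0 s / _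
      rw [← hS s hs hs0, ← hS (-s) hs' (neg_ne_zero.2 hs0), dcosh, dcosh, hodd s hs,
        Complex.sinh_neg]
      rw [div_neg, neg_mul_neg]

lemma exists_even_extension (hg : DifferentiableOn ℂ g (Metric.ball 0 3))
    (he : ∀ s ∈ Metric.ball (0 : ℂ) 3, g (-s) = g s) (n : ℕ) :
    ∃ G : ℂ → ℂ, DifferentiableOn ℂ G (Metric.ball 0 3) ∧
      (∀ s ∈ Metric.ball (0 : ℂ) 3, G (-s) = G s) ∧
      ∀ s ∈ Metric.ball (0 : ℂ) 3, s ≠ 0 → (dcosh t)^[n] g s = G s := by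
  induction n with
  | zero => exact ⟨g, hg, he, fun _ _ _ => rfl⟩
  | succ n ih =>
    obtain ⟨G, h1, h2, h3⟩ := ih
    obtain ⟨G', h1', h2', h3'⟩ := exists_even_extension_dcosh (t := t) h1 h2
    refine ⟨G', h1', h2', fun s hs hs0 => ?_⟩
    have hV : IsOpen (Metric.ball (0 : ℂ) 3 ∩ {0}ᶜ) :=
      Metric.isOpen_ball.inter isOpen_compl_singleton
    rw [dcosh_iterate_succ, ← h3' s hs hs0]
    exact dcosh_iterate_congr (t := t) hV (fun x hx => h3 x hx.1 hx.2) 1 ⟨hs, hs0⟩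

end DcoshCalculus

/-! ### Uniform bounds for paired translates. -/

section PairBound

variable {t : ℝ}

/-- The sum of the iterated `cosh`-derivatives of the Gaussian at two conjugate translates. -/
def pairDeriv (n : ℕ) (t : ℝ) (m : ℕ) (s : ℂ) : ℂ :=
  gaussDeriv n t (s + (m : ℤ) * (Real.pi * Complex.I)) +
    gaussDeriv n t (s + (-m : ℤ) * (Real.pi * Complex.I))

/-- The majorant of `pairDeriv`. -/
def pairMajorant (n : ℕ) (t : ℝ) (m : ℕ) (r : ℝ) : ℝ :=
  (1 + m : ℝ) ^ n * (1 + r) ^ n * Real.exp (-(n * r)) *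
    Real.exp ((r ^ 2 - (Real.pi * (m - 1 : ℕ)) ^ 2) / (2 * t))

/-- A shift by `±mπ` from within `[-π, π]` can be undone by at most one `π`. Truncation at `m = 0`
makes the bound trivial there. -/
lemma sq_pi_mul_pred_le {m : ℕ} {y : ℝ} (hy : |y| ≤ Real.pi) {k : ℤ} (hk : k.natAbs = m) :
    (Real.pi * (m - 1 : ℕ)) ^ 2 ≤ (y + k * Real.pi) ^ 2 := by
  rcases Nat.eq_zero_or_pos m with rfl | hm
  · simp; positivity
  have h1 : |(k : ℝ)| = m := by
    rw [← hk, Nat.cast_natAbs, Int.cast_abs]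
  rw [sq_le_sq, abs_of_nonneg (by positivity), Nat.cast_sub hm, Nat.cast_one]
  have h2 : |k * Real.pi| - |y| ≤ |y + k * Real.pi| := by
    have := abs_sub_abs_le_abs_sub (k * Real.pi) (-y)
    rw [abs_neg] at this
    refine this.trans_eq ?_
    congr 1; ring
  rw [abs_mul, h1, abs_of_pos Real.pi_pos] at h2
  linarith

lemma norm_gaussDeriv_shift_le {n : ℕ} (ht : 0 < t) {c₀ C : ℝ} (hC0 : 0 ≤ C)
    (hC : ∀ κ, c₀ ≤ ‖Complex.sinh κ‖ →
      ‖gaussDeriv n t κ‖ ≤ C * (1 + ‖κ‖) ^ n * Real.exp (-(n * |κ.re|)) *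
        Real.exp ((κ.re ^ 2 - κ.im ^ 2) / (2 * t))) {m : ℕ} {k : ℤ} (hk : k.natAbs = m) {s : ℂ}
    (hs : |s.im| ≤ Real.pi) (hsinh : c₀ ≤ ‖Complex.sinh s‖) :
    ‖gaussDeriv n t (s + k * (Real.pi * Complex.I))‖ ≤
      C * (1 + Real.pi) ^ n * pairMajorant n t m |s.re| := by
  set κ := s + k * (Real.pi * Complex.I)
  have hre : κ.re = s.re := by simp [κ]
  have him : κ.im = s.im + k * Real.pi := by simp [κ]
  have hsh : ‖Complex.sinh κ‖ = ‖Complex.sinh s‖ := by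
    rw [sinh_add_int_mul_pi, norm_mul, norm_zpow, norm_neg, norm_one, one_zpow, one_mul]
  have h1 := hC κ (hsh ▸ hsinh)
  rw [hre] at h1
  have h2 : ‖κ‖ ≤ |s.re| + Real.pi + m * Real.pi := by
    have h3 := Complex.norm_le_abs_re_add_abs_im κ
    have h4 : |(k : ℝ)| = m := by
      rw [← hk, Nat.cast_natAbs, Int.cast_abs]
    have h5 := abs_add_le s.im (k * Real.pi)
    rw [abs_mul, h4, abs_of_pos Real.pi_pos] at h5
    rw [hre, him] at h3
    linarith
  have h3 : 1 + ‖κ‖ ≤ (1 + Real.pi) * ((1 + m) * (1 + |s.re|)) := by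
    have hp := Real.pi_pos
    have hm : (0 : ℝ) ≤ m := Nat.cast_nonneg m
    have hr := abs_nonneg s.re
    have e : (1 + Real.pi) * ((1 + m) * (1 + |s.re|)) = 1 + (|s.re| + Real.pi + m * Real.pi) + m +
      m * |s.re| + Real.pi * |s.re| + Real.pi * (m * |s.re|) := by ring
    have := mul_nonneg hm hr
    have := mul_nonneg hp.le hr
    have := mul_nonneg hp.le (mul_nonneg hm hr)
    linarith
  have h4 := sq_pi_mul_pred_le hs hk
  rw [← him] at h4
  refine h1.trans ?_
  have h5 : (s.re ^ 2 - κ.im ^ 2) / (2 * t) ≤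
      (|s.re| ^ 2 - (Real.pi * (m - 1 : ℕ)) ^ 2) / (2 * t) := by
    rw [sq_abs]
    gcongr
  calc _ ≤ C * ((1 + Real.pi) * ((1 + m) * (1 + |s.re|))) ^ n * Real.exp (-(n * |s.re|)) *
        Real.exp ((|s.re| ^ 2 - (Real.pi * (m - 1 : ℕ)) ^ 2) / (2 * t)) := by gcongr
    _ = _ := by
        rw [pairMajorant, mul_pow, mul_pow]
        ring

/-- The right side is `|cosh s - 1|`. It is bounded below by `cosh x ≥ 1 + x²/2` and, from Jordan's
inequality, `cos y ≤ 1 - 2y²/π²` on the strip. -/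
lemma two_div_pi_sq_le {s : ℂ} (hs1 : 1 ≤ ‖s‖) (him : |s.im| ≤ Real.pi) :
    2 / Real.pi ^ 2 ≤ Real.cosh s.re - Real.cos s.im := by
  have hp := Real.pi_gt_three
  have h1 : 1 + s.re ^ 2 / 2 ≤ Real.cosh s.re := by
    have h2 : |s.re| / 2 ≤ Real.sinh (|s.re| / 2) := Real.self_le_sinh_iff.2 (by positivity)
    have h3 : Real.cosh s.re = 1 + 2 * Real.sinh (|s.re| / 2) ^ 2 := by
      rw [← Real.cosh_abs, show |s.re| = 2 * (|s.re| / 2) by ring, Real.cosh_two_mul,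
        Real.cosh_sq']
      ring_nf
    rw [h3, ← sq_abs s.re]
    nlinarith [abs_nonneg s.re]
  have h2 : Real.cos s.im ≤ 1 - 2 * s.im ^ 2 / Real.pi ^ 2 := by
    have h3 : 2 / Real.pi * (|s.im| / 2) ≤ Real.sin (|s.im| / 2) :=
      Real.mul_le_sin (by positivity) (by linarith)
    have h4 : Real.cos s.im = 1 - 2 * Real.sin (|s.im| / 2) ^ 2 := by
      rw [← Real.cos_abs, show |s.im| = 2 * (|s.im| / 2) by ring, Real.cos_two_mul, Real.cos_sq']
      ring_nf
    have h5 : (2 / Real.pi * (|s.im| / 2)) ^ 2 ≤ Real.sin (|s.im| / 2) ^ 2 := by gcongr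
    have h6 : (2 / Real.pi * (|s.im| / 2)) ^ 2 = s.im ^ 2 / Real.pi ^ 2 := by
      rw [← sq_abs s.im]
      field_simp
    rw [h4]
    rw [h6] at h5
    have h7 : 2 * s.im ^ 2 / Real.pi ^ 2 = 2 * (s.im ^ 2 / Real.pi ^ 2) := by ring
    linarith
  have h3 : 1 ≤ s.re ^ 2 + s.im ^ 2 := by
    have : ‖s‖ ^ 2 = s.re ^ 2 + s.im ^ 2 := by
      rw [Complex.sq_norm, Complex.normSq_apply]; ring
    nlinarith
  have h4 : 2 / Real.pi ^ 2 * s.re ^ 2 ≤ s.re ^ 2 / 2 := by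
    have : 2 / Real.pi ^ 2 ≤ 1 / 2 := by
      rw [div_le_div_iff₀ (by positivity) (by norm_num)]
      nlinarith
    nlinarith [sq_nonneg s.re]
  have h5 : 2 / Real.pi ^ 2 * s.im ^ 2 = 2 * s.im ^ 2 / Real.pi ^ 2 := by ring
  have h6 : 2 / Real.pi ^ 2 * 1 ≤ 2 / Real.pi ^ 2 * (s.re ^ 2 + s.im ^ 2) := by gcongr
  rw [mul_add] at h6
  linarith

lemma sqrt_le_norm_sinh {s : ℂ} {η : ℝ} (hη : 0 ≤ η) (hs1 : 1 ≤ ‖s‖) (him : |s.im| ≤ Real.pi)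
    (h : η ≤ ‖Complex.cosh s + 1‖) : √(η * (2 / Real.pi ^ 2)) ≤ ‖Complex.sinh s‖ := by
  apply Real.sqrt_le_iff.2 ⟨norm_nonneg _, ?_⟩
  rw [norm_sinh_sq, norm_cosh_sub_one, mul_comm η]
  exact mul_le_mul (two_div_pi_sq_le hs1 him) h hη
    ((by positivity : (0 : ℝ) ≤ 2 / Real.pi ^ 2).trans (two_div_pi_sq_le hs1 him))

/-- The translations by `mπi` and `-mπi` have the same sign, so up to this sign the pair is the
iterated derivative of one even function. -/
lemma pairDeriv_eq (n m : ℕ) {s : ℂ} (hs : Complex.sinh s ≠ 0) :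
    (dcosh t)^[n] (fun s => Complex.exp ((s + (m : ℤ) * (Real.pi * Complex.I)) ^ 2 / (2 * t)) +
      Complex.exp ((s + (-m : ℤ) * (Real.pi * Complex.I)) ^ 2 / (2 * t))) s =
      ((-1 : ℂ) ^ (m : ℤ)) ^ n * pairDeriv n t m s := by
  have hd : ∀ k : ℤ, Differentiable ℂ fun s : ℂ =>
      Complex.exp ((s + k * (Real.pi * Complex.I)) ^ 2 / (2 * t)) := fun k => by fun_prop
  have h := dcosh_iterate_add (t := t) (V := {s | Complex.sinh s ≠ 0}) isOpen_sinh_ne_zero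
    (fun s hs => hs) (hd m).differentiableOn (hd (-m)).differentiableOn n hs
  refine Eq.trans ?_ (h.trans ?_)
  · rfl
  rw [Pi.add_apply,
    dcosh_iterate_shift (fun s : ℂ => Complex.exp (s ^ 2 / (2 * t))) m n,
    dcosh_iterate_shift (fun s : ℂ => Complex.exp (s ^ 2 / (2 * t))) (-m) n]
  have e : ((-1 : ℂ) ^ (-m : ℤ)) = (-1) ^ (m : ℤ) := by
    rw [zpow_neg, inv_eq_of_mul_eq_one_right (neg_one_zpow_mul_self m)]
  rw [e]
  simp only [Pi.smul_apply, smul_eq_mul, pairDeriv, gaussDeriv]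
  ring

/-- The pairs are bounded uniformly up to the removable singularity at `s = 0`. -/
lemma exists_bound_pairDeriv (n : ℕ) (ht : 0 < t) {η : ℝ} (hη : 0 < η) :
    ∃ C, 0 ≤ C ∧ ∀ (m : ℕ) (s : ℂ), |s.im| ≤ Real.pi → η ≤ ‖Complex.cosh s + 1‖ → s ≠ 0 →
      ‖pairDeriv n t m s‖ ≤ C * pairMajorant n t m |s.re| := by
  -- The cap at `1` ensures that the lower bound on `|cosh + 1|` also holds on the unit circle,
  -- where the estimate is applied below.
  set η₀ := min η 1
  have hη₀ : 0 < η₀ := lt_min hη one_pos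
  obtain ⟨C, hC0, hC⟩ := exists_bound_gaussDeriv n ht.ne'
    (c₀ := √(η₀ * (2 / Real.pi ^ 2))) (by have := Real.pi_pos; positivity)
  set D := 2 * (C * (1 + Real.pi) ^ n)
  have hD : 0 ≤ D := by have := Real.pi_pos; positivity
  have hfar : ∀ (m : ℕ) (s : ℂ), |s.im| ≤ Real.pi → η₀ ≤ ‖Complex.cosh s + 1‖ → 1 ≤ ‖s‖ →
      ‖pairDeriv n t m s‖ ≤ D * pairMajorant n t m |s.re| := by
    intro m s him hcosh hs
    have h0 := sqrt_le_norm_sinh hη₀.le hs him hcosh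
    have h1 := norm_gaussDeriv_shift_le ht hC0 hC (k := m) (Int.natAbs_natCast m) him h0
    have h2 := norm_gaussDeriv_shift_le ht hC0 hC (k := -m) (m := m) (by simp) him h0
    refine (norm_add_le _ _).trans ?_
    simp only [D]
    linarith
  -- For `r ≤ 1` the majorant is comparable, uniformly in `m`, to a quantity independent of `r`.
  -- This and the next bound transfer an estimate from the unit circle to interior points.
  have hmaj : ∀ (m : ℕ) (r : ℝ), 0 ≤ r → r ≤ 1 → pairMajorant n t m r ≤
      (1 + m : ℝ) ^ n * 2 ^ n * Real.exp (1 / (2 * t)) *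
        Real.exp (-(Real.pi * (m - 1 : ℕ)) ^ 2 / (2 * t)) := by
    intro m r hr0 hr1
    rw [pairMajorant, mul_assoc _ (Real.exp (1 / (2 * t))), ← Real.exp_add, ← add_div]
    have h1 : Real.exp (-(n * r)) ≤ 1 := Real.exp_le_one_iff.2 (by
      have := mul_nonneg (Nat.cast_nonneg (α := ℝ) n) hr0; linarith)
    calc _ ≤ (1 + m : ℝ) ^ n * 2 ^ n * 1 *
          Real.exp ((1 + -(Real.pi * (m - 1 : ℕ)) ^ 2) / (2 * t)) := by
          gcongr
          · linarith
          · nlinarith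
      _ = _ := by rw [mul_one]
  have hmin : ∀ (m : ℕ) (r : ℝ), 0 ≤ r → r ≤ 1 →
      (1 + m : ℝ) ^ n * Real.exp (-(Real.pi * (m - 1 : ℕ)) ^ 2 / (2 * t)) ≤
        Real.exp n * pairMajorant n t m r := by
    intro m r hr0 hr1
    have h1 : 1 ≤ Real.exp n * Real.exp (-(n * r)) := by
      rw [← Real.exp_add, Real.one_le_exp_iff]
      nlinarith [Nat.cast_nonneg (α := ℝ) n]
    calc _ = (1 + m : ℝ) ^ n * 1 ^ n * 1 *
          Real.exp (-(Real.pi * (m - 1 : ℕ)) ^ 2 / (2 * t)) := by rw [one_pow, mul_one, mul_one]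
      _ ≤ (1 + m : ℝ) ^ n * (1 + r) ^ n * (Real.exp n * Real.exp (-(n * r))) *
          Real.exp ((r ^ 2 - (Real.pi * (m - 1 : ℕ)) ^ 2) / (2 * t)) := by
          gcongr
          · linarith
          · nlinarith
      _ = _ := by rw [pairMajorant]; ring
  refine ⟨D * (1 + 2 ^ n * Real.exp (1 / (2 * t)) * Real.exp n), by positivity,
    fun m s him hcosh hs0 => ?_⟩
  have hM0 : 0 ≤ pairMajorant n t m |s.re| := by rw [pairMajorant]; positivity
  rcases le_or_gt 1 ‖s‖ with hs | hs
  · refine (hfar m s him ((min_le_left _ _).trans hcosh) hs).trans ?_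
    rw [mul_assoc D]
    refine mul_le_mul_of_nonneg_left (le_mul_of_one_le_left hM0 ?_) hD
    linarith [(by positivity : 0 ≤ 2 ^ n * Real.exp (1 / (2 * t)) * Real.exp n)]
  set q : ℂ → ℂ := fun s =>
    Complex.exp ((s + (m : ℤ) * (Real.pi * Complex.I)) ^ 2 / (2 * t)) +
      Complex.exp ((s + (-m : ℤ) * (Real.pi * Complex.I)) ^ 2 / (2 * t))
  have hq : Differentiable ℂ q := by simp only [q]; fun_prop
  obtain ⟨G, hG, -, hGq⟩ := exists_even_extension (t := t) (g := q) hq.differentiableOn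
    (fun s _ => by
      simp only [q]
      rw [add_comm]
      push_cast
      congr 3 <;> ring) n
  have hpair : ∀ s : ℂ, s ≠ 0 → ‖s‖ < 3 → ‖pairDeriv n t m s‖ = ‖G s‖ := by
    intro s hs0 hs
    rw [← hGq s (by simpa using hs) hs0,
      pairDeriv_eq n m (sinh_ne_zero_of_norm_lt hs0 hs), norm_mul, norm_pow, norm_zpow,
      norm_neg, norm_one, one_zpow, one_pow, one_mul]
  rw [hpair s hs0 (by linarith)]
  -- Maximum principle on the unit disc for the holomorphic extension across `0`; on the circle the
  -- estimate away from the zeros of `sinh` applies.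
  have hle : ‖G s‖ ≤ D * ((1 + m : ℝ) ^ n * 2 ^ n * Real.exp (1 / (2 * t)) *
      Real.exp (-(Real.pi * (m - 1 : ℕ)) ^ 2 / (2 * t))) := by
    refine Complex.norm_le_of_forall_mem_frontier_norm_le (U := Metric.ball (0 : ℂ) 1)
      Metric.isBounded_ball ?_ (fun z hz => ?_) (subset_closure (by simpa using hs))
    · refine DifferentiableOn.diffContOnCl (hG.mono ?_)
      exact Metric.closure_ball_subset_closedBall.trans
        (Metric.closedBall_subset_ball (by norm_num))
    · rw [frontier_ball (0 : ℂ) one_ne_zero, mem_sphere_zero_iff_norm] at hz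
      have hz0 : z ≠ 0 := norm_pos_iff.1 (by rw [hz]; exact one_pos)
      have hre : |z.re| ≤ 1 := (Complex.abs_re_le_norm z).trans hz.le
      have him1 : |z.im| ≤ 1 := (Complex.abs_im_le_norm z).trans hz.le
      have hc : η₀ ≤ ‖Complex.cosh z + 1‖ := by
        rw [norm_cosh_add_one]
        have h1 := Real.one_le_cosh z.re
        have h2 : 0 ≤ Real.cos z.im := Real.cos_nonneg_of_mem_Icc (by
          have := abs_le.1 him1
          constructor <;> linarith [Real.pi_gt_three])
        linarith [min_le_right η 1]
      rw [← hpair z hz0 (by rw [hz]; norm_num)]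
      refine (hfar m z (him1.trans (by linarith [Real.pi_gt_three])) hc hz.ge).trans ?_
      exact mul_le_mul_of_nonneg_left (hmaj m _ (abs_nonneg _) hre) hD
  have hre : |s.re| ≤ 1 := (Complex.abs_re_le_norm s).trans hs.le
  have h3 := hmin m |s.re| (abs_nonneg _) hre
  calc ‖G s‖ ≤ D * (2 ^ n * Real.exp (1 / (2 * t)) *
        ((1 + m : ℝ) ^ n * Real.exp (-(Real.pi * (m - 1 : ℕ)) ^ 2 / (2 * t)))) := by
        refine hle.trans_eq ?_
        ring
    _ ≤ D * (2 ^ n * Real.exp (1 / (2 * t)) * (Real.exp n * pairMajorant n t m |s.re|)) := by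
        gcongr
    _ = D * (2 ^ n * Real.exp (1 / (2 * t)) * Real.exp n) * pairMajorant n t m |s.re| := by ring
    _ ≤ _ := by
        gcongr
        linarith

end PairBound

end

section

/-! ### Termwise `cosh`-derivatives of locally uniformly convergent series. -/

section TermwiseDerivative

variable {ι : Type*} {t : ℝ} {V : Set ℂ} {f : ι → ℂ → ℂ} {g : ℂ → ℂ}

/-- Weierstrass' theorem for the derivative, followed by multiplication with a continuous factor. -/
lemma hasSumLocallyUniformlyOn_dcosh (hV : IsOpen V) (hs : ∀ s ∈ V, Complex.sinh s ≠ 0)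
    (hf : ∀ i, DifferentiableOn ℂ (f i) V) (h : HasSumLocallyUniformlyOn f g V) :
    HasSumLocallyUniformlyOn (fun i => dcosh t (f i)) (dcosh t g) V := by
  have hF : ∀ I : Finset ι, DifferentiableOn ℂ (fun s => ∑ i ∈ I, f i s) V := fun I =>
    DifferentiableOn.fun_sum fun i _ => hf i
  have h' : TendstoLocallyUniformlyOn (fun (I : Finset ι) s => ∑ i ∈ I, f i s) g atTop V :=
    hasSumLocallyUniformlyOn_iff_tendstoLocallyUniformlyOn.1 h
  have hg := h'.differentiableOn (Eventually.of_forall hF) hV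
  have hd := h'.deriv (Eventually.of_forall hF) hV
  set q : ℂ → ℂ := fun s => t / Complex.sinh s
  have hq : ContinuousOn q V :=
    continuousOn_const.div Complex.continuous_sinh.continuousOn hs
  have hc : TendstoLocallyUniformlyOn (fun _ : Finset ι => q) q atTop V :=
    fun u hu x _ => ⟨univ, univ_mem, Eventually.of_forall fun _ _ _ => refl_mem_uniformity hu⟩
  refine hasSumLocallyUniformlyOn_iff_tendstoLocallyUniformlyOn.2 ?_
  refine (hc.mul₀ hd hq (hg.deriv hV).continuousOn).congr fun I s hsV => ?_
  have hdi : ∀ i ∈ I, DifferentiableAt ℂ (f i) s := fun i _ =>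
    (hf i).differentiableAt (hV.mem_nhds hsV)
  change q s * deriv (fun s => ∑ i ∈ I, f i s) s = ∑ i ∈ I, q s * deriv (f i) s
  rw [deriv_fun_sum hdi, Finset.mul_sum]

lemma hasSumLocallyUniformlyOn_dcosh_iterate (hV : IsOpen V) (hs : ∀ s ∈ V, Complex.sinh s ≠ 0)
    (hf : ∀ i, DifferentiableOn ℂ (f i) V) (h : HasSumLocallyUniformlyOn f g V) (n : ℕ) :
    HasSumLocallyUniformlyOn (fun i => (dcosh t)^[n] (f i))
      ((dcosh t)^[n] g) V := by
  induction n with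
  | zero => exact h
  | succ n ih =>
    simp only [dcosh_iterate_succ]
    exact hasSumLocallyUniformlyOn_dcosh hV hs
      (fun i => differentiableOn_dcosh_iterate hV hs (hf i) n) ih

end TermwiseDerivative

/-! ### Poisson summation for the Gaussian and its `cosh`-derivatives. -/

section Poisson

variable {t : ℝ}

/-- In the coordinate `x = cosh κ` the operator is `t d/dx`. -/
lemma dcosh_iterate_eval_cosh (p : Polynomial ℂ) (n : ℕ) {s : ℂ} (hs : Complex.sinh s ≠ 0) :
    (dcosh t)^[n] (fun κ => p.eval (Complex.cosh κ)) s =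
      t ^ n * (Polynomial.derivative^[n] p).eval (Complex.cosh s) := by
  induction n generalizing s with
  | zero => simp
  | succ n ih =>
    have hev : (dcosh t)^[n] (fun κ => p.eval (Complex.cosh κ)) =ᶠ[𝓝 s]
        fun s => t ^ n * (Polynomial.derivative^[n] p).eval (Complex.cosh s) := by
      filter_upwards [isOpen_sinh_ne_zero.mem_nhds hs] with x hx using ih hx
    have hd := (((Polynomial.derivative^[n] p).hasDerivAt (Complex.cosh s)).comp s
      (Complex.hasDerivAt_cosh s)).const_mul ((t : ℂ) ^ n)
    rw [dcosh_iterate_succ, dcosh, hev.deriv_eq, Function.iterate_succ_apply']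
    rw [HasDerivAt.deriv (f := fun s => (t : ℂ) ^ n *
      (Polynomial.derivative^[n] p).eval (Complex.cosh s)) hd]
    field_simp
    ring

/-- The translates of the Gaussian by the periods of `cosh`. -/
def gaussTranslate (t : ℝ) (k : ℤ) (κ : ℂ) : ℂ :=
  Complex.exp ((κ + (2 * k : ℤ) * (Real.pi * Complex.I)) ^ 2 / (2 * t))

/-- The terms of the Fourier expansion of the periodized Gaussian. -/
def chebTerm (t : ℝ) (m : ℕ) (κ : ℂ) : ℂ :=
  2 * Real.exp (-(m ^ 2 * t / 2)) * Complex.cosh (m * κ)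

lemma exists_norm_le_of_isCompact {K : Set ℂ} (hK : IsCompact K) :
    ∃ R, 0 ≤ R ∧ ∀ κ ∈ K, ‖κ‖ ≤ R := by
  obtain ⟨R, hR⟩ := hK.isBounded.exists_norm_le
  exact ⟨max R 0, le_max_right _ _, fun κ hκ => (hR κ hκ).trans (le_max_left _ _)⟩

lemma summable_gaussTranslate (ht : 0 < t) :
    SummableLocallyUniformlyOn (gaussTranslate t) univ := by
  refine SummableLocallyUniformlyOn_of_locally_bounded isOpen_univ fun K _ hK => ?_
  obtain ⟨R, hR0, hR⟩ := exists_norm_le_of_isCompact hK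
  have hp := Real.pi_pos
  refine ⟨fun k => Real.exp (R ^ 2 / (2 * t)) * (|(k : ℝ)| ^ 0 *
    Real.exp (-Real.pi * (2 * Real.pi / t * k ^ 2 - 2 * (R / t) * |(k : ℝ)|))), ?_,
    fun k κ hκ => ?_⟩
  · have := (summable_pow_mul_jacobiTheta₂_term_bound (R / t) (T := 2 * Real.pi / t)
      (by positivity) 0).mul_left (Real.exp (R ^ 2 / (2 * t)))
    simpa only [Int.cast_abs] using this
  · beta_reduce
    rw [gaussTranslate, Complex.norm_exp, pow_zero, one_mul, ← Real.exp_add]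
    apply Real.exp_le_exp.2
    have e : ((κ + (2 * k : ℤ) * (Real.pi * Complex.I)) ^ 2 / (2 * t)).re =
        (κ.re ^ 2 - (κ.im + 2 * k * Real.pi) ^ 2) / (2 * t) := by
      have : (2 * t : ℂ) = ((2 * t : ℝ) : ℂ) := by push_cast; ring
      rw [this, Complex.div_ofReal_re]
      simp [pow_two]
    have e2 : R ^ 2 / (2 * t) + -Real.pi * (2 * Real.pi / t * k ^ 2 - 2 * (R / t) * |(k : ℝ)|) =
        (R ^ 2 + 4 * Real.pi * R * |(k : ℝ)| - (2 * k * Real.pi) ^ 2) / (2 * t) := by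
      field_simp
      ring
    rw [e, e2]
    refine div_le_div_of_nonneg_right ?_ (by positivity)
    have h1 : κ.re ^ 2 ≤ R ^ 2 := by
      rw [← sq_abs]
      have := (Complex.abs_re_le_norm κ).trans (hR κ hκ)
      gcongr
    have h2 : |κ.im| ≤ R := (Complex.abs_im_le_norm κ).trans (hR κ hκ)
    have h3 : -(κ.im * k) ≤ R * |(k : ℝ)| := by
      calc -(κ.im * k) ≤ |κ.im * k| := neg_le_abs _
        _ = |κ.im| * |(k : ℝ)| := abs_mul _ _
        _ ≤ _ := by gcongr
    have h4 := mul_le_mul_of_nonneg_left h3 (by positivity : 0 ≤ 4 * Real.pi)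
    linarith [sq_nonneg κ.im]

lemma summable_chebTerm (ht : 0 < t) : SummableLocallyUniformlyOn (chebTerm t) univ := by
  refine SummableLocallyUniformlyOn_of_locally_bounded isOpen_univ fun K _ hK => ?_
  obtain ⟨R, hR0, hR⟩ := exists_norm_le_of_isCompact hK
  have hp := Real.pi_pos
  refine ⟨fun m => 2 * Real.exp (-(m ^ 2 * t / 2)) * Real.exp (m * R), ?_, fun m κ hκ => ?_⟩
  · have h := ((summable_pow_mul_jacobiTheta₂_term_bound (R / (2 * Real.pi))
      (T := t / (2 * Real.pi)) (by positivity) 0).comp_injective Nat.cast_injective).mul_left 2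
    refine h.congr fun m => ?_
    simp only [Function.comp_apply, pow_zero, one_mul, Int.cast_abs, Int.cast_natCast,
      Nat.abs_cast]
    rw [mul_assoc (2 : ℝ) (Real.exp _), ← Real.exp_add]
    congr 2
    field_simp
    ring
  · beta_reduce
    rw [chebTerm, norm_mul, norm_mul, Complex.norm_ofNat, Complex.norm_real, Real.norm_eq_abs,
      Real.abs_exp]
    refine mul_le_mul_of_nonneg_left ?_ (by positivity)
    refine (norm_cosh_le_exp _).trans (Real.exp_le_exp.2 ?_)
    have e : ((m : ℂ) * κ).re = m * κ.re := by simp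
    rw [e, abs_mul, Nat.abs_cast]
    exact mul_le_mul_of_nonneg_left ((Complex.abs_re_le_norm κ).trans (hR κ hκ))
      (Nat.cast_nonneg m)

/-- The Poisson summation formula for the Gaussian. -/
lemma tsum_gaussTranslate (ht : 0 < t) (κ : ℂ) :
    ∑' k, gaussTranslate t k κ = (√(t / (2 * Real.pi)) : ℝ) * (∑' m, chebTerm t m κ - 1) := by
  have hp := Real.pi_pos
  have hpc : (Real.pi : ℂ) ≠ 0 := by exact_mod_cast hp.ne'
  have htc : (t : ℂ) ≠ 0 := by exact_mod_cast ht.ne'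
  have ha : 0 < t / (2 * Real.pi) := by positivity
  have hP := Complex.tsum_exp_neg_quadratic (a := ((t / (2 * Real.pi) : ℝ) : ℂ))
    (by rwa [Complex.ofReal_re]) (κ / (2 * Real.pi))
  have hsq : (((t / (2 * Real.pi) : ℝ) : ℂ)) ^ (1 / 2 : ℂ) = (√(t / (2 * Real.pi)) : ℝ) := by
    rw [Real.sqrt_eq_rpow, Complex.ofReal_cpow ha.le]
    push_cast
    rfl
  have hs0 : ((√(t / (2 * Real.pi)) : ℝ) : ℂ) ≠ 0 := by
    exact_mod_cast (Real.sqrt_pos.2 ha).ne'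
  set F : ℤ → ℂ := fun n => Complex.exp (-Real.pi * ((t / (2 * Real.pi) : ℝ) : ℂ) * n ^ 2 +
    2 * Real.pi * (κ / (2 * Real.pi)) * n)
  have hF : ∀ n : ℤ, F n = Complex.exp (-(n ^ 2 * t / 2)) * Complex.exp (n * κ) := fun n => by
    simp only [F]
    rw [← Complex.exp_add]
    congr 1
    push_cast
    field_simp
  -- `n + iκ/2π = (i/2π)(κ - 2πin)`, so the summand of index `n` is the Gaussian translate of index
  -- `-n`.
  have hleft : ∑' n : ℤ, Complex.exp (-Real.pi / ((t / (2 * Real.pi) : ℝ) : ℂ) *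
      (n + Complex.I * (κ / (2 * Real.pi))) ^ 2) = ∑' k, gaussTranslate t k κ := by
    rw [← (Equiv.neg ℤ).tsum_eq (gaussTranslate t · κ)]
    refine tsum_congr fun n => ?_
    rw [gaussTranslate, Equiv.neg_apply]
    congr 1
    push_cast
    field_simp
    linear_combination (-(κ ^ 2) - (4 * n ^ 2 * Real.pi ^ 2)) * Complex.I_sq
  have hFs : Summable F := by
    have h := summable_pow_mul_jacobiTheta₂_term_bound (|κ.re| / (2 * Real.pi))
      (T := t / (2 * Real.pi)) (by positivity) 0
    refine Summable.of_norm_bounded h fun n => ?_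
    rw [hF, ← Complex.exp_add, Complex.norm_exp, pow_zero, one_mul]
    apply Real.exp_le_exp.2
    have e : (-((n : ℂ) ^ 2 * t / 2) + n * κ).re = -((n : ℝ) ^ 2 * t / 2) + n * κ.re := by
      simp [pow_two]
    have h1 : n * κ.re ≤ |κ.re| * |(n : ℝ)| := by
      rw [mul_comm, ← abs_mul]
      exact le_abs_self _
    have e2 : -Real.pi * (t / (2 * Real.pi) * n ^ 2 -
        2 * (|κ.re| / (2 * Real.pi)) * |(n : ℝ)|) =
        -((n : ℝ) ^ 2 * t / 2) + |κ.re| * |(n : ℝ)| := by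
      field_simp
      ring
    rw [e, Int.cast_abs, e2]
    linarith
  -- Folding `n` and `-n` together counts `n = 0` twice.
  have hcheb : HasSum (fun m : ℕ => chebTerm t m κ) (∑' n, F n + 1) := by
    have h := hFs.hasSum.nat_add_neg
    have h0 : F 0 = 1 := by simp [hF]
    rw [h0] at h
    refine hasSum_of_forall_eq h fun m => ?_
    rw [hF, hF, chebTerm, Complex.cosh]
    push_cast
    rw [neg_sq, neg_mul]
    ring
  rw [hcheb.tsum_eq, add_sub_cancel_right, hP, hleft, hsq, ← mul_assoc, mul_one_div,
    div_self hs0, one_mul]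

/-- The `cosh`-derivatives of the Poisson summation formula. -/
lemma hasSum_gaussDeriv {n : ℕ} (hn : 1 ≤ n) (ht : 0 < t) {κ : ℂ} (hκ : Complex.sinh κ ≠ 0) :
    HasSum (fun k : ℤ => gaussDeriv n t (κ + (2 * k : ℤ) * (Real.pi * Complex.I)))
      ((√(t / (2 * Real.pi)) * t ^ n : ℝ) * ∑' m : ℕ, 2 * Real.exp (-(m ^ 2 * t / 2)) *
        (chebDeriv ℂ n m).eval (Complex.cosh κ)) := by
  set V : Set ℂ := {κ | Complex.sinh κ ≠ 0}
  have hV : IsOpen V := isOpen_sinh_ne_zero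
  have hs : ∀ s ∈ V, Complex.sinh s ≠ 0 := fun s hs => hs
  have hA := hasSumLocallyUniformlyOn_dcosh_iterate (t := t) hV hs
    (fun k => by unfold gaussTranslate; fun_prop)
    ((summable_gaussTranslate ht).hasSumLocallyUniformlyOn.mono (subset_univ V)) n
  have hB := hasSumLocallyUniformlyOn_dcosh_iterate (t := t) hV hs
    (fun k => by unfold chebTerm; fun_prop)
    ((summable_chebTerm ht).hasSumLocallyUniformlyOn.mono (subset_univ V)) n
  -- Since `n ≥ 1`, the first derivative removes the additive constant of the Poisson formula.
  have hAB : (dcosh t)^[n] (fun κ => ∑' k, gaussTranslate t k κ) =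
      ((√(t / (2 * Real.pi)) : ℝ) : ℂ) • (dcosh t)^[n] (fun κ => ∑' m, chebTerm t m κ) := by
    obtain ⟨j, rfl⟩ := Nat.exists_eq_add_of_le' hn
    rw [Function.iterate_succ_apply, Function.iterate_succ_apply, ← dcosh_iterate_const_smul]
    congr 1
    ext s
    simp only [dcosh, tsum_gaussTranslate ht, deriv_const_mul_field, deriv_sub_const,
      Pi.smul_apply, smul_eq_mul]
    ring
  have hA' := hA.hasSum hκ
  rw [hAB] at hA'
  have hB' := hB.hasSum hκ
  have hterm : ∀ m : ℕ, (dcosh t)^[n] (chebTerm t m) κ = t ^ n *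
      (2 * Real.exp (-(m ^ 2 * t / 2)) * (chebDeriv ℂ n m).eval (Complex.cosh κ)) := fun m => by
    have e : chebTerm t m = (2 * Real.exp (-(m ^ 2 * t / 2)) : ℂ) •
        fun κ => (Polynomial.Chebyshev.T ℂ (m : ℤ)).eval (Complex.cosh κ) := by
      ext κ
      rw [Pi.smul_apply, smul_eq_mul, Polynomial.Chebyshev.T_complex_cosh, chebTerm,
        Int.cast_natCast]
    rw [e, dcosh_iterate_const_smul, Pi.smul_apply, smul_eq_mul, dcosh_iterate_eval_cosh _ _ hκ,
      chebDeriv]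
    ring
  simp only [hterm] at hB'
  rw [Pi.smul_apply, smul_eq_mul, ← hB'.tsum_eq, tsum_mul_left, ← mul_assoc] at hA'
  have e : ((√(t / (2 * Real.pi)) : ℝ) : ℂ) * t ^ n =
      ((√(t / (2 * Real.pi)) * t ^ n : ℝ) : ℂ) := by push_cast; rfl
  rw [e] at hA'
  refine hasSum_of_forall_eq hA' fun k => ?_
  have h := congr_fun (dcosh_iterate_shift (t := t) (fun s : ℂ => Complex.exp (s ^ 2 / (2 * t)))
    (2 * k) n) κ
  have e2 : ((-1 : ℂ) ^ (2 * k)) = 1 := by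
    rw [zpow_mul]; norm_num
  rw [e2, one_pow, one_smul] at h
  exact h

end Poisson

end

section

open scoped ComplexConjugate

/-! ### The heat kernel as one Gaussian integral. -/

section GaussianAverage

variable {n : ℕ} {t : ℝ}

/-- Exchanging `ζ` and `ζ̄` in the Gaussian average is the reflection `u ↦ -u`. Consequently the
blocks are real. -/
lemma zonalBlock_conj_eq (n m : ℕ) (ht : 0 < t) (ζ : ℂ) :
    zonalBlock n m t (conj ζ) = zonalBlock n m t ζ := by
  have hp := Real.pi_pos
  have h1 := integral_gaussian_mul_eval n m ht (conj ζ)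
  have h2 := integral_gaussian_mul_eval n m ht ζ
  have h3 : ∀ u : ℝ, shiftedCosh (conj ζ) u = shiftedCosh ζ (-u) := fun u => by
    rw [shiftedCosh, shiftedCosh, Complex.conj_conj]
    push_cast
    rw [neg_neg]
    ring
  have h4 : ∀ u : ℝ, Complex.exp (-(1 / (2 * t)) * u ^ 2) =
      Complex.exp (-(1 / (2 * t)) * ((-u : ℝ) : ℂ) ^ 2) := fun u => by
    push_cast
    rw [neg_sq]
  have h5 : ∫ u : ℝ, Complex.exp (-(1 / (2 * t)) * u ^ 2) *
      (chebDeriv ℂ n m).eval (shiftedCosh (conj ζ) u) =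
      ∫ u : ℝ, Complex.exp (-(1 / (2 * t)) * u ^ 2) *
        (chebDeriv ℂ n m).eval (shiftedCosh ζ u) := by
    rw [← integral_neg_eq_self fun u : ℝ => Complex.exp (-(1 / (2 * t)) * u ^ 2) *
        (chebDeriv ℂ n m).eval (shiftedCosh ζ u)]
    simp_rw [h3, ← h4]
  rw [h1, h2] at h5
  refine mul_left_cancel₀ ?_ h5
  rw [Complex.ofReal_ne_zero]
  positivity

lemma ofReal_poleBlock (n m : ℕ) (ht : 0 < t) (w z : Cn n) :
    (poleBlock n m t w z : ℂ) = zonalBlock n m t (inner ℂ w z) := by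
  rw [poleBlock]
  refine Complex.conj_eq_iff_re.1 ?_
  rw [← zonalBlock_conj, zonalBlock_conj_eq n m ht]

/-- The terms of the Gaussian average that gives the heat kernel. -/
def gaussTerm (n : ℕ) (t : ℝ) (ζ : ℂ) (m : ℕ) (u : ℝ) : ℂ :=
  2 * Real.exp (-(m ^ 2 * t / 2)) *
    (Complex.exp (-(1 / (2 * t)) * u ^ 2) * (chebDeriv ℂ n m).eval (shiftedCosh ζ u))

lemma integral_norm_gaussTerm_le (n m : ℕ) (ht : 0 < t) {ζ : ℂ} (hζ : ‖ζ‖ ≤ 1) :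
    ∫ u, ‖gaussTerm n t ζ m u‖ ≤ 2 * √(2 * Real.pi * t) *
      (2 * (m : ℝ) ^ (2 * n) * Real.exp (-(n * (m - n : ℕ) * t))) := by
  simp only [gaussTerm]
  simp_rw [fun u : ℝ => norm_mul (2 * Real.exp (-(m ^ 2 * t / 2)) : ℂ)
    (Complex.exp (-(1 / (2 * t)) * u ^ 2) * (chebDeriv ℂ n m).eval (shiftedCosh ζ u))]
  rw [integral_const_mul, norm_mul, Complex.norm_ofNat, Complex.norm_real, Real.norm_eq_abs,
    Real.abs_exp]
  have h1 : Real.exp (-(m ^ 2 * t / 2)) * Real.exp (((m - n : ℕ) : ℝ) ^ 2 * t / 2) ≤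
      Real.exp (-(n * (m - n : ℕ) * t)) := by
    rw [← Real.exp_add]
    apply Real.exp_le_exp.2
    rcases le_total n m with h | h
    · rw [Nat.cast_sub h]
      have : 0 ≤ (n : ℝ) ^ 2 * t := by positivity
      linarith
    · rw [Nat.sub_eq_zero_of_le h]
      have : 0 ≤ (m : ℝ) ^ 2 * t := by positivity
      simp only [Nat.cast_zero]
      linarith
  calc _ ≤ 2 * Real.exp (-(m ^ 2 * t / 2)) * (2 * √(2 * Real.pi * t) * (m : ℝ) ^ (2 * n) *
        Real.exp (((m - n : ℕ) : ℝ) ^ 2 * t / 2)) := by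
        gcongr
        exact integral_norm_gaussian_mul_eval_le n m ht hζ
    _ = 2 * √(2 * Real.pi * t) * (2 * (m : ℝ) ^ (2 * n) *
        (Real.exp (-(m ^ 2 * t / 2)) * Real.exp (((m - n : ℕ) : ℝ) ^ 2 * t / 2))) := by ring
    _ ≤ _ := by gcongr

lemma prefactor_mul (n : ℕ) (ht : 0 < t) :
    prefactor n t * (√(t / (2 * Real.pi)) * t ^ n) *
      (2 * √(2 * Real.pi * t) * Real.exp (-(n ^ 2 * t / 2))) = 2 / (2 * Real.pi) ^ (n + 1) := by
  have hp := Real.pi_pos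
  have h1 : √(t / (2 * Real.pi)) * √(2 * Real.pi * t) = t := by
    rw [← Real.sqrt_mul (by positivity)]
    rw [show t / (2 * Real.pi) * (2 * Real.pi * t) = t ^ 2 by field_simp]
    exact Real.sqrt_sq ht.le
  have h2 : Real.exp ((n : ℝ) ^ 2 / 2 * t) * Real.exp (-(n ^ 2 * t / 2)) = 1 := by
    rw [← Real.exp_add, Real.exp_eq_one_iff]
    ring
  rw [prefactor, mul_pow _ t]
  calc _ = (Real.exp ((n : ℝ) ^ 2 / 2 * t) * Real.exp (-(n ^ 2 * t / 2))) *
        (√(t / (2 * Real.pi)) * √(2 * Real.pi * t)) * t ^ n * 2 /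
        ((2 * Real.pi) ^ (n + 1) * t ^ (n + 1)) := by ring
    _ = _ := by
        rw [h1, h2, one_mul, pow_succ t n, mul_comm t]
        field_simp

/-- The heat kernel as a Gaussian average. -/
lemma prefactor_mul_integral (hn : 1 ≤ n) (ht : 0 < t) {w z : Cn n} (hw : ‖w‖ = 1)
    (hz : ‖z‖ = 1) :
    (prefactor n t : ℂ) * ∫ u, (√(t / (2 * Real.pi)) * t ^ n : ℝ) *
      ∑' m, gaussTerm n t (inner ℂ w z) m u = zonalHeatKernel n w t z := by
  have hζ := norm_inner_le_one hw hz
  have hsum := hasSum_integral_of_summable_integral_norm (μ := volume)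
    (F := gaussTerm n t (inner ℂ w z))
    (fun m => (integrable_gaussian_mul_eval n m ht (inner ℂ w z)).const_mul _)
    (Summable.of_nonneg_of_le (fun m => integral_nonneg fun u => norm_nonneg _)
      (fun m => integral_norm_gaussTerm_le n m ht hζ)
      ((summable_zonalBlock_bound hn ht).mul_left _))
  have hK := (Complex.hasSum_ofReal.2 (hasSum_zonalHeatKernel hn hw hz ht))
  rw [integral_const_mul, ← mul_assoc]
  refine (hsum.mul_left ((prefactor n t : ℂ) * (√(t / (2 * Real.pi)) * t ^ n : ℝ))).unique
    (hasSum_of_forall_eq hK fun m => ?_)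
  simp only [gaussTerm]
  rw [integral_const_mul, integral_gaussian_mul_eval n m ht, Complex.ofReal_mul,
    ofReal_poleBlock n m ht, ← prefactor_mul n ht]
  have e : Real.exp (-(n ^ 2 * t / 2)) = Real.exp (-(m ^ 2 * t / 2)) *
      Real.exp (((m : ℝ) ^ 2 - (n : ℝ) ^ 2) * t / 2) := by
    rw [← Real.exp_add]
    congr 1
    ring
  rw [e]
  push_cast
  ring

end GaussianAverage

/-! ### Zeros of `sinh κ` and the distance of `cosh κ` from `-1`. -/

section Exceptional

lemma ae_cosh_ne (a : ℝ) : ∀ᵐ u : ℝ, Real.cosh u ≠ a := by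
  by_cases h : ∃ u₀, Real.cosh u₀ = a
  · obtain ⟨u₀, rfl⟩ := h
    have hfin : ({u₀, -u₀} : Set ℝ).Finite := by simp
    filter_upwards [compl_mem_ae_iff.2 (hfin.measure_zero volume)] with u hu hc
    have h1 : |u| = |u₀| := le_antisymm (Real.cosh_le_cosh.1 hc.le) (Real.cosh_le_cosh.1 hc.ge)
    exact hu (abs_eq_abs.1 h1)
  · exact Eventually.of_forall fun u hu => h ⟨u, hu⟩

lemma re_mul_cosh (c φ u : ℝ) :
    ((c : ℂ) * Complex.cosh (u + Complex.I * φ)).re = c * (Real.cosh u * Real.cos φ) := by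
  rw [Complex.re_ofReal_mul, mul_comm Complex.I, Complex.cosh_add, Complex.cosh_mul_I,
    Complex.sinh_mul_I]
  simp [Complex.cos_ofReal_re, Complex.sin_ofReal_re, Complex.cosh_ofReal_re,
    Complex.sinh_ofReal_re]

lemma im_mul_cosh (c φ u : ℝ) :
    ((c : ℂ) * Complex.cosh (u + Complex.I * φ)).im = c * (Real.sinh u * Real.sin φ) := by
  rw [Complex.im_ofReal_mul, mul_comm Complex.I, Complex.cosh_add, Complex.cosh_mul_I,
    Complex.sinh_mul_I]
  simp [Complex.cos_ofReal_re, Complex.sin_ofReal_re, Complex.cosh_ofReal_re,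
    Complex.sinh_ofReal_re]

lemma ae_mul_cosh_ne (c φ : ℝ) {ε : ℝ} (hε : ε ≠ 0) :
    ∀ᵐ u : ℝ, (c : ℂ) * Complex.cosh (u + Complex.I * φ) ≠ ε := by
  filter_upwards [ae_cosh_ne (ε / (c * Real.cos φ))] with u hu h
  have h1 := congr_arg Complex.re h
  rw [re_mul_cosh, Complex.ofReal_re] at h1
  have h2 : Real.cosh u * (c * Real.cos φ) = ε := by rw [← h1]; ring
  have h3 : c * Real.cos φ ≠ 0 := fun h0 => hε (by rw [← h2, h0, mul_zero])
  exact hu ((eq_div_iff h3).2 h2)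

/-- A zero forces `cosh κ = ±1`, hence `cos ϑ₁ cos φ₁ cosh u = ±1`; for either sign this has at most
two solutions `u`. -/
lemma ae_sinh_kappa_ne_zero (θ φ : ℝ) : ∀ᵐ u : ℝ, Complex.sinh (kappa θ φ u) ≠ 0 := by
  filter_upwards [ae_mul_cosh_ne (Real.cos θ) φ one_ne_zero,
    ae_mul_cosh_ne (Real.cos θ) φ (neg_ne_zero.2 one_ne_zero)] with u h1 h2 h
  rw [← cosh_kappa] at h1 h2
  have h3 : Complex.cosh (kappa θ φ u) ^ 2 = 1 := by rw [Complex.cosh_sq, h]; ring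
  rcases sq_eq_one_iff.1 h3 with h4 | h4
  · exact h1 (by simpa using h4)
  · exact h2 (by simpa using h4)

/-- Let `p = c cosh u`. The real part `1 + p cos φ` suffices when `cos φ ≥ 0` or `p ≤ 1`. Otherwise
the squared modulus equals `(p + cos φ)² + (1 - c²) sin² φ`, and `p > 1`. -/
lemma min_one_le_norm_mul_cosh_add_one {c : ℝ} (hc0 : 0 ≤ c) (hc1 : c ≤ 1) (φ u : ℝ) :
    min 1 (1 + Real.cos φ) ≤ ‖(c : ℂ) * Complex.cosh (u + Complex.I * φ) + 1‖ := by
  set p := c * Real.cosh u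
  have hch := Real.one_le_cosh u
  have hp : 0 ≤ p := by positivity
  have hre : ((c : ℂ) * Complex.cosh (u + Complex.I * φ) + 1).re = p * Real.cos φ + 1 := by
    rw [Complex.add_re, re_mul_cosh, Complex.one_re]
    ring
  have him : ((c : ℂ) * Complex.cosh (u + Complex.I * φ) + 1).im =
      c * (Real.sinh u * Real.sin φ) := by
    rw [Complex.add_im, im_mul_cosh, Complex.one_im, add_zero]
  have hle := (le_abs_self _).trans
    (Complex.abs_re_le_norm ((c : ℂ) * Complex.cosh (u + Complex.I * φ) + 1))
  rw [hre] at hle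
  rcases le_or_gt 0 (Real.cos φ) with hφ | hφ
  · have := mul_nonneg hp hφ
    exact (min_le_left _ _).trans (by linarith)
  refine (min_le_right _ _).trans ?_
  rcases le_or_gt p 1 with hp1 | hp1
  · have : 1 * Real.cos φ ≤ p * Real.cos φ := mul_le_mul_of_nonpos_right hp1 hφ.le
    linarith
  · have hs : (1 + Real.cos φ) ^ 2 ≤
        ‖(c : ℂ) * Complex.cosh (u + Complex.I * φ) + 1‖ ^ 2 := by
      rw [Complex.sq_norm, Complex.normSq_apply, hre, him]
      have h1 := Real.cosh_sq u
      have h2 := Real.sin_sq_add_cos_sq φ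
      have h3 : 0 ≤ 1 + Real.cos φ := by linarith [Real.neg_one_le_cos φ]
      have h4 : (1 + Real.cos φ) ^ 2 ≤ (p + Real.cos φ) ^ 2 := by
        gcongr
      have h5 : 0 ≤ (1 - c ^ 2) * Real.sin φ ^ 2 :=
        mul_nonneg (by nlinarith) (sq_nonneg _)
      have h6 : (p * Real.cos φ + 1) * (p * Real.cos φ + 1) +
          c * (Real.sinh u * Real.sin φ) * (c * (Real.sinh u * Real.sin φ)) =
          (p + Real.cos φ) ^ 2 + (1 - c ^ 2) * Real.sin φ ^ 2 := by
        simp only [p]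
        linear_combination (-(c ^ 2) * Real.sin φ ^ 2) * h1 +
          (c ^ 2 * Real.cosh u ^ 2 - 1) * h2
      rw [h6]
      linarith
    exact le_of_sq_le_sq hs (norm_nonneg _)

end Exceptional

/-! ### An integrable majorant in `u` with summable constants in the pair index. -/

section Majorant

variable {t : ℝ}

lemma exists_pow_mul_exp_le (n : ℕ) : ∃ K, 0 ≤ K ∧ ∀ u : ℝ,
    (1 + |u|) ^ n * Real.exp (-(|u| / 2)) ≤ K * (1 + u ^ 2)⁻¹ := by
  refine ⟨2 ^ (n + 2) * (n + 2).factorial * Real.exp (1 / 2), by positivity, fun u => ?_⟩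
  have hu := abs_nonneg u
  have h1 := Real.pow_div_factorial_le_exp ((1 + |u|) / 2) (by positivity) (n + 2)
  rw [div_le_iff₀ (by positivity), div_pow, div_le_iff₀ (by positivity)] at h1
  have h2 : 1 + u ^ 2 ≤ (1 + |u|) ^ 2 := by
    rw [← sq_abs u]
    nlinarith
  rw [← div_eq_mul_inv, le_div_iff₀ (by positivity)]
  calc (1 + |u|) ^ n * Real.exp (-(|u| / 2)) * (1 + u ^ 2)
      ≤ (1 + |u|) ^ n * Real.exp (-(|u| / 2)) * (1 + |u|) ^ 2 := by gcongr
    _ = (1 + |u|) ^ (n + 2) * Real.exp (-(|u| / 2)) := by ring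
    _ ≤ (Real.exp ((1 + |u|) / 2) * (n + 2).factorial * 2 ^ (n + 2)) *
        Real.exp (-(|u| / 2)) := by gcongr
    _ = 2 ^ (n + 2) * (n + 2).factorial *
        (Real.exp ((1 + |u|) / 2) * Real.exp (-(|u| / 2))) := by ring
    _ = _ := by
        rw [← Real.exp_add]
        congr 2
        ring

/-- The Gaussian decay of the pairs. -/
def pairDecay (n : ℕ) (t : ℝ) (m : ℕ) : ℝ :=
  (1 + m : ℝ) ^ n * Real.exp (-(Real.pi * (m - 1 : ℕ)) ^ 2 / (2 * t))

lemma summable_pairDecay (n : ℕ) (ht : 0 < t) : Summable (pairDecay n t) := by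
  refine (summable_nat_add_iff 1).1 ?_
  set r := Real.exp (-Real.pi ^ 2 / (2 * t))
  have hp := Real.pi_pos
  have hr : r < 1 := Real.exp_lt_one_iff.2 (div_neg_of_neg_of_pos (by
    have : 0 < Real.pi ^ 2 := by positivity
    linarith) (by positivity))
  have hr0 : 0 < r := Real.exp_pos _
  refine Summable.of_nonneg_of_le (fun m => by unfold pairDecay; positivity) (fun m => ?_)
    (((summable_nat_add_iff 1).2 (summable_pow_mul_pow n hr0.le hr)).mul_left (2 ^ n * r⁻¹))
  have h1 : Real.exp (-(Real.pi * m) ^ 2 / (2 * t)) ≤ r ^ m := by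
    rw [← Real.exp_nat_mul, Real.exp_le_exp, mul_div_assoc']
    apply div_le_div_of_nonneg_right _ (by positivity)
    have h2 : (m : ℝ) ≤ m ^ 2 := by exact_mod_cast Nat.le_self_pow two_ne_zero m
    have := mul_le_mul_of_nonneg_left h2 (sq_nonneg Real.pi)
    rw [mul_pow]
    linarith
  rw [pairDecay, Nat.add_sub_cancel]
  calc _ ≤ (2 * ((m + 1 : ℕ) : ℝ)) ^ n * r ^ m := by
        gcongr
        push_cast
        linarith [Nat.cast_nonneg (α := ℝ) m]
    _ = _ := by
        rw [mul_pow, pow_succ r m]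
        field_simp

/-- The growth `e^{a²/2t}`, `a = |Re κ|`, may cancel the Gaussian in `u` entirely. If `a ≥ |u|/2`,
the factor `e^{-na}` still decays like `e^{-|u|/2}`; if `a ≤ |u|/2`, three quarters of the Gaussian
exponent survive. -/
lemma exists_gauss_mul_pairMajorant_le {n : ℕ} (hn : 1 ≤ n) (ht : 0 < t) :
    ∃ K, 0 ≤ K ∧ ∀ (m : ℕ) (a u : ℝ), 0 ≤ a → a ≤ |u| →
      Real.exp (-(1 / (2 * t)) * u ^ 2) * pairMajorant n t m a ≤
        pairDecay n t m * (K * (1 + u ^ 2)⁻¹) := by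
  obtain ⟨K, hK0, hK⟩ := exists_pow_mul_exp_le n
  refine ⟨Real.exp (t / 6) * K, by positivity, fun m a u ha hau => ?_⟩
  have hn' : (1 : ℝ) ≤ n := by exact_mod_cast hn
  have key : -(1 / (2 * t)) * u ^ 2 + -(n * a) + a ^ 2 / (2 * t) ≤ t / 6 + -(|u| / 2) := by
    have hna : a ≤ n * a := le_mul_of_one_le_left ha hn'
    have e : -(1 / (2 * t)) * u ^ 2 + a ^ 2 / (2 * t) = -((|u| ^ 2 - a ^ 2) / (2 * t)) := by
      rw [sq_abs]
      ring
    rcases le_total a (|u| / 2) with h | h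
    · have h1 : |u| ^ 2 * 3 / 4 ≤ |u| ^ 2 - a ^ 2 := by nlinarith
      have h2 : |u| / 2 - t / 6 ≤ (|u| ^ 2 - a ^ 2) / (2 * t) := by
        rw [le_div_iff₀ (by positivity)]
        -- `3u²/(8t) - |u|/2 + t/6 = (3|u| - 2t)²/(24t)`, which is where the constant `t/6` comes
        -- from.
        nlinarith [sq_nonneg (3 * |u| - 2 * t)]
      linarith
    · have h1 : 0 ≤ (|u| ^ 2 - a ^ 2) / (2 * t) := by
        apply div_nonneg _ (by positivity)
        nlinarith
      linarith
  calc Real.exp (-(1 / (2 * t)) * u ^ 2) * pairMajorant n t m a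
      = (1 + a) ^ n * (Real.exp (-(1 / (2 * t)) * u ^ 2 + -(n * a) + a ^ 2 / (2 * t))) *
        pairDecay n t m := by
        rw [pairMajorant, pairDecay, sub_div, sub_eq_add_neg, ← neg_div, Real.exp_add, Real.exp_add,
          Real.exp_add]
        ring_nf
    _ ≤ (1 + |u|) ^ n * Real.exp (t / 6 + -(|u| / 2)) * pairDecay n t m := by
        have : 0 ≤ pairDecay n t m := by unfold pairDecay; positivity
        gcongr
    _ = pairDecay n t m * (Real.exp (t / 6) * ((1 + |u|) ^ n * Real.exp (-(|u| / 2)))) := by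
        rw [Real.exp_add]
        ring
    _ ≤ pairDecay n t m * (Real.exp (t / 6) * (K * (1 + u ^ 2)⁻¹)) := by
        have : 0 ≤ pairDecay n t m := by unfold pairDecay; positivity
        exact mul_le_mul_of_nonneg_left (mul_le_mul_of_nonneg_left (hK u) (Real.exp_pos _).le) this
    _ = _ := by ring

end Majorant

end

section

/-! ### The two series representations. -/

section Representation

variable {n : ℕ} {t : ℝ} {w : Cn n} {P : ℝ → Cn n → ℝ}

lemma kappa_add_eq (θ φ u : ℝ) (k : ℤ) :
    kappa θ φ u + Complex.I * (2 * k * Real.pi) =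
      kappa θ φ u + (2 * k : ℤ) * (Real.pi * Complex.I) := by
  push_cast
  ring

/-- For `k = 0` both translates in `pairDeriv` coincide, hence the factor `1/2`. -/
lemma pairNeg_eq (hn : 1 ≤ n) (ht : t ≠ 0) (k : ℕ) (θ φ u : ℝ) :
    pairNeg n t k θ φ u = (if k = 0 then 1 / 2 else 1) *
      (Complex.exp (-(1 / (2 * t)) * u ^ 2) * pairDeriv n t (2 * k) (kappa θ φ u)) := by
  rw [pairNeg, pairDeriv]
  split_ifs with hk
  · subst hk
    rw [integrand_eq hn ht, kappa_add_eq]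
    push_cast
    rw [neg_zero]
    ring
  · rw [integrand_eq hn ht, integrand_eq hn ht, kappa_add_eq, kappa_add_eq, one_mul, mul_add]
    push_cast
    rw [mul_neg]

/-- Seen from `s = κ - πi`, the shifts `2kπi` and `-2(k + 1)πi` of `κ` become the opposite shifts
`±(2k + 1)πi` of `s`. -/
lemma pairNegSucc_eq (hn : 1 ≤ n) (ht : t ≠ 0) (k : ℕ) (θ φ u : ℝ) :
    pairNegSucc n t k θ φ u = Complex.exp (-(1 / (2 * t)) * u ^ 2) *
      pairDeriv n t (2 * k + 1) (kappa θ φ u - Real.pi * Complex.I) := by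
  rw [pairNegSucc, pairDeriv, integrand_eq hn ht, integrand_eq hn ht, mul_add]
  congr 3 <;> push_cast <;> ring

lemma measurable_integrand (hn : 1 ≤ n) (ht : t ≠ 0) (k : ℤ) (θ φ : ℝ) :
    Measurable (integrand n t k θ φ) := by
  have h : integrand n t k θ φ = fun u : ℝ => Complex.exp (-(1 / (2 * t)) * u ^ 2) *
      gaussDeriv n t (kappa θ φ u + Complex.I * (2 * k * Real.pi)) :=
    funext fun u => integrand_eq hn ht k θ φ u
  rw [h]
  have hg : Continuous fun u : ℝ => Complex.exp (-(1 / (2 * t)) * (u : ℂ) ^ 2) := by fun_prop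
  exact hg.measurable.mul ((measurable_gaussDeriv n t).comp
    ((measurable_kappa θ φ).add measurable_const))

lemma measurable_pairNeg (hn : 1 ≤ n) (ht : t ≠ 0) (k : ℕ) (θ φ : ℝ) :
    Measurable (pairNeg n t k θ φ) := by
  by_cases hk : k = 0
  · have : pairNeg n t k θ φ = integrand n t 0 θ φ := funext fun u => if_pos hk
    rw [this]
    exact measurable_integrand hn ht 0 θ φ
  · have : pairNeg n t k θ φ = fun u => integrand n t k θ φ u + integrand n t (-k) θ φ u :=
      funext fun u => if_neg hk
    rw [this]
    exact (measurable_integrand hn ht _ θ φ).add (measurable_integrand hn ht _ θ φ)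

lemma measurable_pairNegSucc (hn : 1 ≤ n) (ht : t ≠ 0) (k : ℕ) (θ φ : ℝ) :
    Measurable (pairNegSucc n t k θ φ) :=
  (measurable_integrand hn ht _ θ φ).add (measurable_integrand hn ht _ θ φ)

lemma hasSum_integrand (hn : 1 ≤ n) (ht : 0 < t) {θ φ u : ℝ}
    (hκ : Complex.sinh (kappa θ φ u) ≠ 0) :
    HasSum (fun k : ℤ => integrand n t k θ φ u) ((√(t / (2 * Real.pi)) * t ^ n : ℝ) *
      ∑' m, gaussTerm n t (Real.cos θ * Complex.exp (Complex.I * φ)) m u) := by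
  have h := (hasSum_gaussDeriv hn ht hκ).mul_left (Complex.exp (-(1 / (2 * t)) * u ^ 2))
  rw [mul_left_comm, ← tsum_mul_left] at h
  have e : ∀ m : ℕ, gaussTerm n t (Real.cos θ * Complex.exp (Complex.I * φ)) m u =
      Complex.exp (-(1 / (2 * t)) * u ^ 2) * (2 * Real.exp (-(m ^ 2 * t / 2)) *
        (chebDeriv ℂ n m).eval (Complex.cosh (kappa θ φ u))) := fun m => by
    rw [gaussTerm, shiftedCosh_polar, cosh_kappa]
    ring
  simp_rw [e]
  refine hasSum_of_forall_eq h fun k => ?_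
  rw [integrand_eq hn ht.ne', kappa_add_eq]

lemma HasSum.pairNeg {θ φ u : ℝ} {S : ℂ} (h : HasSum (fun k : ℤ => integrand n t k θ φ u) S) :
    HasSum (fun k : ℕ => CRSphere.pairNeg n t k θ φ u) S := by
  have h1 := h.nat_add_neg.sub (hasSum_ite_eq (0 : ℕ) (integrand n t 0 θ φ u))
  rw [add_sub_cancel_right] at h1
  refine hasSum_of_forall_eq h1 fun k => ?_
  rw [CRSphere.pairNeg]
  split_ifs with hk
  · subst hk
    simp
  · rw [sub_zero]

lemma HasSum.pairNegSucc {θ φ u : ℝ} {S : ℂ}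
    (h : HasSum (fun k : ℤ => integrand n t k θ φ u) S) :
    HasSum (fun k : ℕ => CRSphere.pairNegSucc n t k θ φ u) S := by
  refine hasSum_of_forall_eq h.nat_add_neg_add_one fun k => ?_
  rw [CRSphere.pairNegSucc, neg_add']

/-- Dominated families of integrands represent the heat kernel. -/
lemma representsOn_of_bound (hn : 1 ≤ n) (hw : ‖w‖ = 1) (hP : IsHeatKernel n w P) (ht : 0 < t)
    {F : ℕ → ℝ → ℝ → ℝ → ℂ} {A : Set ℝ} (hF : ∀ k θ φ, Measurable (F k θ φ)) {b : ℕ → ℝ}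
    (hb : Summable b) {B : ℝ → ℝ} (hB : Integrable B)
    (hbound : ∀ k, ∀ p ∈ region n w A, ∀ᵐ u, ‖F k p.1 p.2.1 u‖ ≤ b k * B u)
    (hsum : ∀ p ∈ region n w A, ∀ᵐ u, HasSum (fun k => F k p.1 p.2.1 u)
      ((√(t / (2 * Real.pi)) * t ^ n : ℝ) *
        ∑' m, gaussTerm n t (Real.cos p.1 * Complex.exp (Complex.I * p.2.1)) m u)) :
    RepresentsOn n t P F (region n w A) := by
  have hint : ∀ k, ∀ p ∈ region n w A, Integrable (F k p.1 p.2.1) := fun k p hp =>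
    (hB.const_mul (b k)).mono' (hF k p.1 p.2.1).aestronglyMeasurable (hbound k p hp)
  have hle : ∀ k, ∀ p ∈ region n w A, ∫ u, ‖F k p.1 p.2.1 u‖ ≤ b k * ∫ u, B u :=
    fun k p hp => by
      rw [← integral_const_mul]
      exact integral_mono_ae (hint k p hp).norm (hB.const_mul (b k)) (hbound k p hp)
  have hbB : Summable fun k => b k * ∫ u, B u := hb.mul_right _
  refine ⟨hint, (HasSumUniformlyOn.of_norm_le_summable hbB fun k p hp => ?_).summableUniformlyOn,
    (HasSumUniformlyOn.of_norm_le_summable (hbB.mul_left ‖(prefactor n t : ℂ)‖)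
      fun k p hp => ?_).congr_right fun p hp => ?_⟩
  · rw [Real.norm_of_nonneg (integral_nonneg fun u => norm_nonneg _)]
    exact hle k p hp
  · rw [norm_mul]
    exact mul_le_mul_of_nonneg_left ((norm_integral_le_integral_norm _).trans (hle k p hp))
      (norm_nonneg _)
  · obtain ⟨-, -, -, hz, hζ⟩ := id hp
    have h1 := hasSum_integral_of_summable_integral_norm (fun k => hint k p hp)
      (Summable.of_nonneg_of_le (fun k => integral_nonneg fun u => norm_nonneg _)
        (fun k => hle k p hp) hbB)
    have h2 : ∫ u, ∑' k, F k p.1 p.2.1 u = ∫ u, (√(t / (2 * Real.pi)) * t ^ n : ℝ) *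
        ∑' m, gaussTerm n t (inner ℂ w p.2.2) m u := by
      rw [hζ]
      refine integral_congr_ae ?_
      filter_upwards [hsum p hp] with u hu using hu.tsum_eq
    rw [h2] at h1
    change ∑' k, (prefactor n t : ℂ) * _ = _
    rw [(h1.mul_left _).tsum_eq, prefactor_mul_integral hn ht hw hz,
      hP.eq_zonalHeatKernel hn hw ht hz]

lemma cos_nonneg_of_mem_region {A : Set ℝ} {p : ℝ × ℝ × Cn n} (hp : p ∈ region n w A) :
    0 ≤ Real.cos p.1 :=
  Real.cos_nonneg_of_neg_pi_div_two_le_of_le (by linarith [hp.1, Real.pi_pos]) hp.2.1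

lemma norm_gauss (t u : ℝ) : ‖Complex.exp (-(1 / (2 * t)) * u ^ 2)‖ =
    Real.exp (-(1 / (2 * t)) * u ^ 2) := by
  have : (-(1 / (2 * t)) * u ^ 2 : ℂ) = ((-(1 / (2 * t)) * u ^ 2 : ℝ) : ℂ) := by push_cast; rfl
  rw [this, ← Complex.ofReal_exp, Complex.norm_real, Real.norm_eq_abs, Real.abs_exp]

/-- The common majorant of the Gaussian-weighted pairs. -/
lemma exists_bound_gauss_mul_pairDeriv (hn : 1 ≤ n) (ht : 0 < t) {η : ℝ} (hη : 0 < η) :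
    ∃ K, 0 ≤ K ∧ ∀ (m : ℕ) (s : ℂ) (u : ℝ), |s.im| ≤ Real.pi → η ≤ ‖Complex.cosh s + 1‖ →
      s ≠ 0 → |s.re| ≤ |u| →
      ‖Complex.exp (-(1 / (2 * t)) * u ^ 2) * pairDeriv n t m s‖ ≤
        pairDecay n t m * (K * (1 + u ^ 2)⁻¹) := by
  obtain ⟨C, hC0, hC⟩ := exists_bound_pairDeriv n ht hη
  obtain ⟨K, hK0, hK⟩ := exists_gauss_mul_pairMajorant_le hn ht
  refine ⟨C * K, by positivity, fun m s u him hc hs hre => ?_⟩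
  rw [norm_mul, norm_gauss]
  calc _ ≤ Real.exp (-(1 / (2 * t)) * u ^ 2) * (C * pairMajorant n t m |s.re|) := by
        gcongr
        exact hC m s him hc hs
    _ = C * (Real.exp (-(1 / (2 * t)) * u ^ 2) * pairMajorant n t m |s.re|) := by ring
    _ ≤ C * (pairDecay n t m * (K * (1 + u ^ 2)⁻¹)) :=
        mul_le_mul_of_nonneg_left (hK m _ u (abs_nonneg _) hre) hC0
    _ = _ := by ring

/-- The pairing takes care of `κ = 0`; the distance of `|φ₁|` from `π` keeps `cosh κ` away from
`-1`, hence `κ` away from `iπ`. -/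
lemma representsOn_pairNeg (hn : 1 ≤ n) (hw : ‖w‖ = 1) (hP : IsHeatKernel n w P) (ht : 0 < t)
    {δ : ℝ} (hδ : 0 < δ) :
    RepresentsOn n t P (pairNeg n t) (region n w {φ : ℝ | |φ| ≤ Real.pi - δ}) := by
  -- The cap keeps the angle in `[0, π]`, where `cos` is monotone; for `δ > π` the region is empty.
  set δ₀ := min δ Real.pi
  have hδ₀ : 0 < δ₀ := lt_min hδ Real.pi_pos
  have hcos : Real.cos δ₀ < 1 := by
    rw [← Real.cos_zero]
    exact Real.cos_lt_cos_of_nonneg_of_le_pi le_rfl (min_le_right _ _) hδ₀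
  obtain ⟨K, hK0, hK⟩ := exists_bound_gauss_mul_pairDeriv hn ht
    (η := min 1 (1 - Real.cos δ₀)) (lt_min one_pos (by linarith))
  refine representsOn_of_bound hn hw hP ht (measurable_pairNeg hn ht.ne')
    (b := fun k => pairDecay n t (2 * k))
    ((summable_pairDecay n ht).comp_injective (mul_right_injective₀ two_ne_zero))
    (integrable_inv_one_add_sq.const_mul K) (fun k p hp => ?_) fun p hp => ?_
  · filter_upwards [ae_sinh_kappa_ne_zero p.1 p.2.1] with u hu
    have hc := cos_nonneg_of_mem_region hp
    have hφ : |p.2.1| ≤ Real.pi - δ := hp.2.2.1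
    have hη : min 1 (1 - Real.cos δ₀) ≤ ‖Complex.cosh (kappa p.1 p.2.1 u) + 1‖ := by
      rw [cosh_kappa]
      refine le_trans (min_le_min_left _ ?_)
        (min_one_le_norm_mul_cosh_add_one hc (Real.cos_le_one _) p.2.1 u)
      have h1 : Real.cos (Real.pi - δ₀) ≤ Real.cos |p.2.1| :=
        Real.cos_le_cos_of_nonneg_of_le_pi (abs_nonneg _) (by linarith)
          (by linarith [min_le_left δ Real.pi])
      rw [Real.cos_pi_sub, Real.cos_abs] at h1
      linarith
    have h := hK (2 * k) (kappa p.1 p.2.1 u) u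
      (by rw [abs_of_nonneg (kappa_im_nonneg _ _ _)]; exact kappa_im_le_pi _ _ _) hη
      (fun h0 => hu (by rw [h0, Complex.sinh_zero])) (abs_kappa_re_le hc _ _)
    rw [pairNeg_eq hn ht.ne', norm_mul]
    refine (mul_le_of_le_one_left (norm_nonneg _) ?_).trans h
    split_ifs <;> norm_num
  · filter_upwards [ae_sinh_kappa_ne_zero p.1 p.2.1] with u hu
    exact HasSum.pairNeg (hasSum_integrand hn ht hu)

/-- With `s = κ - πi` one has `cosh s = -cosh κ`, which amounts to replacing `φ₁` by `φ₁ + π`. Thus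
`κ = iπ` is now the removable point `s = 0`, and `|φ₁| > δ` excludes `κ = 0`. -/
lemma representsOn_pairNegSucc (hn : 1 ≤ n) (hw : ‖w‖ = 1) (hP : IsHeatKernel n w P)
    (ht : 0 < t) {δ : ℝ} (hδ : 0 < δ) :
    RepresentsOn n t P (pairNegSucc n t)
      (region n w {φ : ℝ | δ < |φ| ∧ |φ| ≤ Real.pi}) := by
  set δ₀ := min δ Real.pi
  have hδ₀ : 0 < δ₀ := lt_min hδ Real.pi_pos
  have hcos : Real.cos δ₀ < 1 := by
    rw [← Real.cos_zero]
    exact Real.cos_lt_cos_of_nonneg_of_le_pi le_rfl (min_le_right _ _) hδ₀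
  obtain ⟨K, hK0, hK⟩ := exists_bound_gauss_mul_pairDeriv hn ht
    (η := min 1 (1 - Real.cos δ₀)) (lt_min one_pos (by linarith))
  refine representsOn_of_bound hn hw hP ht (measurable_pairNegSucc hn ht.ne')
    (b := fun k => pairDecay n t (2 * k + 1))
    ((summable_pairDecay n ht).comp_injective fun a b h => by simpa using h)
    (integrable_inv_one_add_sq.const_mul K) (fun k p hp => ?_) fun p hp => ?_
  · filter_upwards [ae_sinh_kappa_ne_zero p.1 p.2.1] with u hu
    have hc := cos_nonneg_of_mem_region hp
    obtain ⟨hφ, hφ'⟩ : δ < |p.2.1| ∧ |p.2.1| ≤ Real.pi := hp.2.2.1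
    set s := kappa p.1 p.2.1 u - Real.pi * Complex.I
    have hre : s.re = (kappa p.1 p.2.1 u).re := by simp [s]
    have him : s.im = (kappa p.1 p.2.1 u).im - Real.pi := by simp [s]
    have hs : Complex.cosh s =
        Real.cos p.1 * Complex.cosh (u + Complex.I * (p.2.1 + Real.pi : ℝ)) := by
      have e : (u : ℂ) + Complex.I * (p.2.1 + Real.pi : ℝ) =
          (u + Complex.I * p.2.1) + Real.pi * Complex.I := by
        push_cast
        ring
      rw [e, Complex.cosh_sub, Complex.cosh_add _ (Real.pi * Complex.I), Complex.cosh_mul_I,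
        Complex.sinh_mul_I, Complex.cos_pi, Complex.sin_pi, cosh_kappa]
      ring
    have hη : min 1 (1 - Real.cos δ₀) ≤ ‖Complex.cosh s + 1‖ := by
      rw [hs]
      refine le_trans (min_le_min_left _ ?_)
        (min_one_le_norm_mul_cosh_add_one hc (Real.cos_le_one _) (p.2.1 + Real.pi) u)
      have h1 : Real.cos |p.2.1| ≤ Real.cos δ₀ :=
        Real.cos_le_cos_of_nonneg_of_le_pi hδ₀.le hφ' ((min_le_left _ _).trans hφ.le)
      rw [Real.cos_add_pi, ← Real.cos_abs p.2.1]
      linarith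
    have hs0 : s ≠ 0 := fun h0 => hu (by
      rw [sub_eq_zero.1 h0, Complex.sinh_mul_I, Complex.sin_pi, zero_mul])
    rw [pairNegSucc_eq hn ht.ne']
    refine hK (2 * k + 1) s u ?_ hη hs0 (by rw [hre]; exact abs_kappa_re_le hc _ _)
    rw [him, abs_le]
    constructor <;> linarith [kappa_im_nonneg p.1 p.2.1 u, kappa_im_le_pi p.1 p.2.1 u]
  · filter_upwards [ae_sinh_kappa_ne_zero p.1 p.2.1] with u hu
    exact HasSum.pairNegSucc (hasSum_integrand hn ht hu)

end Representation

end

end CRSphere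

end

theorem theorem4p95 (n : ℕ) (hn : 1 ≤ n) (w : CRSphere.Cn n) (hw : ‖w‖ = 1) :
    (∃ P : ℝ → CRSphere.Cn n → ℝ, CRSphere.IsHeatKernel n w P) ∧
    ∀ P : ℝ → CRSphere.Cn n → ℝ, CRSphere.IsHeatKernel n w P → ∀ t : ℝ, 0 < t →
      (∀ δ' : ℝ, 0 < δ' →
        CRSphere.RepresentsOn n t P (CRSphere.pairNeg n t)
          (CRSphere.region n w {φ : ℝ | |φ| ≤ Real.pi - δ'})) ∧
      (∀ δ : ℝ, 0 < δ →
        CRSphere.RepresentsOn n t P (CRSphere.pairNegSucc n t)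
          (CRSphere.region n w {φ : ℝ | δ < |φ| ∧ |φ| ≤ Real.pi})) := by
  exact ⟨⟨_, CRSphere.isHeatKernel_zonalHeatKernel hn hw⟩, fun _ hP _ ht =>
    ⟨fun _ hδ => CRSphere.representsOn_pairNeg hn hw hP ht hδ,
      fun _ hδ => CRSphere.representsOn_pairNegSucc hn hw hP ht hδ⟩⟩
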